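/- For $x\in\mathbb R^3$ let $d_r(x)=\sqrt{x_1^2+x_2^2}$, and for $\omega>0$ let $F_\omega(y)=(-\omega y_2,\omega y_1,0)$ be the velocity field of the space rotating about the third axis with angular velocity $\omega$. Fix $\omega,\lambda,\sigma>0$ and a probability law $\nu$ on $\mathbb R^3$ with $\nu(B(0,1))=1$ ($B(0,1)$ the open unit ball) whose support has non-empty interior. Let $(\eta_k)_k$, $(\Delta_k)_k$, $(\xi_k)_k$ be mutually independent i.i.d. sequences, where $\eta_k$ has law $\nu$, $\Delta_k\sim\mathcal N(0,\sigma^2 I_3)$, and $\xi_k$ is exponential with rate $\lambda$. For every $u\neq0$ let $R_u\in SO(3)$ be a rotation matrix with $R_u(1,0,0)^{\mathsf T}=u/\|u\|$, chosen measurably in $u$ (the choice is otherwise arbitrary). Let $x_0,v_0\in\mathbb R^3$ with $(d_r(x_0),v_0)\neq(0,0)$. The particle starts at time $T_0=0$ with $X_0=x_0$, $V_0=v_0$. Given $(X_k,V_k,T_k)$, put $D_k(t)=\int_0^t\|V_k-F_\omega(X_k+sV_k)\|\,ds$ and let the next collision take place at time $T_{k+1}=T_k+D_k^{-1}(\xi_k)$,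 at the point $X_{k+1}=X_k+(T_{k+1}-T_k)V_k$. With $u=F_\omega(X_{k+1})+\Delta_{k+1}$ the new velocity is $$V_{k+1}=\|V_k-u\|\,R_{V_k-u}\,\eta_{k+1}+u$$ (which is $u$ if $V_k=u$). For $t\in[T_k,T_{k+1})$ put $X_t=X_k+(t-T_k)V_k$ and $V_t=V_k$. In particular $X_{T_k}=X_k$ and $V_{T_k}=V_k$; below, $X_n$ with an integer index $n$ is the position at the $n$-th collision. **Theorem.** Almost surely the particle is well defined for all times: $D_k(T_{k+1}-T_k)=\xi_k$ for all $k$, and the times $T_k$ increase strictly to infinity. Moreover, $$d_r(X_t)\to\infty\quad\text{as } t\to\infty,\ \text{almost surely and in probability,}$$ $$\frac{V_t}{F_\omega(X_t)}\to1\quad\text{as } t\to\infty,\ \text{almost surely and in probability, in the sense that}\quad \frac{\|V_t-F_\omega(X_t)\|}{\|F_\omega(X_t)\|}\to0,$$ and there is a (deterministic) $\beta>0$ such that $$\mathbb P\Big(\liminf_{n\to\infty}\{d_r(X_n)>\beta n\}\Big)=1,$$ i.e. almost surely $d_r(X_n)>\beta n$ for all large $n$. -/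

import Mathlib

open MeasureTheory ProbabilityTheory Filter Topology

namespace RotatingWalk

/-- Three-dimensional space with the Euclidean norm; positions and velocities. The
coordinates `x₁, x₂, x₃` are `x 0, x 1, x 2`. -/
abbrev E3 := EuclideanSpace ℝ (Fin 3)

/-- The radial distance: the distance to the third coordinate axis. -/
noncomputable def radialDist (x : E3) : ℝ := √(x 0 ^ 2 + x 1 ^ 2)

/-- The velocity field of the space rotating about the third axis with angular velocity `ω`. -/
noncomputable def rotField (ω : ℝ) (y : E3) : E3 := !₂[-(ω * y 1), ω * y 0, 0]

/-- The distance, relative to the rotating space, travelled up to time `t` by a particle that starts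
at `x` and moves on a straight line with constant velocity `v`. -/
noncomputable def relDist (ω : ℝ) (x v : E3) (t : ℝ) : ℝ :=
  ∫ s in (0 : ℝ)..t, ‖v - rotField ω (x + s • v)‖

/-- The duration of a flight of relative length `r`, that is, the value at `r` of the inverse function
of `t ↦ relDist ω x v t` on `t ≥ 0` (which is strictly increasing and tends to infinity unless
`v = 0` and `x` is on the rotation axis). -/
noncomputable def flightTime (ω : ℝ) (x v : E3) (r : ℝ) : ℝ :=
  sInf {t : ℝ | 0 ≤ t ∧ r ≤ relDist ω x v t}

/-- The action of a matrix on a vector. -/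
noncomputable def act (A : Matrix (Fin 3) (Fin 3) ℝ) (v : E3) : E3 := WithLp.toLp 2 (A.mulVec v.ofLp)

/-- A (measurable) choice, for every nonzero vector `u`, of a rotation matrix, i.e. an orthogonal
matrix of determinant one, that sends `(1, 0, 0)` to `u / ‖u‖`. -/
structure IsRotationChoice (R : E3 → Matrix (Fin 3) (Fin 3) ℝ) : Prop where
  measurable : ∀ i j, Measurable fun u => R u i j
  mem_SO : ∀ u, u ≠ 0 → R u ∈ Matrix.specialOrthogonalGroup (Fin 3) ℝ
  map_axis : ∀ u, u ≠ 0 → act (R u) !₂[1, 0, 0] = ‖u‖⁻¹ • u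

/-- The velocity of a particle with velocity `v` after the collision with a target of velocity `u`,
where `n` is the outcome of the normalised collision. -/
noncomputable def collide (R : E3 → Matrix (Fin 3) (Fin 3) ℝ) (v u n : E3) : E3 :=
  ‖v - u‖ • act (R (v - u)) n + u

/-- Position, velocity and time of the particle just after a collision. -/
structure ParticleState where
  pos : E3
  vel : E3
  time : ℝ

/-- The particle at its `k`-th collision, for given collision outcomes `η`, thermal velocities `Δ`
and free path lengths `ξ`. Between two collisions it moves on a straight line with constant velocity
until it has travelled the relative distance `ξ k`; then it collides with the medium, which at that
point has velocity `rotField ω x + Δ (k + 1)`. At time zero it is at `x₀` with velocity `v₀`. -/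
noncomputable def particle (ω : ℝ) (R : E3 → Matrix (Fin 3) (Fin 3) ℝ) (η Δ : ℕ → E3) (ξ : ℕ → ℝ)
    (x₀ v₀ : E3) : ℕ → ParticleState
  | 0 => ⟨x₀, v₀, 0⟩
  | k + 1 =>
    let p := particle ω R η Δ ξ x₀ v₀ k
    let τ := flightTime ω p.pos p.vel (ξ k)
    let x := p.pos + τ • p.vel
    ⟨x, collide R p.vel (rotField ω x + Δ (k + 1)) (η (k + 1)), p.time + τ⟩

/-- The number of the last collision up to time `t`, given the states `p k` at the collisions. -/
noncomputable def collisionIndex (p : ℕ → ParticleState) (t : ℝ) : ℕ := sSup {k | (p k).time ≤ t}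

/-- The velocity at time `t`, the velocity acquired at the last collision. -/
noncomputable def velAt (p : ℕ → ParticleState) (t : ℝ) : E3 := (p (collisionIndex p t)).vel

/-- The position at time `t`, by linear motion since the last collision. -/
noncomputable def posAt (p : ℕ → ParticleState) (t : ℝ) : E3 :=
  (p (collisionIndex p t)).pos + (t - (p (collisionIndex p t)).time) • velAt p t

/-- `V / F → 1` for vectors: the quotient `‖V - F‖ / ‖F‖`, the distance of `V` to `F` in units of
`‖F‖`, has to tend to zero. -/
noncomputable def relError (ω : ℝ) (p : ℕ → ParticleState) (t : ℝ) : ℝ :=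
  ‖velAt p t - rotField ω (posAt p t)‖ / ‖rotField ω (posAt p t)‖

/-- The random input: all `η k`, `Δ k`, `ξ k` are independent, `η k` has law `ν`, `Δ k` is a centred
normal vector with covariance matrix `σ² I`, and `ξ k` is exponential with rate `lam`. -/
structure IsCollisionNoise {Ω : Type*} [MeasurableSpace Ω] (μ : Measure Ω) (ν : Measure E3)
    (σ lam : ℝ) (η Δ : ℕ → Ω → E3) (ξ : ℕ → Ω → ℝ) : Prop where
  measurable_η : ∀ k, Measurable (η k)
  measurable_Δ : ∀ k, Measurable (Δ k)
  measurable_ξ : ∀ k, Measurable (ξ k)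
  indep : iIndepFun (fun k w => (η k w, Δ k w, ξ k w)) μ
  law : ∀ k, μ.map (fun w => (η k w, Δ k w, ξ k w)) =
    ν.prod ((multivariateGaussian 0 (σ ^ 2 • (1 : Matrix (Fin 3) (Fin 3) ℝ))).prod (expMeasure lam))

/-- Rotation choices exist: take the rotation in the plane of `(1, 0, 0)` and `u`. -/
theorem exists_isRotationChoice : ∃ R, IsRotationChoice R := by
  classical
  let M : ℝ → ℝ → ℝ → Matrix (Fin 3) (Fin 3) ℝ := fun a b c =>
    !![a, -b, -c; b, 1 - b ^ 2 / (1 + a), -(b * c / (1 + a)); c, -(b * c / (1 + a)),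
      1 - c ^ 2 / (1 + a)]
  let N : Matrix (Fin 3) (Fin 3) ℝ := !![-1, 0, 0; 0, -1, 0; 0, 0, 1]
  let R : E3 → Matrix (Fin 3) (Fin 3) ℝ := fun u =>
    if u 0 / ‖u‖ = -1 then N else M (u 0 / ‖u‖) (u 1 / ‖u‖) (u 2 / ‖u‖)
  have key : ∀ u : E3, u ≠ 0 →
      (u 0 / ‖u‖) ^ 2 + (u 1 / ‖u‖) ^ 2 + (u 2 / ‖u‖) ^ 2 = 1 := by
    intro u hu
    have h0 : ‖u‖ ≠ 0 := norm_ne_zero_iff.mpr hu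
    have h := EuclideanSpace.norm_sq_eq u
    simp only [Fin.sum_univ_three, Real.norm_eq_abs, sq_abs] at h
    field_simp
    linarith
  refine ⟨R, ?_, ?_, ?_⟩
  · intro i j
    have e : (fun u => R u i j) = fun u : E3 => if u 0 / ‖u‖ = -1 then N i j
        else M (u 0 / ‖u‖) (u 1 / ‖u‖) (u 2 / ‖u‖) i j := by
      funext u
      simp only [R]
      split_ifs <;> rfl
    rw [e]
    refine Measurable.ite (measurableSet_eq_fun (by fun_prop) (by fun_prop)) measurable_const ?_
    fin_cases i <;> fin_cases j <;> simp [M] <;> fun_prop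
  · intro u hu
    have k := key u hu
    simp only [R]
    generalize u 0 / ‖u‖ = a at k ⊢
    generalize u 1 / ‖u‖ = b at k ⊢
    generalize u 2 / ‖u‖ = c at k ⊢
    rw [Matrix.mem_specialOrthogonalGroup_iff, Matrix.mem_orthogonalGroup_iff]
    split_ifs with h
    · constructor
      · ext i j
        fin_cases i <;> fin_cases j <;> simp [N, Matrix.mul_apply, Fin.sum_univ_three]
      · simp [N, Matrix.det_fin_three]
    · have h1 : 1 + a ≠ 0 := fun h' => h (by linarith)
      have kc : c ^ 2 = 1 - a ^ 2 - b ^ 2 := by linarith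
      constructor
      · ext i j
        fin_cases i <;> fin_cases j <;> simp [M, Matrix.mul_apply, Fin.sum_univ_three] <;>
          field_simp <;> grind
      · simp [M, Matrix.det_fin_three]
        field_simp
        grind
  · intro u hu
    have k := key u hu
    simp only [R]
    split_ifs with h
    · rw [h] at k
      have hb : u 1 / ‖u‖ = 0 := by nlinarith [sq_nonneg (u 1 / ‖u‖), sq_nonneg (u 2 / ‖u‖)]
      have hc : u 2 / ‖u‖ = 0 := by nlinarith [sq_nonneg (u 1 / ‖u‖), sq_nonneg (u 2 / ‖u‖)]
      ext i
      fin_cases i <;>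
        simp [act, N, ← div_eq_inv_mul, h, hb, hc]
    · ext i
      fin_cases i <;>
        simp [act, M, ← div_eq_inv_mul]

end RotatingWalk

/-! In the rotating frame a free flight is motion in the centrifugal potential: `‖V - F‖² - ω² r²`
is conserved, where `r` is the radial distance (`energy_flight`). A collision shrinks the speed
relative to its target by the factor `‖η‖ < 1`, so up to thermal noise it dissipates energy. Summed
over the collisions (`energy_sum`), the dissipated energy reappears as growth of `ω² r²`: friction
drives the particle outwards.

The gain: a flight of relative length at least `c` from radial distance `r` has relative speed of
order `√r` at one of its ends (`flight_bound`, `speed_gain`), so two consecutive dissipative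
collisions gain a constant times `r`. The cost: noise contributes terms `u d + d²`. In units of `√r`
the incoming speed `u` is dominated by a contracting linear recursion with bounded eighth moments,
which almost surely grows more slowly than the fourth root (`linearRec_growth`); the cost over `n`
steps is then at most a small multiple of `n²`, up to lower-order terms. As long as `r k ≥ r 0 / 2 +
β k`, the gain is of order `β n²`, whereas the target `(β n)²` is quadratic in `β`. For small `β`
the induction closes (`EnergyWalk.linear_growth`), provided that the walk starts far out with `u ≤ K
√(r + 1)` and that the later input is good (`GoodFuture`).

Good futures have positive probability by the strong law and the moment bound
(`exists_goodFutures`). By a Lévy zero-one argument (`IsIID.frequently_and_future`) it suffices that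
the favourable starting state recurs infinitely often. First, `u ≤ K √(r + 1)` recurs, as otherwise
`u` would contract exponentially (`frequently_speed_le`). Second, if this happens infinitely often
at bounded radius, then a thermal kick, a long flight and a run of very short flights, together of
positive probability, infinitely often lead far out with moderate speed (`ae_frequently_far`).

So `r` grows linearly while relative speeds and path lengths are sublinear (`ae_escape`,
`ae_long_time`). This gives `V / F → 1`, and also `T k → ∞`, because a linear total path length is
travelled at sublinear relative speed. The thermal law charges no sphere, so the particle almost
surely never comes to rest (`ae_vel_ne_zero`). -/

namespace RotatingWalk

/-! ### Deterministic energy balance along the collisions. -/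

/-- The scalar relations along a trajectory: at the `k`-th collision, at radial distance `r k`, the
speed relative to the rotating space is `u k` before and `w k` after the collision; `a k` and `d k`
are the norms of the normalised outcome and of the thermal velocity, and `ξ k` is the length of the
flight that follows. -/
structure EnergyWalk (ω : ℝ) (r u w a d ξ : ℕ → ℝ) : Prop where
  r_nonneg : ∀ k, 0 ≤ r k
  u_nonneg : ∀ k, 0 ≤ u k
  w_nonneg : ∀ k, 0 ≤ w k
  a_nonneg : ∀ k, 0 ≤ a k
  a_le_one : ∀ k, a k ≤ 1
  d_nonneg : ∀ k, 0 ≤ d k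
  ξ_nonneg : ∀ k, 0 ≤ ξ k
  radial : ∀ k, |r (k + 1) - r k| ≤ 2 * ξ k
  energy : ∀ k, u (k + 1) ^ 2 = w k ^ 2 + ω ^ 2 * (r (k + 1) ^ 2 - r k ^ 2)
  collision : ∀ k, w k ≤ a k * (u k + d k) + d k
  flight : ∀ k, ω * (ω * r k - w k) * ξ k ≤ 2 * (w k ^ 2 + u (k + 1) ^ 2)

/-- The linear recursion that dominates the incoming relative speeds in units of the square root of
the radial distance. -/
noncomputable def speedBound (ω K : ℝ) (a d ξ : ℕ → ℝ) : ℕ → ℝ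
  | 0 => K
  | k + 1 => a k * speedBound ω K a d ξ k + (2 * d k + ω + 3 * ω * ξ k)

/-- Indicator of a collision that dissipates energy and is followed by a long enough flight. -/
noncomputable def dissipative (ε c : ℝ) (a ξ : ℝ) : ℝ := if a ≤ 1 - ε ∧ c ≤ ξ then 1 else 0

lemma dissipative_mem (ε c a ξ : ℝ) : dissipative ε c a ξ = 0 ∨ dissipative ε c a ξ = 1 := by
  unfold dissipative; split_ifs <;> simp

/-- The conditions on the random input from some time on that force linear growth. -/
structure GoodFuture (ω K ε c C₀ θ M : ℝ) (a d ξ : ℕ → ℝ) : Prop where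
  path : ∀ n : ℕ, ∑ j ∈ Finset.range n, ξ j ≤ C₀ * n + M
  count : ∀ n : ℕ, 3 / 4 * (n : ℝ) - M ≤ ∑ j ∈ Finset.range n, dissipative ε c (a j) (ξ j)
  speed : ∀ n : ℕ, speedBound ω K a d ξ n ^ 4 ≤ θ ^ 2 * (n + M)

namespace EnergyWalk

variable {ω : ℝ} {r u w a d ξ : ℕ → ℝ}

lemma shift (h : EnergyWalk ω r u w a d ξ) (m : ℕ) :
    EnergyWalk ω (fun k => r (m + k)) (fun k => u (m + k)) (fun k => w (m + k))
      (fun k => a (m + k)) (fun k => d (m + k)) (fun k => ξ (m + k)) where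
  r_nonneg _ := h.r_nonneg _
  u_nonneg _ := h.u_nonneg _
  w_nonneg _ := h.w_nonneg _
  a_nonneg _ := h.a_nonneg _
  a_le_one _ := h.a_le_one _
  d_nonneg _ := h.d_nonneg _
  ξ_nonneg _ := h.ξ_nonneg _
  radial k := h.radial (m + k)
  energy k := h.energy (m + k)
  collision _ := h.collision _
  flight k := h.flight (m + k)

lemma collision' (h : EnergyWalk ω r u w a d ξ) (k : ℕ) : w k ≤ a k * u k + 2 * d k := by
  have := h.collision k
  nlinarith [mul_le_mul_of_nonneg_right (h.a_le_one k) (h.d_nonneg k)]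

/-- The radial bound gives `r (k+1)² - r k² ≤ 4 r ξ + 4 ξ²`, and `4 ξ ≤ (1 + ξ)²` makes this at most
the square of `√r (1 + ξ) + 2 ξ`. A flight thus adds speed of order `√r` only, which makes `√r` the
natural unit of speed. -/
lemma incoming_le (hω : 0 ≤ ω) (h : EnergyWalk ω r u w a d ξ) (k : ℕ) :
    u (k + 1) ≤ w k + ω * √(r k) * (1 + ξ k) + 2 * ω * ξ k := by
  have hw := h.w_nonneg k
  have hr := h.r_nonneg k
  have hx := h.ξ_nonneg k
  have hs := Real.sq_sqrt hr
  have hs0 := Real.sqrt_nonneg (r k)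
  set s := √(r k)
  have h1 : r (k + 1) ≤ r k + 2 * ξ k := by linarith [(abs_le.1 (h.radial k)).2]
  have h2 : r (k + 1) ^ 2 ≤ (r k + 2 * ξ k) ^ 2 := pow_le_pow_left₀ (h.r_nonneg _) h1 2
  have h3 : r (k + 1) ^ 2 - r k ^ 2 ≤ 4 * s ^ 2 * ξ k + 4 * ξ k ^ 2 := by rw [hs]; linarith
  have h4 : r (k + 1) ^ 2 - r k ^ 2 ≤ (s * (1 + ξ k) + 2 * ξ k) ^ 2 := by
    have : 0 ≤ s * ξ k * (1 + ξ k) := by positivity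
    nlinarith [mul_nonneg (sq_nonneg s) (sq_nonneg (1 - ξ k))]
  have h5 : 0 ≤ s * (1 + ξ k) + 2 * ξ k := by positivity
  have e : w k + ω * s * (1 + ξ k) + 2 * ω * ξ k = w k + ω * (s * (1 + ξ k) + 2 * ξ k) := by ring
  rw [e]
  refine abs_le_of_sq_le_sq' ?_ (by positivity) |>.2
  rw [h.energy]
  have : ω ^ 2 * (r (k + 1) ^ 2 - r k ^ 2) ≤ ω ^ 2 * (s * (1 + ξ k) + 2 * ξ k) ^ 2 :=
    mul_le_mul_of_nonneg_left h4 (sq_nonneg _)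
  nlinarith [mul_nonneg hw (mul_nonneg hω h5)]

lemma radial_le_sum (h : EnergyWalk ω r u w a d ξ) (n : ℕ) :
    r n ≤ r 0 + 2 * ∑ j ∈ Finset.range n, ξ j := by
  induction n with
  | zero => simp
  | succ n ih =>
    rw [Finset.sum_range_succ]
    linarith [(abs_le.1 (h.radial n)).2]

lemma speedBound_nonneg (hω : 0 ≤ ω) (h : EnergyWalk ω r u w a d ξ) {K : ℝ} (hK : 0 ≤ K) (n : ℕ) :
    0 ≤ speedBound ω K a d ξ n := by
  induction n with
  | zero => simpa [speedBound]
  | succ n ih =>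
    have := h.a_nonneg n
    have := h.d_nonneg n
    have := h.ξ_nonneg n
    simp only [speedBound]
    positivity

/-- Domination of the incoming speeds. -/
lemma speed_le (hω : 0 ≤ ω) (h : EnergyWalk ω r u w a d ξ) {K C₀ M : ℝ} (hK : 0 ≤ K)
    (hC : 0 ≤ C₀) (hM : 0 ≤ M) (hpath : ∀ n : ℕ, ∑ j ∈ Finset.range n, ξ j ≤ C₀ * n + M)
    (h0 : u 0 ≤ K * √(r 0 + 1)) (n : ℕ) :
    u n ≤ √(r 0 + 2 * C₀ * n + 2 * M + 1) * speedBound ω K a d ξ n := by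
  have hr0 := h.r_nonneg 0
  induction n with
  | zero =>
    simp only [speedBound]
    rw [mul_comm] at h0
    refine h0.trans (mul_le_mul_of_nonneg_right (Real.sqrt_le_sqrt ?_) hK)
    simp; linarith
  | succ n ih =>
    have ha := h.a_nonneg n
    have hd := h.d_nonneg n
    have hx := h.ξ_nonneg n
    have hn : (0 : ℝ) ≤ n := Nat.cast_nonneg n
    have hY := h.speedBound_nonneg hω hK n
    have hrn : r n ≤ r 0 + 2 * C₀ * n + 2 * M + 1 := by
      linarith [h.radial_le_sum n, hpath n]
    set S := √(r 0 + 2 * C₀ * n + 2 * M + 1)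
    set S' := √(r 0 + 2 * C₀ * (n + 1 : ℕ) + 2 * M + 1)
    have hSS' : S ≤ S' := Real.sqrt_le_sqrt (by push_cast; nlinarith)
    have hS1 : 1 ≤ S := Real.one_le_sqrt.2 (by nlinarith [mul_nonneg hC hn])
    have hS0 : 0 ≤ S := by linarith
    have hrS : √(r n) ≤ S := Real.sqrt_le_sqrt hrn
    have h1 := h.incoming_le hω n
    have h2 := h.collision' n
    have h3 : a n * u n ≤ a n * (S * speedBound ω K a d ξ n) := mul_le_mul_of_nonneg_left ih ha
    have h4 : ω * √(r n) * (1 + ξ n) ≤ ω * S * (1 + ξ n) := by gcongr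
    -- Since `S ≥ 1`, the terms that do not carry `√r` may be multiplied by `S` as well; this is
    -- where `2 d + 3 ω ξ` in `speedBound` comes from.
    have h5 : u (n + 1) ≤ S * (a n * speedBound ω K a d ξ n + (2 * d n + ω + 3 * ω * ξ n)) := by
      have : 0 ≤ (S - 1) * (2 * d n + 2 * ω * ξ n) := mul_nonneg (by linarith) (by positivity)
      nlinarith
    simp only [speedBound]
    exact h5.trans (mul_le_mul_of_nonneg_right hSS' (by positivity))

/-- Conservation during flights telescopes: the squared radius can only change by what the
collisions dissipate and by the current kinetic energy. -/
lemma energy_sum (h : EnergyWalk ω r u w a d ξ) (n : ℕ) :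
    ω ^ 2 * (r n ^ 2 - r 0 ^ 2) =
      u n ^ 2 - u 0 ^ 2 + ∑ k ∈ Finset.range n, (u k ^ 2 - w k ^ 2) := by
  induction n with
  | zero => simp
  | succ n ih =>
    rw [Finset.sum_range_succ]
    linarith [h.energy n]

/-- Squaring `w ≤ a u + 2 d` leaves `(1 - a²) u²`, at least `ε u²` at a dissipative collision
because `1 - a² ≥ 1 - a`. The mixed terms are the heating by thermal noise. -/
lemma dissipation_ge (h : EnergyWalk ω r u w a d ξ) (ε c : ℝ) (k : ℕ) :
    ε * (dissipative ε c (a k) (ξ k) * u k ^ 2) - (4 * (u k * d k) + 4 * d k ^ 2)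
      ≤ u k ^ 2 - w k ^ 2 := by
  have ha := h.a_nonneg k
  have ha1 := h.a_le_one k
  have hu := h.u_nonneg k
  have hd := h.d_nonneg k
  have h1 : w k ^ 2 ≤ (a k * u k + 2 * d k) ^ 2 :=
    pow_le_pow_left₀ (h.w_nonneg k) (h.collision' k) 2
  have h2 : ε * dissipative ε c (a k) (ξ k) ≤ 1 - a k ^ 2 := by
    unfold dissipative
    split_ifs with hg
    · nlinarith [hg.1]
    · nlinarith
  have h3 := mul_le_mul_of_nonneg_right h2 (sq_nonneg (u k))
  have h4 : a k * (u k * d k) ≤ u k * d k := mul_le_of_le_one_left (by positivity) ha1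
  nlinarith

lemma outgoing_sq_le (h : EnergyWalk ω r u w a d ξ) (k : ℕ) :
    w k ^ 2 ≤ 2 * u k ^ 2 + 8 * d k ^ 2 := by
  have hu := h.u_nonneg k
  have hd := h.d_nonneg k
  have hau : a k * u k ≤ u k := mul_le_of_le_one_left hu (h.a_le_one k)
  have h1 : w k ≤ u k + 2 * d k := by linarith [h.collision' k]
  have h2 := pow_le_pow_left₀ (h.w_nonneg k) h1 2
  nlinarith [sq_nonneg (u k - 2 * d k)]

/-- Either the outgoing speed is at least `ω r / 2`, and `r ≥ c` settles the claim, or the factor `ω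
r - w` in `flight` is at least `ω r / 2`. The collision inequality then trades `w` for `u` and `d`.
-/
lemma speed_gain (hω : 0 < ω) (h : EnergyWalk ω r u w a d ξ) {c : ℝ} (hc : 0 ≤ c) (k : ℕ)
    (hx : c ≤ ξ k) (hr : c ≤ r k) :
    c * ω ^ 2 / 4 * r k ≤ 2 * u k ^ 2 + u (k + 1) ^ 2 + 8 * d k ^ 2 := by
  have h1 := h.outgoing_sq_le k
  have h2 := h.flight k
  have hr0 := h.r_nonneg k
  suffices c * ω ^ 2 / 4 * r k ≤ w k ^ 2 + u (k + 1) ^ 2 by linarith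
  rcases le_or_gt (w k) (ω * r k / 2) with hw | hw
  · have h3 : ω * (ω * r k / 2) * c ≤ ω * (ω * r k - w k) * ξ k := by
      have h4 : 0 ≤ ω * r k / 2 := by positivity
      exact mul_le_mul (mul_le_mul_of_nonneg_left (by linarith) hω.le) hx hc
        (mul_nonneg hω.le (by linarith))
    nlinarith
  · have h3 : (ω * r k / 2) ^ 2 ≤ w k ^ 2 := pow_le_pow_left₀ (by positivity) hw.le 2
    have h4 : c * (ω ^ 2 / 4 * r k) ≤ r k * (ω ^ 2 / 4 * r k) :=
      mul_le_mul_of_nonneg_right hr (by positivity)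
    nlinarith [sq_nonneg (u (k + 1))]

end EnergyWalk

/-- Weights in `[0, 1]` of total mass `P` make `∑ k p k` smallest when they fill the lowest indices,
which gives about `P² / 2`. -/
lemma sum_range_mul_ge (p : ℕ → ℝ) (h0 : ∀ k, 0 ≤ p k) (h1 : ∀ k, p k ≤ 1) (n : ℕ) :
    (∑ k ∈ Finset.range n, p k) * (∑ k ∈ Finset.range n, p k - 1) / 2
      ≤ ∑ k ∈ Finset.range n, (k : ℝ) * p k := by
  have hP : ∀ n : ℕ, ∑ k ∈ Finset.range n, p k ≤ n := fun n => by
    simpa using Finset.sum_le_sum (s := Finset.range n) fun k _ => h1 k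
  induction n with
  | zero => simp
  | succ n ih =>
    rw [Finset.sum_range_succ, Finset.sum_range_succ]
    have := mul_le_mul_of_nonneg_right (hP n) (h0 n)
    nlinarith [h0 n, h1 n]

/-! ### Energy balance under a good future. -/

namespace EnergyWalk

variable {ω : ℝ} {r u w a d ξ : ℕ → ℝ}

/-- With `q = √(k + 1 + M)`, the fourth-power bound in `GoodFuture` says `Y² ≤ θ q` for two
consecutive values of the recursion. The first controls `u ≤ S Y`, the second `2 d`, and `S q` is
linear in `k` by the inequality of arithmetic and geometric means. -/
lemma loss_le (hω : 0 ≤ ω) (h : EnergyWalk ω r u w a d ξ) {K ε c C₀ θ M : ℝ} (hK : 0 ≤ K)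
    (hC : 0 ≤ C₀) (hM : 0 ≤ M) (hθ : 0 ≤ θ) (hg : GoodFuture ω K ε c C₀ θ M a d ξ)
    (h0 : u 0 ≤ K * √(r 0 + 1)) (k : ℕ) :
    4 * (u k * d k) + 8 * d k ^ 2 ≤ 4 * θ * (r 0 + (2 * C₀ + 1) * k + 2 * M + 1) := by
  have hr0 := h.r_nonneg 0
  have hk : (0 : ℝ) ≤ k := Nat.cast_nonneg k
  have hCk := mul_nonneg hC hk
  have hd := h.d_nonneg k
  have hu := h.speed_le hω hK hC hM hg.path h0 k
  have hY := h.speedBound_nonneg hω hK k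
  have hY' := h.speedBound_nonneg hω hK (k + 1)
  have hd' : 2 * d k ≤ speedBound ω K a d ξ (k + 1) := by
    have := mul_nonneg (h.a_nonneg k) hY
    have := mul_nonneg hω (h.ξ_nonneg k)
    simp only [speedBound]
    linarith
  have b1 := hg.speed k
  have b2 := hg.speed (k + 1)
  set Y := speedBound ω K a d ξ k
  set Y' := speedBound ω K a d ξ (k + 1)
  set q := √((k : ℝ) + 1 + M)
  have hq : q ^ 2 = k + 1 + M := Real.sq_sqrt (by linarith)
  have hq0 : 0 ≤ q := Real.sqrt_nonneg _
  set S := √(r 0 + 2 * C₀ * k + 2 * M + 1)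
  have hS : S ^ 2 = r 0 + 2 * C₀ * k + 2 * M + 1 := Real.sq_sqrt (by linarith)
  have hS0 : 0 ≤ S := Real.sqrt_nonneg _
  set R' := r 0 + (2 * C₀ + 1) * k + 2 * M + 1 with hR'
  have c1 : Y ^ 2 ≤ θ * q := by
    refine abs_le_of_sq_le_sq' (b := θ * q) ?_ (by positivity) |>.2
    rw [mul_pow, hq, ← pow_mul]
    exact b1.trans (mul_le_mul_of_nonneg_left (by linarith) (sq_nonneg _))
  have c2 : Y' ^ 2 ≤ θ * q := by
    refine abs_le_of_sq_le_sq' (b := θ * q) ?_ (by positivity) |>.2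
    rw [mul_pow, hq, ← pow_mul]
    refine b2.trans (mul_le_mul_of_nonneg_left ?_ (sq_nonneg _))
    push_cast; linarith
  have c3 : Y * Y' ≤ θ * q := by nlinarith [sq_nonneg (Y - Y')]
  have c4 : S * q ≤ R' := by nlinarith [sq_nonneg (S - q)]
  have c5 : q ≤ R' := by nlinarith [sq_nonneg (q - 1)]
  have c6 : u k * d k ≤ S * Y * (Y' / 2) := mul_le_mul hu (by linarith) hd (by positivity)
  have c7 : S * (Y * Y') ≤ S * (θ * q) := mul_le_mul_of_nonneg_left c3 hS0
  have c8 : θ * (S * q) ≤ θ * R' := mul_le_mul_of_nonneg_left c4 hθ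
  have c9 : θ * q ≤ θ * R' := mul_le_mul_of_nonneg_left c5 hθ
  have c10 : (2 * d k) ^ 2 ≤ Y' ^ 2 := pow_le_pow_left₀ (by positivity) hd' 2
  nlinarith

/-- Combines the telescoped energy, the dissipation and the gain. Only pairs of consecutive
dissipative collisions count, since the large speed produced by a flight may occur at either of its
ends. -/
lemma energy_ge (hω : 0 < ω) (h : EnergyWalk ω r u w a d ξ) {K ε c C₀ θ M : ℝ} (hK : 0 ≤ K)
    (hε : 0 < ε) (hε1 : ε ≤ 1) (hc : 0 ≤ c)
    (hC : 0 ≤ C₀) (hM : 0 ≤ M) (hθ : 0 ≤ θ) (hg : GoodFuture ω K ε c C₀ θ M a d ξ)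
    (h0 : u 0 ≤ K * √(r 0 + 1)) (n : ℕ) (hr : ∀ k < n, c ≤ r k) :
    ω ^ 2 * r 0 ^ 2 - K ^ 2 * (r 0 + 1) +
      ε * c * ω ^ 2 / 12 * ∑ k ∈ Finset.range n,
        dissipative ε c (a k) (ξ k) * dissipative ε c (a (k + 1)) (ξ (k + 1)) * r k -
      4 * θ * (n * (r 0 + 2 * M + 1) + (2 * C₀ + 1) * n ^ 2 / 2) ≤ ω ^ 2 * r n ^ 2 := by
  have hr0 := h.r_nonneg 0
  set e : ℕ → ℝ := fun k => dissipative ε c (a k) (ξ k) with he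
  have e01 : ∀ k, e k = 0 ∨ e k = 1 := fun k => dissipative_mem _ _ _ _
  have e0 : ∀ k, 0 ≤ e k := fun k => by rcases e01 k with h | h <;> simp [h]
  have hloss : ∑ k ∈ Finset.range n, (4 * (u k * d k) + 8 * d k ^ 2) ≤
      4 * θ * (n * (r 0 + 2 * M + 1) + (2 * C₀ + 1) * n ^ 2 / 2) := by
    refine (Finset.sum_le_sum fun k _ => h.loss_le hω.le hK hC hM hθ hg h0 k).trans ?_
    rw [← Finset.mul_sum]
    refine mul_le_mul_of_nonneg_left ?_ (by positivity)
    clear hr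
    induction n with
    | zero => simp
    | succ n ih => rw [Finset.sum_range_succ]; push_cast; nlinarith
  -- A squared speed is counted twice as the start and once as the end of a pair, hence the factor
  -- 3. Shifting the index costs the boundary term `u n ^ 2`, which the energy balance supplies.
  have hgain : c * ω ^ 2 / 4 * ∑ k ∈ Finset.range n, e k * e (k + 1) * r k ≤
      3 * (∑ k ∈ Finset.range n, e k * u k ^ 2 + u n ^ 2) +
      ∑ k ∈ Finset.range n, 8 * d k ^ 2 := by
    have hs : ∀ k ∈ Finset.range n, c * ω ^ 2 / 4 * (e k * e (k + 1) * r k) ≤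
        2 * (e k * u k ^ 2) + e (k + 1) * u (k + 1) ^ 2 + 8 * d k ^ 2 := by
      intro k hk
      rcases e01 k with h1 | h1 <;> rcases e01 (k + 1) with h2 | h2
      · simp [h1, h2]; positivity
      · simp [h1, h2]; positivity
      · simp [h1, h2]; positivity
      · have hx : c ≤ ξ k := by
          by_contra hcon
          simp [he, dissipative, hcon] at h1
        have := h.speed_gain hω hc k hx (hr k (Finset.mem_range.1 hk))
        simp [h1, h2]; linarith
    rw [Finset.mul_sum]
    refine (Finset.sum_le_sum hs).trans ?_
    rw [Finset.sum_add_distrib, Finset.sum_add_distrib, ← Finset.mul_sum]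
    have ht : ∑ k ∈ Finset.range n, e (k + 1) * u (k + 1) ^ 2 ≤
        ∑ k ∈ Finset.range n, e k * u k ^ 2 + u n ^ 2 := by
      have h1 := Finset.sum_range_succ (fun k => e k * u k ^ 2) n
      have h2 := Finset.sum_range_succ' (fun k => e k * u k ^ 2) n
      have h3 : e n * u n ^ 2 ≤ u n ^ 2 := by
        rcases e01 n with h | h <;> simp [h]; positivity
      have h4 := mul_nonneg (e0 0) (sq_nonneg (u 0))
      linarith
    linarith [sq_nonneg (u n)]
  have hsum := h.energy_sum n
  have hdis : ε * ∑ k ∈ Finset.range n, e k * u k ^ 2 -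
      ∑ k ∈ Finset.range n, (4 * (u k * d k) + 4 * d k ^ 2) ≤
      ∑ k ∈ Finset.range n, (u k ^ 2 - w k ^ 2) := by
    rw [Finset.mul_sum, ← Finset.sum_sub_distrib]
    exact Finset.sum_le_sum fun k _ => h.dissipation_ge ε c k
  have hu0 : u 0 ^ 2 ≤ K ^ 2 * (r 0 + 1) := by
    have := pow_le_pow_left₀ (h.u_nonneg 0) h0 2
    rwa [mul_pow, Real.sq_sqrt (by linarith)] at this
  have hd2 : ∑ k ∈ Finset.range n, (4 * (u k * d k) + 8 * d k ^ 2) =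
      ∑ k ∈ Finset.range n, (4 * (u k * d k) + 4 * d k ^ 2) +
      (∑ k ∈ Finset.range n, 8 * d k ^ 2) / 2 := by
    rw [Finset.sum_div, ← Finset.sum_add_distrib]
    exact Finset.sum_congr rfl fun k _ => by ring
  have hD : 0 ≤ ∑ k ∈ Finset.range n, 8 * d k ^ 2 := Finset.sum_nonneg fun k _ => by positivity
  -- The factor `ε / 3` matches the gain to the dissipation `ε ∑ e u²`. What remains, `8 ε d² / 3`,
  -- is below the spare `4 d²` in `hloss`.
  have hg' := mul_le_mul_of_nonneg_left hgain (by positivity : 0 ≤ ε / 3)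
  have h5 : ε * (∑ k ∈ Finset.range n, 8 * d k ^ 2) ≤ ∑ k ∈ Finset.range n, 8 * d k ^ 2 :=
    mul_le_of_le_one_left hD hε1
  have h6 : ε * u n ^ 2 ≤ u n ^ 2 := mul_le_of_le_one_left (sq_nonneg _) hε1
  have h7 : ε * c * ω ^ 2 / 12 * ∑ k ∈ Finset.range n, e k * e (k + 1) * r k =
    ε / 3 * (c * ω ^ 2 / 4 * ∑ k ∈ Finset.range n, e k * e (k + 1) * r k) := by ring
  rw [h7]
  linarith

end EnergyWalk

/-! ### The bootstrap for linear growth. -/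

/-- Here `ρ` is the initial radius and `P` the number of dissipative pairs. Of order `n²`, the gain
`κ β n² / 32` is shared equally by the target `ω² β² n²` and the noise. The terms in `n ρ` are
covered by `κ n ρ / 4`, and all constants by the surplus `3/4 ω² ρ²`, as `ρ` is large. -/
lemma growth_arith {κ ω β θ C₀ K M ρ n P : ℝ} (hκ : 0 < κ) (hβ : 0 < β)
    (hβ1 : β ≤ 1) (hβκ : 64 * ω ^ 2 * β ≤ κ) (hC : 0 ≤ C₀) (hM : 0 ≤ M)
    (hθ : 128 * (2 * C₀ + 1) * θ = κ * β) (hn : 0 ≤ n) (hP : n / 2 - (2 * M + 1) ≤ P)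
    (hρ1 : 1 ≤ ρ) (hρM : 2 * M + 1 ≤ ρ)
    (hρ : 2 * K ^ 2 + κ * (2 * M + 1) / 2 + κ * ((2 * M + 1) ^ 2 + 1) / 4 ≤ 3 / 4 * ω ^ 2 * ρ) :
    ω ^ 2 * (ρ / 2 + β * n) ^ 2 ≤ ω ^ 2 * ρ ^ 2 - K ^ 2 * (ρ + 1) +
      κ * (ρ / 2 * P + β * (P * (P - 1) / 2)) -
      4 * θ * (n * (ρ + 2 * M + 1) + (2 * C₀ + 1) * n ^ 2 / 2) := by
  set M' := 2 * M + 1 with hM'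
  have hM'1 : 1 ≤ M' := by linarith
  have hθ0 : 0 ≤ θ := by
    by_contra hneg
    push Not at hneg
    have : 128 * (2 * C₀ + 1) * θ < 0 := mul_neg_of_pos_of_neg (by positivity) hneg
    nlinarith [mul_pos hκ hβ]
  have hθκ : 128 * θ ≤ κ := by
    have h1 : 128 * θ ≤ 128 * (2 * C₀ + 1) * θ := by nlinarith [mul_nonneg hC hθ0]
    have h2 : κ * β ≤ κ := mul_le_of_le_one_right hκ.le hβ1
    linarith
  -- From `(P + M')² ≤ 2 (P² + M'²)` and `P (P - 1) / 2 ≥ P² / 4 - 1 / 4`.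
  have q1 : n ^ 2 / 32 - M' ^ 2 / 4 - 1 / 4 ≤ P * (P - 1) / 2 := by
    have h1 : (n / 2) ^ 2 ≤ (P + M') ^ 2 := pow_le_pow_left₀ (by positivity) (by linarith) 2
    nlinarith [sq_nonneg (P - M'), sq_nonneg (P - 1)]
  have q2 : κ * β * (n ^ 2 / 32 - M' ^ 2 / 4 - 1 / 4) ≤ κ * β * (P * (P - 1) / 2) :=
    mul_le_mul_of_nonneg_left q1 (by positivity)
  have q3 : κ * (ρ / 2) * (n / 2 - M') ≤ κ * (ρ / 2) * P :=
    mul_le_mul_of_nonneg_left hP (by positivity)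
  have q4 : θ * n * M' ≤ θ * n * ρ := mul_le_mul_of_nonneg_left hρM (by positivity)
  have q5 : 128 * θ * (n * ρ) ≤ κ * (n * ρ) := mul_le_mul_of_nonneg_right hθκ (by positivity)
  have q6 : 64 * ω ^ 2 * β * (n * ρ) ≤ κ * (n * ρ) :=
    mul_le_mul_of_nonneg_right hβκ (by positivity)
  have q7 : 64 * ω ^ 2 * β * (β * n ^ 2) ≤ κ * (β * n ^ 2) :=
    mul_le_mul_of_nonneg_right hβκ (by positivity)
  have q8 : 128 * (2 * C₀ + 1) * θ * n ^ 2 = κ * β * n ^ 2 := by rw [hθ]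
  have q9 := mul_le_mul_of_nonneg_right hρ (by positivity : 0 ≤ ρ)
  have q10 : K ^ 2 * 1 ≤ K ^ 2 * ρ := mul_le_mul_of_nonneg_left hρ1 (sq_nonneg _)
  have q11 : κ * β * (M' ^ 2 / 4 + 1 / 4) ≤ κ * 1 * (M' ^ 2 / 4 + 1 / 4) := by gcongr
  have q12 : κ * (M' ^ 2 + 1) / 4 * 1 ≤ κ * (M' ^ 2 + 1) / 4 * ρ :=
    mul_le_mul_of_nonneg_left hρ1 (by positivity)
  have hnρ : 0 ≤ κ * (n * ρ) := by positivity
  have hnn : 0 ≤ κ * (β * n ^ 2) := by positivity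
  nlinarith

/-- A good future and a large radial distance at the start force linear growth. -/
theorem EnergyWalk.linear_growth {ω ε c C₀ : ℝ} (hω : 0 < ω) (hε : 0 < ε) (hε1 : ε ≤ 1)
    (hc : 0 < c) (hC : 0 ≤ C₀) :
    ∃ β > 0, ∃ θ > 0, ∀ K M : ℝ, 0 ≤ K → 0 ≤ M → ∃ M₂ : ℝ, ∀ r u w a d ξ : ℕ → ℝ,
      EnergyWalk ω r u w a d ξ → GoodFuture ω K ε c C₀ θ M a d ξ → M₂ ≤ r 0 →
      u 0 ≤ K * √(r 0 + 1) → ∀ n : ℕ, r 0 / 2 + β * n ≤ r n := by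
  set κ := ε * c * ω ^ 2 / 12 with hκd
  have hκ : 0 < κ := by positivity
  set β := min 1 (κ / (64 * ω ^ 2)) with hβd
  have hβ : 0 < β := by positivity
  have hβ1 : β ≤ 1 := min_le_left _ _
  have hβκ : 64 * ω ^ 2 * β ≤ κ := by
    have : β ≤ κ / (64 * ω ^ 2) := min_le_right _ _
    rw [le_div_iff₀ (by positivity)] at this
    linarith
  -- This `θ` makes the quadratic noise term `2 θ (2 C₀ + 1) n²` equal to `κ β n² / 64`, half of the
  -- quadratic gain. It is fixed before `K` and `M`, as `M` will depend on it.
  refine ⟨β, hβ, κ * β / (128 * (2 * C₀ + 1)), by positivity, fun K M hK hM => ?_⟩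
  set θ := κ * β / (128 * (2 * C₀ + 1)) with hθd
  have hθ0 : 0 < θ := by positivity
  have hθ : 128 * (2 * C₀ + 1) * θ = κ * β := by rw [hθd]; field_simp
  set B := 2 * K ^ 2 + κ * (2 * M + 1) / 2 + κ * ((2 * M + 1) ^ 2 + 1) / 4 with hB
  have hB0 : 0 ≤ B := by positivity
  -- The three summands ensure, respectively, that `r 0` dominates `2 M + 1`, that `r 0 / 2 ≥ c` as
  -- needed for `speed_gain`, and that the surplus of the initial energy pays the constants `B`.
  refine ⟨2 * M + 1 + 2 * c + B / (3 / 4 * ω ^ 2), fun r u w a d ξ h hg hr0 hu0 n => ?_⟩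
  have hBω : 0 ≤ B / (3 / 4 * ω ^ 2) := by positivity
  have hρB : B ≤ 3 / 4 * ω ^ 2 * r 0 := by
    have : B / (3 / 4 * ω ^ 2) ≤ r 0 := by linarith
    rw [div_le_iff₀ (by positivity)] at this
    linarith
  induction n using Nat.strong_induction_on with
  | _ n ih =>
  have hr : ∀ k < n, c ≤ r k := fun k hk => by
    have := ih k hk
    have : 0 ≤ β * k := by positivity
    linarith
  set e : ℕ → ℝ := fun k => dissipative ε c (a k) (ξ k) with he
  have e01 : ∀ k, e k = 0 ∨ e k = 1 := fun k => dissipative_mem _ _ _ _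
  set p : ℕ → ℝ := fun k => e k * e (k + 1) with hp
  have p0 : ∀ k, 0 ≤ p k := fun k => by
    rcases e01 k with h | h <;> rcases e01 (k + 1) with h' | h' <;> simp [hp, h, h']
  have p1 : ∀ k, p k ≤ 1 := fun k => by
    rcases e01 k with h | h <;> rcases e01 (k + 1) with h' | h' <;> simp [hp, h, h']
  have hPge : (n : ℝ) / 2 - (2 * M + 1) ≤ ∑ k ∈ Finset.range n, p k := by
    -- For indicators `e e' ≥ e + e' - 1`, so density `3/4` of dissipative steps yields density
    -- `1/2` of dissipative pairs.
    have h1 : ∑ k ∈ Finset.range n, (e k + e (k + 1) - 1) ≤ ∑ k ∈ Finset.range n, p k :=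
      Finset.sum_le_sum fun k _ => by
        rcases e01 k with h | h <;> rcases e01 (k + 1) with h' | h' <;> simp [hp, h, h']
    rw [Finset.sum_sub_distrib, Finset.sum_add_distrib] at h1
    simp only [Finset.sum_const, Finset.card_range, nsmul_eq_mul, mul_one] at h1
    have h2 := Finset.sum_range_succ' e n
    have h3 := hg.count n
    have h4 := hg.count (n + 1)
    have h5 : e 0 ≤ 1 := by rcases e01 0 with h | h <;> simp [h]
    push_cast at h4
    simp only [he] at h1 h2 h5
    linarith
  have hS : r 0 / 2 * (∑ k ∈ Finset.range n, p k) + β * ((∑ k ∈ Finset.range n, p k) *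
      (∑ k ∈ Finset.range n, p k - 1) / 2) ≤ ∑ k ∈ Finset.range n, p k * r k := by
    have h1 := sum_range_mul_ge p p0 p1 n
    have h2 : ∑ k ∈ Finset.range n, p k * (r 0 / 2 + β * k) ≤
        ∑ k ∈ Finset.range n, p k * r k := Finset.sum_le_sum fun k hk =>
      mul_le_mul_of_nonneg_left (ih k (Finset.mem_range.1 hk)) (p0 k)
    have h3 : ∑ k ∈ Finset.range n, p k * (r 0 / 2 + β * k) =
        r 0 / 2 * (∑ k ∈ Finset.range n, p k) + β * ∑ k ∈ Finset.range n, k * p k := by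
      rw [Finset.mul_sum, Finset.mul_sum, ← Finset.sum_add_distrib]
      exact Finset.sum_congr rfl fun k _ => by ring
    have := mul_le_mul_of_nonneg_left h1 hβ.le
    linarith
  have harith := growth_arith (K := K) (n := n) hκ hβ hβ1 hβκ hC hM hθ (Nat.cast_nonneg n)
    hPge (by linarith) (by linarith) hρB
  have hκS := mul_le_mul_of_nonneg_left hS hκ.le
  have hE : ω ^ 2 * r 0 ^ 2 - K ^ 2 * (r 0 + 1) + κ * ∑ k ∈ Finset.range n, p k * r k -
      4 * θ * (n * (r 0 + 2 * M + 1) + (2 * C₀ + 1) * n ^ 2 / 2) ≤ ω ^ 2 * r n ^ 2 :=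
    h.energy_ge hω hK hε hε1 hc.le hC hM hθ0.le hg hu0 n hr
  have hfin : ω ^ 2 * (r 0 / 2 + β * n) ^ 2 ≤ ω ^ 2 * r n ^ 2 := by
    refine harith.trans (le_trans ?_ hE)
    linarith
  have hsq : (r 0 / 2 + β * n) ^ 2 ≤ r n ^ 2 := le_of_mul_le_mul_left hfin (by positivity)
  exact abs_le_of_sq_le_sq' hsq (h.r_nonneg n) |>.2

/-! ### Free flight in the rotating frame. -/

section Flight

variable (ω : ℝ)

lemma norm_sq_eq_coords (x : E3) : ‖x‖ ^ 2 = x 0 ^ 2 + x 1 ^ 2 + x 2 ^ 2 := by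
  rw [EuclideanSpace.norm_sq_eq]
  simp [Fin.sum_univ_three]

lemma radialDist_sq (x : E3) : radialDist x ^ 2 = x 0 ^ 2 + x 1 ^ 2 :=
  Real.sq_sqrt (by positivity)

lemma radialDist_nonneg (x : E3) : 0 ≤ radialDist x := Real.sqrt_nonneg _

lemma continuous_radialDist : Continuous radialDist := by
  unfold radialDist; fun_prop

lemma radialDist_le_norm (x : E3) : radialDist x ≤ ‖x‖ := by
  refine abs_le_of_sq_le_sq' ?_ (norm_nonneg _) |>.2
  rw [radialDist_sq, norm_sq_eq_coords]
  nlinarith [sq_nonneg (x 2)]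

lemma continuous_rotField : Continuous (rotField ω) := by
  unfold rotField
  refine (PiLp.continuous_toLp 2 _).comp (continuous_pi fun i => ?_)
  fin_cases i <;> simp <;> fun_prop

lemma rotField_add (x y : E3) : rotField ω (x + y) = rotField ω x + rotField ω y := by
  ext i; fin_cases i <;> simp [rotField] <;> ring

lemma rotField_smul (c : ℝ) (x : E3) : rotField ω (c • x) = c • rotField ω x := by
  ext i; fin_cases i <;> simp [rotField] <;> ring

variable {ω}

lemma norm_rotField (hω : 0 ≤ ω) (x : E3) : ‖rotField ω x‖ = ω * radialDist x := by
  rw [← sq_eq_sq₀ (norm_nonneg _) (mul_nonneg hω (radialDist_nonneg x)), mul_pow, radialDist_sq,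
    norm_sq_eq_coords]
  simp [rotField]; ring

lemma norm_rotField_le (hω : 0 ≤ ω) (x : E3) : ‖rotField ω x‖ ≤ ω * ‖x‖ := by
  rw [norm_rotField hω]
  exact mul_le_mul_of_nonneg_left (radialDist_le_norm x) hω

lemma radialDist_rotField (hω : 0 ≤ ω) (x : E3) :
    radialDist (rotField ω x) = ω * radialDist x := by
  rw [← sq_eq_sq₀ (radialDist_nonneg _) (mul_nonneg hω (radialDist_nonneg x)), mul_pow,
    radialDist_sq, radialDist_sq]
  simp [rotField]; ring

/-- The relative velocity is affine in time; convexity of the norm then bounds it by its end values.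
-/
lemma relVel_eq (ω : ℝ) (x v : E3) (s : ℝ) :
    v - rotField ω (x + s • v) = (v - rotField ω x) - s • rotField ω v := by
  rw [rotField_add, rotField_smul]; abel

lemma continuous_relVel (ω : ℝ) (x v : E3) : Continuous fun s : ℝ => v - rotField ω (x + s • v) := by
  have := continuous_rotField ω
  fun_prop

lemma intervalIntegrable_relVel (ω : ℝ) (x v : E3) (s t : ℝ) :
    IntervalIntegrable (fun s : ℝ => ‖v - rotField ω (x + s • v)‖) volume s t :=
  (continuous_relVel ω x v).norm.intervalIntegrable _ _

lemma relDist_zero (ω : ℝ) (x v : E3) : relDist ω x v 0 = 0 := by simp [relDist]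

lemma relDist_sub (ω : ℝ) (x v : E3) (s t : ℝ) :
    relDist ω x v t - relDist ω x v s = ∫ s in s..t, ‖v - rotField ω (x + s • v)‖ :=
  intervalIntegral.integral_interval_sub_left (intervalIntegrable_relVel ..)
    (intervalIntegrable_relVel ..)

lemma relDist_mono (ω : ℝ) (x v : E3) : Monotone (relDist ω x v) := by
  intro s t hst
  have h : 0 ≤ ∫ s in s..t, ‖v - rotField ω (x + s • v)‖ :=
    intervalIntegral.integral_nonneg hst fun _ _ => norm_nonneg _
  linarith [relDist_sub ω x v s t]

lemma relDist_nonneg (ω : ℝ) (x v : E3) {t : ℝ} (ht : 0 ≤ t) : 0 ≤ relDist ω x v t := by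
  rw [← relDist_zero ω x v]; exact relDist_mono ω x v ht

lemma continuous_relDist_time (ω : ℝ) (x v : E3) : Continuous (relDist ω x v) :=
  intervalIntegral.continuous_primitive (fun s t => intervalIntegrable_relVel ω x v s t) 0

lemma continuous_relDist (ω : ℝ) : Continuous fun q : (E3 × E3) × ℝ => relDist ω q.1.1 q.1.2 q.2 := by
  unfold relDist
  have := continuous_rotField ω
  refine intervalIntegral.continuous_parametric_intervalIntegral_of_continuous
    (f := fun (q : (E3 × E3) × ℝ) (s : ℝ) => ‖q.1.2 - rotField ω (q.1.1 + s • q.1.2)‖) ?_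
    continuous_snd
  unfold Function.uncurry
  fun_prop

lemma norm_sub_smul_le_max {E : Type*} [NormedAddCommGroup E] [NormedSpace ℝ E] (p b : E) {s t : ℝ}
    (hs : 0 ≤ s) (hst : s ≤ t) : ‖p - s • b‖ ≤ max ‖p‖ ‖p - t • b‖ := by
  rcases (hs.trans hst).eq_or_lt with ht | ht
  · obtain rfl : s = 0 := by linarith
    simp
  have h : p - s • b = (1 - s / t) • p + (s / t) • (p - t • b) := by
    rw [smul_sub, sub_smul, one_smul, smul_smul, div_mul_cancel₀ _ ht.ne']
    abel
  have h0 : 0 ≤ s / t := by positivity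
  have h1 : s / t ≤ 1 := (div_le_one ht).2 hst
  rw [h]
  refine (norm_add_le _ _).trans ?_
  rw [norm_smul, norm_smul, Real.norm_of_nonneg h0, Real.norm_of_nonneg (by linarith)]
  have a1 := mul_le_mul_of_nonneg_left (le_max_left ‖p‖ ‖p - t • b‖) (by linarith : 0 ≤ 1 - s / t)
  have a2 := mul_le_mul_of_nonneg_left (le_max_right ‖p‖ ‖p - t • b‖) h0
  linarith

/-- The relative speed during a flight is at most the larger one of its end values. -/
lemma relSpeed_le_max (ω : ℝ) (x v : E3) {s t : ℝ} (hs : 0 ≤ s) (hst : s ≤ t) :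
    ‖v - rotField ω (x + s • v)‖ ≤
      max ‖v - rotField ω x‖ ‖v - rotField ω (x + t • v)‖ := by
  rw [relVel_eq, relVel_eq ω x v t]
  exact norm_sub_smul_le_max _ _ hs hst

lemma relDist_le_mul_max (ω : ℝ) (x v : E3) {t : ℝ} (ht : 0 ≤ t) :
    relDist ω x v t ≤ t * max ‖v - rotField ω x‖ ‖v - rotField ω (x + t • v)‖ := by
  have h := intervalIntegral.integral_mono_on ht (intervalIntegrable_relVel ω x v 0 t)
    (intervalIntegrable_const (c := max ‖v - rotField ω x‖ ‖v - rotField ω (x + t • v)‖))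
    (fun s hs => relSpeed_le_max ω x v hs.1 hs.2)
  simpa [relDist] using h

lemma mul_radialDist_le_max (hω : 0 ≤ ω) (x v : E3) {t : ℝ} (ht : 0 ≤ t) :
    ω * radialDist v * t ≤ 2 * max ‖v - rotField ω x‖ ‖v - rotField ω (x + t • v)‖ := by
  have h1 : t • rotField ω v = (v - rotField ω x) - (v - rotField ω (x + t • v)) := by
    rw [relVel_eq]; abel
  have h2 : ω * radialDist v * t = ‖t • rotField ω v‖ := by
    rw [norm_smul, Real.norm_of_nonneg ht, norm_rotField hω]; ring
  rw [h2, h1]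
  refine (norm_sub_le _ _).trans ?_
  linarith [le_max_left ‖v - rotField ω x‖ ‖v - rotField ω (x + t • v)‖,
    le_max_right ‖v - rotField ω x‖ ‖v - rotField ω (x + t • v)‖]

/-- Applying the field twice multiplies horizontal vectors by `-ω²`. So if `v` is close to `F(x)`,
then `F(v)` has norm close to `ω² r`: a particle carried along far out has a large horizontal
velocity. -/
lemma radialDist_vel_ge (hω : 0 < ω) (x v : E3) :
    ω * radialDist x - ‖v - rotField ω x‖ ≤ radialDist v := by
  have h : rotField ω v = rotField ω (v - rotField ω x) + rotField ω (rotField ω x) := by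
    rw [← rotField_add, sub_add_cancel]
  have h1 : ‖rotField ω (rotField ω x)‖ ≤ ‖rotField ω v‖ + ‖rotField ω (v - rotField ω x)‖ := by
    rw [h]
    have := norm_sub_le (rotField ω (v - rotField ω x) + rotField ω (rotField ω x))
      (rotField ω (v - rotField ω x))
    rwa [add_sub_cancel_left] at this
  have h2 := norm_rotField_le hω.le (v - rotField ω x)
  rw [norm_rotField hω.le, norm_rotField hω.le, radialDist_rotField hω.le] at h1
  have h3 : ω * (ω * radialDist x - ‖v - rotField ω x‖) ≤ ω * radialDist v := by linarith
  exact le_of_mul_le_mul_left h3 hω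

/-- With `z` the larger end value of the relative speed, a flight of duration `t` has length at most
`t z`, while the relative velocity changes by `t F(v)`, so `ω t radialDist v ≤ 2 z`. Multiplying the
two eliminates `t`. -/
lemma flight_bound (hω : 0 < ω) (x v : E3) {t : ℝ} (ht : 0 ≤ t) :
    ω * (ω * radialDist x - ‖v - rotField ω x‖) * relDist ω x v t ≤
      2 * (‖v - rotField ω x‖ ^ 2 + ‖v - rotField ω (x + t • v)‖ ^ 2) := by
  have hD := relDist_nonneg ω x v ht
  have h1 := relDist_le_mul_max ω x v ht
  have h2 := mul_radialDist_le_max hω.le x v ht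
  have h3 := radialDist_vel_ge hω x v
  set z := max ‖v - rotField ω x‖ ‖v - rotField ω (x + t • v)‖ with hz
  have hz0 : 0 ≤ z := (norm_nonneg _).trans (le_max_left _ _)
  have hz2 : z ^ 2 ≤ ‖v - rotField ω x‖ ^ 2 + ‖v - rotField ω (x + t • v)‖ ^ 2 := by
    rcases max_choice ‖v - rotField ω x‖ ‖v - rotField ω (x + t • v)‖ with h | h <;>
      rw [hz, h] <;> nlinarith [sq_nonneg ‖v - rotField ω x‖,
        sq_nonneg ‖v - rotField ω (x + t • v)‖]
  have hv := radialDist_nonneg v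
  calc ω * (ω * radialDist x - ‖v - rotField ω x‖) * relDist ω x v t
      ≤ ω * radialDist v * relDist ω x v t := by gcongr
    _ ≤ ω * radialDist v * (t * z) := by gcongr
    _ = (ω * radialDist v * t) * z := by ring
    _ ≤ 2 * z * z := by gcongr
    _ ≤ _ := by nlinarith

/-- In the rotating frame, the kinetic energy minus the centrifugal potential is conserved. -/
lemma energy_flight (ω : ℝ) (x v : E3) (t : ℝ) :
    ‖v - rotField ω (x + t • v)‖ ^ 2 = ‖v - rotField ω x‖ ^ 2 +
      ω ^ 2 * (radialDist (x + t • v) ^ 2 - radialDist x ^ 2) := by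
  rw [norm_sq_eq_coords, norm_sq_eq_coords, radialDist_sq, radialDist_sq]
  simp [rotField]; ring

lemma radialDist_sq_flight_le (x v : E3) {s t : ℝ} (hs : 0 ≤ s) (hst : s ≤ t) :
    radialDist (x + s • v) ≤ max (radialDist x) (radialDist (x + t • v)) := by
  have h := norm_sub_smul_le_max (rotField 1 x) (-rotField 1 v) hs hst
  have e : ∀ s : ℝ, ‖rotField 1 x - s • -rotField 1 v‖ = radialDist (x + s • v) := fun s => by
    rw [smul_neg, sub_neg_eq_add, ← rotField_smul, ← rotField_add, norm_rotField zero_le_one,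
      one_mul]
  rw [e, e, norm_rotField zero_le_one, one_mul] at h
  exact h

/-- The field is tangential, so `F(y)` drops out of the derivative of `radialDist y ^ 2` and only
the relative velocity moves the particle radially. Working with the square avoids the axis, where
the distance is not differentiable; replacing the distance by the maximum `m` of its end values
costs the factor 2. -/
lemma abs_radialDist_sub_le (x v : E3) (ω : ℝ) {t : ℝ} (ht : 0 ≤ t) :
    |radialDist (x + t • v) - radialDist x| ≤ 2 * relDist ω x v t := by
  have hD := relDist_nonneg ω x v ht
  have hr := radialDist_nonneg x
  have hr' := radialDist_nonneg (x + t • v)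
  set m := max (radialDist x) (radialDist (x + t • v)) with hm
  have hm0 : 0 ≤ m := hr.trans (le_max_left _ _)
  set f' : ℝ → ℝ := fun s => 2 * ((x 0 + s * v 0) * v 0 + (x 1 + s * v 1) * v 1) with hf'
  have hint : radialDist (x + t • v) ^ 2 - radialDist x ^ 2 = ∫ s in (0 : ℝ)..t, f' s := by
    have hder : ∀ s ∈ Set.uIcc 0 t, HasDerivAt
        (fun s : ℝ => (x 0 + s * v 0) ^ 2 + (x 1 + s * v 1) ^ 2) (f' s) s := by
      intro s _
      have h0 : HasDerivAt (fun s : ℝ => x 0 + s * v 0) (v 0) s := by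
        simpa using ((hasDerivAt_id s).mul_const (v 0)).const_add (x 0)
      have h1 : HasDerivAt (fun s : ℝ => x 1 + s * v 1) (v 1) s := by
        simpa using ((hasDerivAt_id s).mul_const (v 1)).const_add (x 1)
      refine ((h0.pow 2).add (h1.pow 2)).congr_deriv ?_
      simp [hf']; ring
    rw [intervalIntegral.integral_eq_sub_of_hasDerivAt hder
      (Continuous.intervalIntegrable (by fun_prop) _ _), radialDist_sq, radialDist_sq]
    simp
  have hbound : ∀ s ∈ Set.Icc 0 t, |f' s| ≤ 2 * m * ‖v - rotField ω (x + s • v)‖ := by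
    intro s hs
    have h1 := radialDist_sq_flight_le x v hs.1 hs.2
    have h2 : f' s = 2 * ((x + s • v) 0 * (v - rotField ω (x + s • v)) 0 +
        (x + s • v) 1 * (v - rotField ω (x + s • v)) 1) := by
      simp [hf', rotField]; ring
    set y := x + s • v
    set U := v - rotField ω y
    have h3 : |y 0 * U 0 + y 1 * U 1| ≤ radialDist y * radialDist U := by
      refine abs_le_of_sq_le_sq ?_ (mul_nonneg (radialDist_nonneg _) (radialDist_nonneg _))
      rw [mul_pow, radialDist_sq, radialDist_sq]
      nlinarith [sq_nonneg (y 0 * U 1 - y 1 * U 0)]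
    rw [h2, abs_mul, abs_two]
    have h4 : radialDist y * radialDist U ≤ m * ‖U‖ :=
      mul_le_mul h1 (radialDist_le_norm U) (radialDist_nonneg U) hm0
    linarith
  have hmain : |radialDist (x + t • v) ^ 2 - radialDist x ^ 2| ≤ 2 * m * relDist ω x v t := by
    rw [hint]
    refine (intervalIntegral.abs_integral_le_integral_abs ht).trans ?_
    have h := intervalIntegral.integral_mono_on ht
      (Continuous.intervalIntegrable (by fun_prop) 0 t)
      ((intervalIntegrable_relVel ω x v 0 t).const_mul (2 * m)) hbound
    rwa [intervalIntegral.integral_const_mul] at h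
  have hms : m ≤ radialDist (x + t • v) + radialDist x := by
    rcases max_choice (radialDist x) (radialDist (x + t • v)) with h | h <;> rw [hm, h] <;> linarith
  have hfac : |radialDist (x + t • v) ^ 2 - radialDist x ^ 2| =
      |radialDist (x + t • v) - radialDist x| * (radialDist (x + t • v) + radialDist x) := by
    rw [sq_sub_sq, abs_mul, abs_of_nonneg (by linarith : 0 ≤ radialDist (x + t • v) + radialDist x)]
    ring
  rw [hfac] at hmain
  set S := radialDist (x + t • v) + radialDist x with hS
  rcases (by linarith : 0 ≤ S).eq_or_lt with h0 | h0
  · have e1 : radialDist (x + t • v) = 0 := by linarith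
    have e2 : radialDist x = 0 := by linarith
    rw [e1, e2]; simpa using hD
  · have h5 : |radialDist (x + t • v) - radialDist x| * S ≤ (2 * relDist ω x v t) * S := by
      refine hmain.trans ?_
      have := mul_le_mul_of_nonneg_right hms hD
      linarith
    exact le_of_mul_le_mul_right h5 h0

/-- The state in which a particle would never collide: at rest on the rotation axis. -/
def IsStuck (x v : E3) : Prop := radialDist x = 0 ∧ v = 0

/-- Without horizontal velocity the relative velocity is constant, and it vanishes only for a stuck
particle. Otherwise the radial distance is unbounded, and it changes by at most twice the relative
length. -/
lemma exists_le_relDist (hω : 0 < ω) {x v : E3} (h : ¬ IsStuck x v) (ρ : ℝ) :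
    ∃ t, 0 ≤ t ∧ ρ ≤ relDist ω x v t := by
  by_cases hv : radialDist v = 0
  · have hF : rotField ω v = 0 := by rw [← norm_eq_zero, norm_rotField hω.le, hv, mul_zero]
    have hc : ∀ s : ℝ, v - rotField ω (x + s • v) = v - rotField ω x := fun s => by
      rw [relVel_eq, hF, smul_zero, sub_zero]
    have hne : v - rotField ω x ≠ 0 := by
      intro h0
      apply h
      rw [sub_eq_zero] at h0
      have h1 : ω * radialDist x = 0 := by rw [← radialDist_rotField hω.le, ← h0, hv]
      have h2 : radialDist x = 0 := by simpa [hω.ne'] using h1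
      refine ⟨h2, ?_⟩
      rw [h0, ← norm_eq_zero, norm_rotField hω.le, h1]
    have hn : 0 < ‖v - rotField ω x‖ := norm_pos_iff.2 hne
    refine ⟨|ρ| / ‖v - rotField ω x‖, by positivity, ?_⟩
    simp only [relDist, hc]
    simp only [intervalIntegral.integral_const, sub_zero, smul_eq_mul]
    rw [div_mul_cancel₀ _ hn.ne']
    exact le_abs_self ρ
  · have hv0 : 0 < radialDist v := (radialDist_nonneg v).lt_of_ne' hv
    refine ⟨(2 * |ρ| + 2 * radialDist x) / radialDist v,
      div_nonneg (by have := radialDist_nonneg x; positivity) hv0.le, ?_⟩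
    set t := (2 * |ρ| + 2 * radialDist x) / radialDist v with ht
    have ht0 : 0 ≤ t := div_nonneg (by have := radialDist_nonneg x; positivity) hv0.le
    have h1 := abs_radialDist_sub_le x v ω ht0
    have h2 : radialDist v * t ≤ radialDist (x + t • v) + radialDist x := by
      have e : t • rotField 1 v = rotField 1 (x + t • v) - rotField 1 x := by
        rw [rotField_add, rotField_smul]; abel
      have := norm_sub_le (rotField 1 (x + t • v)) (rotField 1 x)
      rw [← e, norm_smul, norm_rotField zero_le_one, norm_rotField zero_le_one,
        norm_rotField zero_le_one, Real.norm_of_nonneg ht0] at this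
      linarith
    rw [ht, mul_div_cancel₀ _ hv0.ne', ← ht] at h2
    linarith [(abs_le.1 h1).2, le_abs_self ρ]

lemma flightTime_nonneg (ω : ℝ) (x v : E3) (ρ : ℝ) : 0 ≤ flightTime ω x v ρ :=
  Real.sInf_nonneg fun _ ht => ht.1

lemma isClosed_flightSet (ω : ℝ) (x v : E3) (ρ : ℝ) :
    IsClosed {t : ℝ | 0 ≤ t ∧ ρ ≤ relDist ω x v t} :=
  (isClosed_le continuous_const continuous_id).inter
    (isClosed_le continuous_const (continuous_relDist_time ω x v))

lemma flightTime_mem (hω : 0 < ω) {x v : E3} (h : ¬ IsStuck x v) (ρ : ℝ) :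
    ρ ≤ relDist ω x v (flightTime ω x v ρ) :=
  ((isClosed_flightSet ω x v ρ).csInf_mem (exists_le_relDist hω h ρ) ⟨0, fun _ ht => ht.1⟩).2

lemma relDist_flightTime (hω : 0 < ω) {x v : E3} (h : ¬ IsStuck x v) {ρ : ℝ} (hρ : 0 ≤ ρ) :
    relDist ω x v (flightTime ω x v ρ) = ρ := by
  refine le_antisymm ?_ (flightTime_mem hω h ρ)
  by_contra hlt
  push Not at hlt
  have h0 : relDist ω x v 0 ≤ ρ := by rwa [relDist_zero]
  obtain ⟨s, hs, hsρ⟩ := intermediate_value_Icc (flightTime_nonneg ω x v ρ)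
    (continuous_relDist_time ω x v).continuousOn ⟨h0, hlt.le⟩
  have : flightTime ω x v ρ ≤ s := csInf_le ⟨0, fun _ ht => ht.1⟩ ⟨hs.1, hsρ.ge⟩
  have hs' : s = flightTime ω x v ρ := le_antisymm hs.2 this
  rw [hs'] at hsρ
  linarith

lemma flightTime_pos (hω : 0 < ω) {x v : E3} (h : ¬ IsStuck x v) {ρ : ℝ} (hρ : 0 < ρ) :
    0 < flightTime ω x v ρ := by
  refine (flightTime_nonneg ω x v ρ).lt_of_ne fun h0 => ?_
  have := relDist_flightTime hω h hρ.le
  rw [← h0, relDist_zero] at this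
  linarith

/-- For a particle that is not stuck, the duration is at most `t` exactly when the distance
travelled by time `t` reaches the given length, and this distance is jointly continuous in the data.
-/
lemma measurable_flightTime (hω : 0 < ω) :
    Measurable fun q : (E3 × E3) × ℝ => flightTime ω q.1.1 q.1.2 q.2 := by
  have hstuck : MeasurableSet {q : (E3 × E3) × ℝ | IsStuck q.1.1 q.1.2} := by
    have h1 : MeasurableSet {q : (E3 × E3) × ℝ | radialDist q.1.1 = 0} :=
      measurableSet_eq_fun (continuous_radialDist.measurable.comp (by fun_prop)) measurable_const
    have h2 : MeasurableSet {q : (E3 × E3) × ℝ | q.1.2 = 0} :=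
      measurableSet_eq_fun (by fun_prop) measurable_const
    exact h1.inter h2
  refine measurable_of_Iic fun t => ?_
  rcases lt_or_ge t 0 with ht | ht
  · convert MeasurableSet.empty
    ext q
    simp only [Set.mem_preimage, Set.mem_Iic, Set.mem_empty_iff_false, iff_false, not_le]
    exact ht.trans_le (flightTime_nonneg _ _ _ _)
  · have e : (fun q : (E3 × E3) × ℝ => flightTime ω q.1.1 q.1.2 q.2) ⁻¹' Set.Iic t =
        {q | IsStuck q.1.1 q.1.2} ∪ {q | q.2 ≤ relDist ω q.1.1 q.1.2 t} := by
      ext ⟨⟨x, v⟩, ρ⟩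
      simp only [Set.mem_preimage, Set.mem_Iic, Set.mem_union, Set.mem_ofPred_eq]
      by_cases h : IsStuck x v
      · simp only [h, true_or, iff_true]
        have hz : ∀ s, relDist ω x v s = 0 := fun s => by
          have hF : rotField ω x = 0 := by
            rw [← norm_eq_zero, norm_rotField hω.le, h.1, mul_zero]
          simp [relDist, h.2, hF]
        -- For a stuck particle the set is empty or all of `t ≥ 0`; its infimum is zero in both
        -- cases, by convention if it is empty.
        unfold flightTime
        simp only [hz]
        by_cases hρ : ρ ≤ 0
        · have hmem : (0 : ℝ) ∈ {s : ℝ | 0 ≤ s ∧ ρ ≤ 0} := ⟨le_rfl, hρ⟩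
          exact (csInf_le ⟨0, fun _ hs => hs.1⟩ hmem).trans ht
        · simpa [hρ] using ht
      · simp only [h, false_or]
        constructor
        · intro h1
          exact (flightTime_mem hω h ρ).trans (relDist_mono ω x v h1)
        · intro h1
          exact csInf_le ⟨0, fun _ hs => hs.1⟩ ⟨ht, h1⟩
    rw [e]
    refine hstuck.union (measurableSet_le (by fun_prop) ?_)
    exact ((continuous_relDist ω).comp (by fun_prop :
      Continuous fun q : (E3 × E3) × ℝ => (q.1, t))).measurable

end Flight

/-! ### The collision map. -/

section Collision

lemma measurable_collide {R : E3 → Matrix (Fin 3) (Fin 3) ℝ} (hR : IsRotationChoice R) :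
    Measurable fun q : (E3 × E3) × E3 => collide R q.1.1 q.1.2 q.2 := by
  have h : Measurable fun q : (E3 × E3) × E3 => act (R (q.1.1 - q.1.2)) q.2 := by
    unfold act
    refine (PiLp.continuous_toLp 2 _).measurable.comp (measurable_pi_lambda _ fun i => ?_)
    simp only [Matrix.mulVec, dotProduct]
    refine Finset.measurable_sum _ fun j _ => ?_
    have := hR.measurable i j
    refine Measurable.mul (this.comp (by fun_prop)) ?_
    fun_prop
  unfold collide
  fun_prop

lemma norm_act {A : Matrix (Fin 3) (Fin 3) ℝ} (hA : A ∈ Matrix.specialOrthogonalGroup (Fin 3) ℝ)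
    (n : E3) : ‖act A n‖ = ‖n‖ := by
  have h1 : A.transpose * A = 1 :=
    (Matrix.mem_orthogonalGroup_iff' (Fin 3) ℝ).1 (Matrix.mem_specialOrthogonalGroup_iff.1 hA).1
  have key : ∀ v : E3, ‖v‖ ^ 2 = v.ofLp ⬝ᵥ v.ofLp := fun v => by
    rw [norm_sq_eq_coords]; simp [dotProduct, Fin.sum_univ_three]; ring
  rw [← sq_eq_sq₀ (norm_nonneg _) (norm_nonneg _), key, key]
  simp only [act]
  rw [Matrix.dotProduct_mulVec, Matrix.vecMul_mulVec, h1, Matrix.vecMul_one]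

lemma act_sub (A : Matrix (Fin 3) (Fin 3) ℝ) (x y : E3) : act A (x - y) = act A x - act A y := by
  simp [act, Matrix.mulVec_sub]

variable {R : E3 → Matrix (Fin 3) (Fin 3) ℝ}

lemma norm_collide_sub (hR : IsRotationChoice R) (v u n : E3) :
    ‖collide R v u n - u‖ = ‖v - u‖ * ‖n‖ := by
  unfold collide
  rw [add_sub_cancel_right, norm_smul, norm_norm]
  by_cases h : v - u = 0
  · simp [h]
  · rw [norm_act (hR.mem_SO _ h)]

lemma norm_collide_sub_le (hR : IsRotationChoice R) (v f δ n : E3) :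
    ‖collide R v (f + δ) n - f‖ ≤ ‖n‖ * (‖v - f‖ + ‖δ‖) + ‖δ‖ := by
  have h1 : collide R v (f + δ) n - f = (collide R v (f + δ) n - (f + δ)) + δ := by abel
  have h2 : v - (f + δ) = (v - f) - δ := by abel
  rw [h1]
  refine (norm_add_le _ _).trans ?_
  rw [norm_collide_sub hR, h2, mul_comm]
  gcongr
  exact norm_sub_le _ _

/-- The particle can only be at rest after a collision if the thermal velocity lies on a certain
sphere. -/
lemma norm_of_collide_eq_zero (hR : IsRotationChoice R) {v u n : E3} (h : collide R v u n = 0) :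
    ‖v - u‖ * ‖(!₂[1, 0, 0] : E3) - n‖ = ‖v‖ := by
  unfold collide at h
  by_cases hy : v - u = 0
  · have hu : v = u := sub_eq_zero.1 hy
    simp only [hy, norm_zero, zero_smul, zero_add] at h
    simp [hu, h]
  -- With `y = v - u = ‖y‖ R e₁` and, for a vanishing outcome, `u = -‖y‖ R n`, the sum is `v = ‖y‖ R
  -- (e₁ - n)`. The rotation then disappears from the norm.
  · have h1 : v = ‖v - u‖ • act (R (v - u)) (!₂[1, 0, 0] - n) := by
      have hn : ‖v - u‖ ≠ 0 := norm_ne_zero_iff.2 hy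
      rw [act_sub, hR.map_axis _ hy, smul_sub, smul_smul, mul_inv_cancel₀ hn, one_smul]
      rw [eq_neg_of_add_eq_zero_left h]
      abel
    conv_rhs => rw [h1]
    rw [norm_smul, norm_norm, norm_act (hR.mem_SO _ hy)]

end Collision

/-! ### Gaussian and exponential laws: null sets, positivity, moments. -/

section Laws

lemma pi_absolutelyContinuous {n : ℕ} (μ ν : Fin n → Measure ℝ) [∀ i, SigmaFinite (μ i)]
    [∀ i, SigmaFinite (ν i)] (h : ∀ i, μ i ≪ ν i) : Measure.pi μ ≪ Measure.pi ν := by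
  induction n with
  | zero => rw [Measure.pi_of_empty, Measure.pi_of_empty]
  | succ n ih =>
    have h1 := measurePreserving_piFinSuccAbove μ 0
    have h2 := measurePreserving_piFinSuccAbove ν 0
    have h3 := (h 0).prod (ih (fun j => μ (Fin.succAbove 0 j)) (fun j => ν (Fin.succAbove 0 j))
      fun j => h _)
    rw [← h1.map_eq, ← h2.map_eq] at h3
    intro s hs
    have e : ∀ κ : Measure (Fin (n + 1) → ℝ), κ s =
        (κ.map (MeasurableEquiv.piFinSuccAbove (fun _ => ℝ) 0))
          ((MeasurableEquiv.piFinSuccAbove (fun _ => ℝ) 0).symm ⁻¹' s) := fun κ => by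
      rw [MeasurableEquiv.map_apply, ← Set.preimage_comp]
      simp
    rw [e] at hs ⊢
    exact h3 hs

/-- The law of the thermal velocities. -/
noncomputable abbrev thermalLaw (σ : ℝ) : Measure E3 :=
  multivariateGaussian 0 (σ ^ 2 • (1 : Matrix (Fin 3) (Fin 3) ℝ))

lemma thermalLaw_eq_map (σ : ℝ) :
    thermalLaw σ = (stdGaussian E3).map (fun x => σ • x) := by
  refine Measure.ext_of_charFun ?_
  ext t
  have hS : (σ ^ 2 • (1 : Matrix (Fin 3) (Fin 3) ℝ)).PosSemidef :=
    Matrix.PosSemidef.one.smul (sq_nonneg σ)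
  rw [charFun_map_smul, charFun_multivariateGaussian hS, charFun_stdGaussian]
  congr 1
  simp only [inner_zero_right, Complex.ofReal_zero, zero_mul, zero_sub, Matrix.smul_mulVec,
    Matrix.one_mulVec]
  rw [← Complex.ofReal_pow ‖σ • t‖, norm_smul, mul_pow, norm_sq_eq_coords, Real.norm_eq_abs, sq_abs]
  simp only [dotProduct, Fin.sum_univ_three, Pi.smul_apply, smul_eq_mul]
  push_cast
  ring

lemma map_toLp_volume : (volume : Measure (Fin 3 → ℝ)).map (WithLp.toLp 2) = (volume : Measure E3) :=
  (PiLp.volume_preserving_toLp (Fin 3)).map_eq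

lemma stdGaussian_absolutelyContinuous : stdGaussian E3 ≪ volume := by
  rw [← map_pi_eq_stdGaussian, ← map_toLp_volume]
  exact (pi_absolutelyContinuous _ _ fun _ => gaussianReal_absolutelyContinuous 0 one_ne_zero).map
    (PiLp.continuous_toLp 2 _).measurable

lemma absolutelyContinuous_stdGaussian : (volume : Measure E3) ≪ stdGaussian E3 := by
  rw [← map_pi_eq_stdGaussian, ← map_toLp_volume]
  exact (pi_absolutelyContinuous _ _ fun _ => gaussianReal_absolutelyContinuous' 0 one_ne_zero).map
    (PiLp.continuous_toLp 2 _).measurable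

lemma thermalLaw_sphere {σ : ℝ} (hσ : 0 < σ) (c : E3) (ρ : ℝ) :
    thermalLaw σ (Metric.sphere c ρ) = 0 := by
  rw [thermalLaw_eq_map, Measure.map_apply (by fun_prop) Metric.isClosed_sphere.measurableSet]
  refine stdGaussian_absolutelyContinuous (measure_mono_null ?_
    (Measure.addHaar_sphere volume (σ⁻¹ • c) (σ⁻¹ * ρ)))
  intro x hx
  simp only [Set.mem_preimage, mem_sphere_iff_norm] at hx ⊢
  have : x - σ⁻¹ • c = σ⁻¹ • (σ • x - c) := by
    rw [smul_sub, smul_smul, inv_mul_cancel₀ hσ.ne', one_smul]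
  rw [this, norm_smul, hx, Real.norm_of_nonneg (by positivity)]

lemma thermalLaw_ball {σ : ℝ} (hσ : 0 < σ) (c : E3) : thermalLaw σ (Metric.ball c 1) ≠ 0 := by
  rw [thermalLaw_eq_map, Measure.map_apply (by fun_prop) Metric.isOpen_ball.measurableSet]
  intro h
  have hopen : IsOpen ((fun x : E3 => σ • x) ⁻¹' Metric.ball c 1) :=
    Metric.isOpen_ball.preimage (by fun_prop)
  have := hopen.measure_eq_zero_iff volume |>.1 (absolutelyContinuous_stdGaussian h)
  have hmem : σ⁻¹ • c ∈ (fun x : E3 => σ • x) ⁻¹' Metric.ball c 1 := by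
    simp [smul_smul, hσ.ne']
  rw [this] at hmem
  exact hmem

lemma expMeasure_Ioo {lam : ℝ} (hlam : 0 < lam) {s t : ℝ} (hs : 0 ≤ s) (hst : s < t) :
    expMeasure lam (Set.Ioo s t) ≠ 0 := by
  have e : expMeasure lam = volume.withDensity (exponentialPDF lam) := rfl
  rw [e]
  have hm : Measurable (exponentialPDF lam) := (measurable_exponentialPDFReal lam).ennreal_ofReal
  rw [Ne, withDensity_apply_eq_zero hm]
  intro h
  have hsub : Set.Ioo s t ⊆ {x | exponentialPDF lam x ≠ 0} ∩ Set.Ioo s t := by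
    intro x hx
    refine ⟨?_, hx⟩
    have := exponentialPDFReal_pos hlam (hs.trans_lt hx.1)
    simpa [exponentialPDF] using this
  have := measure_mono_null hsub h
  simp at this
  linarith

lemma expMeasure_Ioi (lam : ℝ) : ∀ᵐ x ∂expMeasure lam, 0 < x := by
  have e : expMeasure lam = volume.withDensity (exponentialPDF lam) := rfl
  have hm : Measurable (exponentialPDF lam) := (measurable_exponentialPDFReal lam).ennreal_ofReal
  rw [e, ae_withDensity_iff hm]
  have h0 : ∀ᵐ x : ℝ, x ≠ 0 := by simp [ae_iff]
  filter_upwards [h0] with x hx0 hx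
  by_contra hneg
  exact hx (exponentialPDF_of_neg (lt_of_le_of_ne (not_lt.1 hneg) hx0))

/-- Half of the exponential decay absorbs the power: `xⁿ exp (-lam x / 2)` is bounded, so the
integrand is at most a multiple of the exponential density of rate `lam / 2`. -/
lemma memLp_id_expMeasure {lam : ℝ} (hlam : 0 < lam) (n : ℕ) (hn : n ≠ 0) :
    MemLp id n (expMeasure lam) := by
  refine ⟨aestronglyMeasurable_id, ?_⟩
  rw [eLpNorm_lt_top_iff_lintegral_rpow_enorm_lt_top (by simpa using hn) (by simp)]
  have e : expMeasure lam = volume.withDensity (exponentialPDF lam) := rfl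
  have hm : Measurable (exponentialPDF lam) := (measurable_exponentialPDFReal lam).ennreal_ofReal
  have hn' : Measurable fun x : ℝ => ‖id x‖ₑ ^ (n : ENNReal).toReal := by fun_prop
  rw [e, lintegral_withDensity_eq_lintegral_mul _ hm hn']
  set C : ℝ := n.factorial * (2 / lam) ^ n * 2 with hC
  have hbound : ∀ x, (exponentialPDF lam * fun x : ℝ => ‖id x‖ₑ ^ (n : ENNReal).toReal) x ≤
      ENNReal.ofReal C * exponentialPDF (lam / 2) x := by
    intro x
    rcases lt_or_ge x 0 with hx | hx
    · simp [exponentialPDF_of_neg hx]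
    · simp only [Pi.mul_apply, exponentialPDF_of_nonneg hx, id, ENNReal.toReal_natCast,
        ENNReal.rpow_natCast]
      rw [Real.enorm_eq_ofReal hx, ← ENNReal.ofReal_pow hx, ← ENNReal.ofReal_mul (by positivity),
        ← ENNReal.ofReal_mul (by positivity)]
      refine ENNReal.ofReal_le_ofReal ?_
      have h1 := Real.pow_div_factorial_le_exp (lam / 2 * x) (by positivity) n
      rw [div_le_iff₀ (by positivity), mul_pow] at h1
      have h2 : Real.exp (-(lam * x)) = Real.exp (-(lam / 2 * x)) * Real.exp (-(lam / 2 * x)) := by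
        rw [← Real.exp_add]; ring_nf
      have h3 : Real.exp (lam / 2 * x) * Real.exp (-(lam / 2 * x)) = 1 := by
        rw [← Real.exp_add]; simp
      have h4 : x ^ n = (2 / lam) ^ n * ((lam / 2) ^ n * x ^ n) := by
        rw [← mul_assoc, ← mul_pow]
        have : 2 / lam * (lam / 2) = 1 := by field_simp
        rw [this, one_pow, one_mul]
      have h5 : x ^ n * Real.exp (-(lam / 2 * x)) ≤ (2 / lam) ^ n * n.factorial := by
        rw [h4]
        calc (2 / lam) ^ n * ((lam / 2) ^ n * x ^ n) * Real.exp (-(lam / 2 * x))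
            ≤ (2 / lam) ^ n * (Real.exp (lam / 2 * x) * n.factorial) *
              Real.exp (-(lam / 2 * x)) := by gcongr
          _ = (2 / lam) ^ n * n.factorial *
              (Real.exp (lam / 2 * x) * Real.exp (-(lam / 2 * x))) := by ring
          _ = _ := by rw [h3, mul_one]
      rw [h2, hC]
      have h6 := mul_le_mul_of_nonneg_left h5
        (by positivity : 0 ≤ lam * Real.exp (-(lam / 2 * x)))
      linarith
  calc _ ≤ ∫⁻ x, ENNReal.ofReal C * exponentialPDF (lam / 2) x := lintegral_mono hbound
    _ = ENNReal.ofReal C := by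
      have hm' : Measurable (exponentialPDF (lam / 2)) :=
        (measurable_exponentialPDFReal _).ennreal_ofReal
      rw [lintegral_const_mul _ hm', lintegral_exponentialPDF_eq_one (by positivity), mul_one]
    _ < ⊤ := ENNReal.ofReal_lt_top

end Laws

/-! ### Random linear recursions. -/

section LinearRecursion

/-- A linear recursion driven by an i.i.d. sequence. -/
def linearRec {N : Type*} (f g : N → ℝ) (K : ℝ) (y : ℕ → N) : ℕ → ℝ
  | 0 => K
  | k + 1 => f (y k) * linearRec f g K y k + g (y k)

variable {Ω N : Type*} [MeasurableSpace N] {z : ℕ → Ω → N}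

/-- The `k`-th value uses inputs of index below `k` only, hence is independent of the coefficient
that multiplies it next. -/
lemma measurable_linearRec' {f g : N → ℝ} (hf : Measurable f) (hg : Measurable g) (K : ℝ) (k : ℕ) :
    Measurable[⨆ j ∈ Set.Iio k, MeasurableSpace.comap (z j) inferInstance]
      fun w => linearRec f g K (fun j => z j w) k := by
  induction k with
  | zero => exact measurable_const
  | succ k ih =>
    have h1 : Measurable[⨆ j ∈ Set.Iio (k + 1), MeasurableSpace.comap (z j) inferInstance] (z k) := by
      rw [measurable_iff_comap_le]
      exact le_iSup₂ (f := fun j (_ : j ∈ Set.Iio (k + 1)) =>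
        MeasurableSpace.comap (z j) inferInstance) k (by simp)
    have h2 := ih.mono (biSup_mono fun j hj => lt_trans (Set.mem_Iio.1 hj) (Nat.lt_succ_self k))
      le_rfl
    exact ((hf.comp h1).mul h2).add (hg.comp h1)

lemma measurable_linearRec {f g : N → ℝ} (hf : Measurable f) (hg : Measurable g) (K : ℝ) (k : ℕ) :
    Measurable fun y : ℕ → N => linearRec f g K y k := by
  induction k with
  | zero => exact measurable_const
  | succ k ih =>
    exact ((hf.comp (measurable_pi_apply k)).mul ih).add (hg.comp (measurable_pi_apply k))

end LinearRecursion

/-! ### Independent inputs: strong law, zero-one argument, moment bounds. -/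

section IID

variable {Ω N : Type*} [mΩ : MeasurableSpace Ω] [MeasurableSpace N] {μ : Measure Ω}
  {z : ℕ → Ω → N}

/-- The filtration generated by a sequence of random elements. -/
def past (z : ℕ → Ω → N) (hz : ∀ k, Measurable (z k)) : Filtration ℕ mΩ where
  seq i := ⨆ j ∈ Set.Iic i, MeasurableSpace.comap (z j) inferInstance
  mono' _ _ hik := biSup_mono fun _ hj => le_trans (Set.mem_Iic.1 hj) hik
  le' _ := iSup₂_le fun j _ => (hz j).comap_le

/-- A sequence of independent random elements with the same law `P`. -/
structure IsIID (z : ℕ → Ω → N) (P : Measure N) (μ : Measure Ω) : Prop where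
  measurable : ∀ k, Measurable (z k)
  indep : iIndepFun z μ
  law : ∀ k, μ.map (z k) = P

lemma measurable_past (hz : ∀ k, Measurable (z k)) {i j : ℕ} (hij : j ≤ i) :
    Measurable[past z hz i] (z j) := by
  rw [measurable_iff_comap_le]
  exact le_iSup₂ (f := fun j (_ : j ∈ Set.Iic i) => MeasurableSpace.comap (z j) inferInstance) j hij

namespace IsIID

variable {P : Measure N}

lemma shift (h : IsIID z P μ) (m : ℕ) : IsIID (fun k => z (m + k)) P μ where
  measurable _ := h.measurable _
  indep := h.indep.precomp (add_right_injective m)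
  law _ := h.law _

lemma ae_law (h : IsIID z P μ) {p : N → Prop} (hp : ∀ᵐ x ∂P, p x) : ∀ᵐ w ∂μ, ∀ k, p (z k w) := by
  rw [ae_all_iff]
  intro k
  rw [← h.law k] at hp
  exact ae_of_ae_map (h.measurable k).aemeasurable hp

lemma integral_comp (h : IsIID z P μ) {f : N → ℝ} (hf : Measurable f) (k : ℕ) :
    ∫ w, f (z k w) ∂μ = ∫ x, f x ∂P := by
  rw [← h.law k, integral_map (h.measurable k).aemeasurable hf.aestronglyMeasurable]

/-- The strong law of large numbers for functions of an i.i.d. sequence. -/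
lemma strong_law (h : IsIID z P μ) {f : N → ℝ} (hf : Measurable f) (hint : Integrable f P) :
    ∀ᵐ w ∂μ, Tendsto (fun n : ℕ => (∑ i ∈ Finset.range n, f (z i w)) / n) atTop
      (𝓝 (∫ x, f x ∂P)) := by
  rw [← h.integral_comp hf 0]
  refine strong_law_ae_real (fun i w => f (z i w)) ?_ ?_ ?_
  · rw [← h.law 0] at hint
    exact hint.comp_measurable (h.measurable 0)
  · intro i j hij
    exact (h.indep.indepFun hij).comp hf hf
  · intro i
    have hid : IdentDistrib (z i) (z 0) μ μ :=
      ⟨(h.measurable i).aemeasurable, (h.measurable 0).aemeasurable, by rw [h.law, h.law]⟩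
    exact hid.comp hf

lemma map_shift [IsProbabilityMeasure μ] (h : IsIID z P μ) (m : ℕ) :
    μ.map (fun w j => z (m + j) w) = μ.map (fun w j => z j w) := by
  rw [(h.shift m).indep.map_fun_eq_infinitePi_map (h.shift m).measurable,
    h.indep.map_fun_eq_infinitePi_map h.measurable]
  congr 1
  funext k
  rw [h.law, h.law]

lemma indep_past_future (h : IsIID z P μ) (i : ℕ) :
    Indep (MeasurableSpace.comap (fun w j => z (i + 1 + j) w) inferInstance)
      (past z h.measurable i) μ := by
  have h1 : Indep (⨆ k ∈ Set.Ioi i, MeasurableSpace.comap (z k) inferInstance)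
      (⨆ k ∈ Set.Iic i, MeasurableSpace.comap (z k) inferInstance) μ :=
    indep_iSup_of_disjoint (fun k => (h.measurable k).comap_le) h.indep
      (Set.disjoint_left.2 fun k hk hk' => absurd (Set.mem_Iic.1 hk') (not_le.2 (Set.mem_Ioi.1 hk)))
  refine indep_of_indep_of_le_left h1 ?_
  rw [← measurable_iff_comap_le]
  refine @measurable_pi_lambda _ _ _ (_) _ _ fun j => ?_
  rw [measurable_iff_comap_le]
  exact le_iSup₂ (f := fun j (_ : j ∈ Set.Ioi i) => MeasurableSpace.comap (z j) inferInstance)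
    (i + 1 + j) (by simp only [Set.mem_Ioi]; omega)

/-- If adapted events occur infinitely often, then infinitely often they are followed by a future
in a given set of positive probability. -/
lemma frequently_and_future [IsProbabilityMeasure μ] (h : IsIID z P μ) {S : ℕ → Set Ω}
    (hS : ∀ i, MeasurableSet[past z h.measurable i] (S i)) {A : Set (ℕ → N)} (hA : MeasurableSet A)
    (hpos : μ {w | (fun j => z j w) ∈ A} ≠ 0) :
    ∀ᵐ w ∂μ, (∃ᶠ i in atTop, w ∈ S i) →
      ∃ᶠ i in atTop, w ∈ S i ∧ (fun j => z (i + 1 + j) w) ∈ A := by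
  set ℱ := past z h.measurable with hℱ
  set B : ℕ → Set Ω := fun i => {w | (fun j => z (i + 1 + j) w) ∈ A} with hBdef
  have hshift : ∀ m, Measurable fun (w : Ω) j => z (m + j) w := fun m =>
    measurable_pi_lambda _ fun j => h.measurable _
  have hBm : ∀ i, MeasurableSet (B i) := fun i => hshift (i + 1) hA
  have hBp : ∀ i, μ.real (B i) = μ.real {w | (fun j => z j w) ∈ A} := by
    intro i
    have h1 : μ.map (fun w j => z (i + 1 + j) w) A = μ.map (fun w j => z j w) A := by
      rw [h.map_shift]
    rw [Measure.map_apply (hshift _) hA, Measure.map_apply (measurable_pi_lambda _ h.measurable) hA]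
      at h1
    exact congrArg ENNReal.toReal h1
  set δ := μ.real {w | (fun j => z j w) ∈ A} with hδ
  have hδ0 : 0 < δ := ENNReal.toReal_pos hpos (measure_ne_top _ _)
  have hBsup : ∀ i, MeasurableSet[⨆ n, ℱ n] (B i) := by
    intro i
    have : Measurable[⨆ n, ℱ n] fun (w : Ω) j => z (i + 1 + j) w := by
      refine @measurable_pi_lambda _ _ _ (_) _ _ fun j => ?_
      exact (measurable_past h.measurable le_rfl).mono (le_iSup ℱ (i + 1 + j)) le_rfl
    exact this hA
  have hEsup : ∀ m, MeasurableSet[⨆ n, ℱ n] (⋃ i, ⋃ (_ : m ≤ i), S i ∩ B i) := by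
    intro m
    refine MeasurableSet.iUnion fun i => MeasurableSet.iUnion fun _ => ?_
    exact MeasurableSet.inter (le_iSup ℱ i _ (hS i)) (hBsup i)
  have hle : (⨆ n, ℱ n) ≤ mΩ := iSup_le fun n => ℱ.le n
  -- Lévy's upward theorem: the conditional probabilities of `E` given the past converge to its
  -- indicator. At each `i ≥ m` with `S i` they are at least the probability `δ` of a future in `A`,
  -- so along infinitely many such `i` the limit is at least `δ > 0`, which means `E` occurs.
  have key : ∀ m, ∀ᵐ w ∂μ, (∃ᶠ i in atTop, w ∈ S i) → w ∈ ⋃ i, ⋃ (_ : m ≤ i), S i ∩ B i := by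
    intro m
    set E := ⋃ i, ⋃ (_ : m ≤ i), S i ∩ B i with hE
    have hEm : MeasurableSet E := hle _ (hEsup m)
    set g : Ω → ℝ := E.indicator fun _ => 1 with hg
    have hgint : Integrable g μ := (integrable_const 1).indicator hEm
    have hgm : StronglyMeasurable[⨆ n, ℱ n] g :=
      StronglyMeasurable.indicator stronglyMeasurable_const (hEsup m)
    have hlim := hgint.tendsto_ae_condExp hgm
    have hcond : ∀ i, m ≤ i → ∀ᵐ w ∂μ, w ∈ S i → δ ≤ (μ[g | ℱ i]) w := by
      intro i hi
      set b : Ω → ℝ := (B i).indicator fun _ => 1 with hb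
      have hbint : Integrable b μ := (integrable_const 1).indicator (hBm i)
      have h1 : μ[b | ℱ i] =ᵐ[μ] fun _ => δ := by
        have := condExp_indep_eq (f := b) (hshift (i + 1)).comap_le (ℱ.le i)
          (StronglyMeasurable.indicator stronglyMeasurable_const ⟨A, hA, rfl⟩)
          (h.indep_past_future i)
        refine this.trans (Eventually.of_forall fun _ => ?_)
        simp only [hb]
        rw [integral_indicator_const _ (hBm i), smul_eq_mul, mul_one, hBp]
      have h2 : μ[(S i).indicator b | ℱ i] =ᵐ[μ] (S i).indicator (μ[b | ℱ i]) :=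
        condExp_indicator hbint (hS i)
      have h3 : μ[(S i).indicator b | ℱ i] ≤ᵐ[μ] μ[g | ℱ i] := by
        refine condExp_mono (hbint.indicator (ℱ.le i _ (hS i))) hgint
          (Eventually.of_forall fun w => ?_)
        by_cases h1 : w ∈ S i
        · by_cases h2 : w ∈ B i
          · have : w ∈ E := Set.mem_iUnion₂.2 ⟨i, hi, h1, h2⟩
            simp [hg, hb, h1, h2, this]
          · simp only [hb, hg, Set.indicator_of_mem h1, Set.indicator_of_notMem h2]
            exact Set.indicator_nonneg (fun _ _ => zero_le_one) _
        · simp only [hg, Set.indicator_of_notMem h1]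
          exact Set.indicator_nonneg (fun _ _ => zero_le_one) _
      filter_upwards [h1, h2, h3] with w e1 e2 e3 hw
      rw [e2, Set.indicator_of_mem hw, e1] at e3
      exact e3
    have hcond' : ∀ᵐ w ∂μ, ∀ i, m ≤ i → w ∈ S i → δ ≤ (μ[g | ℱ i]) w := by
      rw [ae_all_iff]; intro i
      by_cases hi : m ≤ i
      · filter_upwards [hcond i hi] with w hw _ using hw
      · exact Eventually.of_forall fun w h => absurd h hi
    filter_upwards [hlim, hcond'] with w h1 h2 hfreq
    have h3 : δ ≤ g w := by
      refine ge_of_tendsto_of_frequently h1 ?_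
      refine (hfreq.and_eventually (eventually_ge_atTop m)).mono fun i hi => h2 i hi.2 hi.1
    by_contra hw
    simp only [hg, Set.indicator_of_notMem hw] at h3
    linarith
  rw [← ae_all_iff] at key
  filter_upwards [key] with w hw hfreq
  rw [frequently_atTop]
  intro m
  obtain ⟨i, hi, h1, h2⟩ := Set.mem_iUnion₂.1 (hw m hfreq)
  exact ⟨i, hi, h1, h2⟩

/-- One-step version of `frequently_and_future`. -/
lemma frequently_and_next [IsProbabilityMeasure μ] (h : IsIID z P μ) {S : ℕ → Set Ω}
    (hS : ∀ i, MeasurableSet[past z h.measurable i] (S i)) {A : Set N} (hA : MeasurableSet A)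
    (hpos : P A ≠ 0) :
    ∀ᵐ w ∂μ, (∃ᶠ i in atTop, w ∈ S i) → ∃ᶠ i in atTop, w ∈ S i ∧ z (i + 1) w ∈ A := by
  refine h.frequently_and_future hS (A := {y | y 0 ∈ A}) (measurable_pi_apply 0 hA) ?_
  rw [← h.law 0, Measure.map_apply (h.measurable 0) hA] at hpos
  exact hpos

/-- Minkowski's inequality; by independence the norm of the product is the product of the norms. -/
lemma linearRec_eLpNorm_le [IsProbabilityMeasure μ] (h : IsIID z P μ) {f g : N → ℝ}
    (hf : Measurable f) (hg : Measurable g) (K : ℝ) (k : ℕ) :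
    eLpNorm (fun w => linearRec f g K (fun j => z j w) (k + 1)) 8 μ ≤
      eLpNorm f 8 P * eLpNorm (fun w => linearRec f g K (fun j => z j w) k) 8 μ +
        eLpNorm g 8 P := by
  have hzm : Measurable fun (w : Ω) j => z j w := measurable_pi_lambda _ h.measurable
  have hY : Measurable fun w => linearRec f g K (fun j => z j w) k :=
    (measurable_linearRec hf hg K k).comp hzm
  have hfz : Measurable fun w => f (z k w) := hf.comp (h.measurable k)
  have hgz : Measurable fun w => g (z k w) := hg.comp (h.measurable k)
  have e1 : ∀ {φ : N → ℝ}, Measurable φ → eLpNorm (fun w => φ (z k w)) 8 μ = eLpNorm φ 8 P := by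
    intro φ hφ
    rw [← h.law k, eLpNorm_map_measure hφ.aestronglyMeasurable (h.measurable k).aemeasurable]
    rfl
  have hind : IndepFun (fun w => f (z k w)) (fun w => linearRec f g K (fun j => z j w) k) μ := by
    have h1 : Indep (⨆ j ∈ ({k} : Set ℕ), MeasurableSpace.comap (z j) inferInstance)
        (⨆ j ∈ Set.Iio k, MeasurableSpace.comap (z j) inferInstance) μ :=
      indep_iSup_of_disjoint (fun k => (h.measurable k).comap_le) h.indep (by simp)
    rw [IndepFun_iff_Indep]
    refine indep_of_indep_of_le_left (indep_of_indep_of_le_right h1 ?_) ?_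
    · exact (measurable_linearRec' hf hg K k).comap_le
    · rw [iSup_singleton, ← measurable_iff_comap_le]
      exact hf.comp (comap_measurable (z k))
  have e2 : eLpNorm (fun w => f (z k w) * linearRec f g K (fun j => z j w) k) 8 μ =
      eLpNorm (fun w => f (z k w)) 8 μ *
        eLpNorm (fun w => linearRec f g K (fun j => z j w) k) 8 μ := by
    simp only [eLpNorm_eq_lintegral_rpow_enorm_toReal (by norm_num : (8 : ENNReal) ≠ 0)
      (by norm_num : (8 : ENNReal) ≠ ⊤)]
    rw [← ENNReal.mul_rpow_of_nonneg _ _ (by positivity)]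
    congr 1
    have hi2 : IndepFun (fun w => ‖f (z k w)‖ₑ ^ (8 : ENNReal).toReal)
        (fun w => ‖linearRec f g K (fun j => z j w) k‖ₑ ^ (8 : ENNReal).toReal) μ :=
      hind.comp (φ := fun x : ℝ => ‖x‖ₑ ^ (8 : ENNReal).toReal)
        (ψ := fun x : ℝ => ‖x‖ₑ ^ (8 : ENNReal).toReal) (by fun_prop) (by fun_prop)
    have := lintegral_mul_eq_lintegral_mul_lintegral_of_indepFun
      (hfz.enorm.pow_const _) (hY.enorm.pow_const _) hi2
    rw [← this]
    refine lintegral_congr fun w => ?_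
    rw [enorm_mul, ENNReal.mul_rpow_of_nonneg _ _ (by positivity)]
    rfl
  calc eLpNorm (fun w => linearRec f g K (fun j => z j w) (k + 1)) 8 μ
      ≤ eLpNorm (fun w => f (z k w) * linearRec f g K (fun j => z j w) k) 8 μ +
        eLpNorm (fun w => g (z k w)) 8 μ :=
        eLpNorm_add_le (hfz.mul hY).aestronglyMeasurable hgz.aestronglyMeasurable (by norm_num)
    _ = _ := by rw [e2, e1 hf, e1 hg]

/-- Bounded eighth moments of a contracting linear recursion. -/
lemma linearRec_eLpNorm_bdd [IsProbabilityMeasure μ] (h : IsIID z P μ) {f g : N → ℝ}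
    (hf : Measurable f) (hg : Measurable g) (hf1 : eLpNorm f 8 P < 1) (hg8 : eLpNorm g 8 P < ⊤)
    (K : ℝ) : ∃ B : ENNReal, B < ⊤ ∧
      ∀ k, eLpNorm (fun w => linearRec f g K (fun j => z j w) k) 8 μ ≤ B := by
  set α := eLpNorm f 8 P
  set γ := eLpNorm g 8 P
  have h1α : (1 - α) ≠ 0 := (tsub_pos_of_lt hf1).ne'
  -- The value `γ / (1 - α)` is the fixed point of `x ↦ α x + γ`; the extra `‖K‖ₑ` accommodates the
  -- initial value.
  refine ⟨‖K‖ₑ + γ / (1 - α), ENNReal.add_lt_top.2 ⟨enorm_lt_top,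
    ENNReal.div_lt_top hg8.ne h1α⟩, fun k => ?_⟩
  induction k with
  | zero =>
    simp only [linearRec]
    rw [eLpNorm_const _ (by norm_num) (NeZero.ne μ)]
    simp
  | succ k ih =>
    refine (h.linearRec_eLpNorm_le hf hg K k).trans ?_
    have h1 : α * (‖K‖ₑ + γ / (1 - α)) + γ ≤ ‖K‖ₑ + γ / (1 - α) := by
      have h2 : γ = (1 - α) * (γ / (1 - α)) := by
        rw [ENNReal.mul_div_cancel h1α (by simp)]
      have h3 : α * (γ / (1 - α)) + γ = γ / (1 - α) := by
        nth_rewrite 2 [h2]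
        rw [← add_mul, add_tsub_cancel_of_le hf1.le, one_mul]
      calc α * (‖K‖ₑ + γ / (1 - α)) + γ = α * ‖K‖ₑ + (α * (γ / (1 - α)) + γ) := by ring
        _ ≤ 1 * ‖K‖ₑ + γ / (1 - α) := by rw [h3]; gcongr
        _ = _ := by rw [one_mul]
    exact le_trans (by gcongr) h1

/-- A contracting linear recursion with finite eighth moments grows more slowly than the fourth
root. -/
lemma linearRec_growth [IsProbabilityMeasure μ] (h : IsIID z P μ) {f g : N → ℝ}
    (hf : Measurable f) (hg : Measurable g) (hf1 : eLpNorm f 8 P < 1) (hg8 : eLpNorm g 8 P < ⊤)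
    (K : ℝ) {θ : ℝ} (hθ : 0 < θ) :
    ∀ᵐ w ∂μ, ∀ᶠ k : ℕ in atTop, linearRec f g K (fun j => z j w) k ^ 4 ≤ θ * k := by
  obtain ⟨B, hB, hYB⟩ := h.linearRec_eLpNorm_bdd hf hg hf1 hg8 K
  have hzm : Measurable fun (w : Ω) j => z j w := measurable_pi_lambda _ h.measurable
  have hY : ∀ k, Measurable fun w => linearRec f g K (fun j => z j w) k := fun k =>
    (measurable_linearRec hf hg K k).comp hzm
  set Y : ℕ → Ω → ℝ := fun k w => linearRec f g K (fun j => z j w) k with hYdef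
  set s : ℕ → ENNReal := fun k => ENNReal.ofReal (1 / ((k : ℝ) + 1) ^ 2) with hs
  have hsum : Summable fun k : ℕ => 1 / ((k : ℝ) + 1) ^ 2 := by
    have := (summable_nat_add_iff 1).2 (Real.summable_one_div_nat_pow.2 one_lt_two)
    simpa using this
  have hL : ∀ k, ∫⁻ w, ‖Y k w‖ₑ ^ 8 ∂μ ≤ B ^ 8 := by
    intro k
    have h1 := hYB k
    rw [eLpNorm_eq_lintegral_rpow_enorm_toReal (by norm_num) (by norm_num)] at h1
    have h2 : ((∫⁻ w, ‖Y k w‖ₑ ^ (8 : ENNReal).toReal ∂μ) ^ (1 / (8 : ENNReal).toReal)) ^ 8 ≤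
      B ^ 8 := by gcongr
    rw [← ENNReal.rpow_natCast, ← ENNReal.rpow_mul] at h2
    have e : (1 / (8 : ENNReal).toReal) * ((8 : ℕ) : ℝ) = 1 := by norm_num
    rw [e, ENNReal.rpow_one] at h2
    have e8 : (8 : ENNReal).toReal = ((8 : ℕ) : ℝ) := by norm_num
    simpa [e8, ENNReal.rpow_natCast] using h2
  -- Bounded eighth moments make the series of `Y k ^ 8 / (k + 1)²` integrable, so almost surely its
  -- terms tend to zero, which is `Y k ^ 4 = o(k)`.
  have htsum : ∫⁻ w, ∑' k, s k * ‖Y k w‖ₑ ^ 8 ∂μ ≠ ⊤ := by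
    rw [lintegral_tsum fun k => by fun_prop]
    refine ne_top_of_le_ne_top (b := (∑' k, s k) * B ^ 8) ?_ ?_
    · refine ENNReal.mul_ne_top ?_ (ENNReal.pow_ne_top hB.ne)
      rw [hs, ← ENNReal.ofReal_tsum_of_nonneg (fun k => by positivity) hsum]
      exact ENNReal.ofReal_ne_top
    · rw [← ENNReal.tsum_mul_right]
      refine ENNReal.tsum_le_tsum fun k => ?_
      rw [lintegral_const_mul _ (by fun_prop)]
      gcongr
      exact hL k
  have hfin := ae_lt_top' (by fun_prop) htsum
  filter_upwards [hfin] with w hw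
  have ht := ENNReal.tendsto_atTop_zero_of_tsum_ne_top hw.ne
  have hev : ∀ᶠ k in atTop, s k * ‖Y k w‖ₑ ^ 8 < ENNReal.ofReal ((θ / 2) ^ 2) := by
    refine ht.eventually_lt_const ?_
    simpa using by positivity
  filter_upwards [hev, eventually_ge_atTop 1] with k hk hk1
  have hk1' : (1 : ℝ) ≤ k := by exact_mod_cast hk1
  rw [← ofReal_norm, ← ENNReal.ofReal_pow (norm_nonneg _), hs,
    ← ENNReal.ofReal_mul (by positivity), ENNReal.ofReal_lt_ofReal_iff (by positivity),
    div_mul_eq_mul_div, one_mul, div_lt_iff₀ (by positivity)] at hk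
  have h8 : (Y k w ^ 4) ^ 2 ≤ (θ * k) ^ 2 := by
    have : ‖Y k w‖ ^ 8 = (Y k w ^ 4) ^ 2 := by
      rw [Real.norm_eq_abs, ← pow_mul, Even.pow_abs (by decide)]
    rw [← this]
    have h9 : (θ / 2 * ((k : ℝ) + 1)) ^ 2 ≤ (θ * k) ^ 2 := by
      apply pow_le_pow_left₀ (by positivity)
      nlinarith
    rw [mul_pow] at h9
    linarith
  exact abs_le_of_sq_le_sq' h8 (by positivity) |>.2

end IsIID

end IID

/-! ### Trajectories, and the passage to scalar energy walks. -/

section Trajectory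

lemma abs_radialDist_add_sub_le (x y : E3) : |radialDist (x + y) - radialDist x| ≤ ‖y‖ := by
  have e := rotField_add 1 x y
  have h := abs_norm_sub_norm_le (rotField 1 (x + y)) (rotField 1 x)
  rw [e, add_sub_cancel_left, ← e, norm_rotField zero_le_one, norm_rotField zero_le_one, one_mul,
    one_mul, norm_rotField zero_le_one, one_mul] at h
  exact h.trans (radialDist_le_norm y)

/-- A strong outward kick of the thermal velocity forces a large horizontal velocity. -/
lemma one_le_radialDist_collide {ω ε K M A : ℝ} (hω : 0 < ω) (hε : 0 ≤ ε)
    (hA : A * ε = 3 + K + ω * M) (hA0 : 0 ≤ A) (hK : 0 ≤ K)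
    {R : E3 → Matrix (Fin 3) (Fin 3) ℝ} (hR : IsRotationChoice R) {x v n δ : E3}
    (hx : radialDist x ≤ M) (hu : ‖v - rotField ω x‖ ≤ K) (hn : ‖n‖ ≤ 1 - ε)
    (hδ : δ ∈ Metric.ball (!₂[A, 0, 0] : E3) 1) :
    1 ≤ radialDist (collide R v (rotField ω x + δ) n) ∧ ‖δ‖ ≤ A + 1 := by
  have hn0 : ‖(!₂[A, 0, 0] : E3)‖ = A := by
    rw [EuclideanSpace.norm_eq]
    simp [Fin.sum_univ_three, Real.sqrt_sq_eq_abs, abs_of_nonneg hA0]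
  have hr0 : radialDist (!₂[A, 0, 0] : E3) = A := by
    simp [radialDist, Real.sqrt_sq_eq_abs, abs_of_nonneg hA0]
  rw [mem_ball_iff_norm] at hδ
  have h1 : ‖δ‖ ≤ A + 1 := by
    have := norm_le_norm_add_norm_sub (!₂[A, 0, 0] : E3) δ
    rw [hn0] at this
    rw [← norm_neg, neg_sub] at hδ
    linarith
  refine ⟨?_, h1⟩
  have h2 := abs_radialDist_add_sub_le (!₂[A, 0, 0] : E3)
    ((δ - !₂[A, 0, 0]) + rotField ω x +
      (collide R v (rotField ω x + δ) n - (rotField ω x + δ)))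
  have e : (!₂[A, 0, 0] : E3) + ((δ - !₂[A, 0, 0]) + rotField ω x +
      (collide R v (rotField ω x + δ) n - (rotField ω x + δ))) =
      collide R v (rotField ω x + δ) n := by abel
  rw [e, hr0] at h2
  have h3 := norm_add₃_le (a := δ - !₂[A, 0, 0]) (b := rotField ω x)
    (c := collide R v (rotField ω x + δ) n - (rotField ω x + δ))
  rw [norm_collide_sub hR, norm_rotField hω.le] at h3
  have h4 : ‖v - (rotField ω x + δ)‖ ≤ K + (A + 1) := by
    rw [← sub_sub]
    exact (norm_sub_le _ _).trans (by linarith)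
  -- The kick of size about `A` also increases the relative speed, but the collision keeps only the
  -- share `1 - ε` of it. A margin `A ε` remains, and `hA` makes it cover all other terms and leave
  -- 1.
  have h5 : ‖v - (rotField ω x + δ)‖ * ‖n‖ ≤ (K + (A + 1)) * (1 - ε) :=
    mul_le_mul h4 hn (norm_nonneg _) (by linarith)
  have h6 : ω * radialDist x ≤ ω * M := mul_le_mul_of_nonneg_left hx hω.le
  have h7 := (abs_le.1 h2).1
  have h8 : 0 ≤ ε * K := mul_nonneg hε hK
  linarith

/-- A long flight at large horizontal velocity leads far away from the axis. -/
lemma radialDist_flight_ge {ω K M M' : ℝ} (hω : 0 < ω) {x v : E3} {t : ℝ} (ht : 0 ≤ t)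
    (hx : radialDist x ≤ M) (hw : ‖v - rotField ω x‖ ≤ K) (hv : 1 ≤ radialDist v)
    (hM' : 0 ≤ M') (hL : (M + M') * (K + ω * M') < relDist ω x v t) :
    M' ≤ radialDist (x + t • v) := by
  by_contra hlt
  push Not at hlt
  have hr := radialDist_nonneg x
  have hr' := radialDist_nonneg (x + t • v)
  have hK : 0 ≤ K := (norm_nonneg _).trans hw
  have h1 : t ≤ M + M' := by
    have e : t • rotField 1 v = rotField 1 (x + t • v) - rotField 1 x := by
      rw [rotField_add, rotField_smul]; abel
    have := norm_sub_le (rotField 1 (x + t • v)) (rotField 1 x)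
    rw [← e, norm_smul, norm_rotField zero_le_one, norm_rotField zero_le_one,
      norm_rotField zero_le_one, Real.norm_of_nonneg ht] at this
    nlinarith
  have h2 : ‖v - rotField ω (x + t • v)‖ ≤ K + ω * M' := by
    refine abs_le_of_sq_le_sq' ?_ (by positivity) |>.2
    rw [energy_flight]
    have h3 : ‖v - rotField ω x‖ ^ 2 ≤ K ^ 2 := pow_le_pow_left₀ (norm_nonneg _) hw 2
    have h4 : ω ^ 2 * radialDist (x + t • v) ^ 2 ≤ ω ^ 2 * M' ^ 2 := by gcongr
    have h5 : 0 ≤ ω ^ 2 * radialDist x ^ 2 := by positivity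
    have h6 : 0 ≤ K * (ω * M') := by positivity
    nlinarith
  have h3 := relDist_le_mul_max ω x v ht
  have h4 : max ‖v - rotField ω x‖ ‖v - rotField ω (x + t • v)‖ ≤ K + ω * M' :=
    max_le (hw.trans (by nlinarith)) h2
  have h5 : t * max ‖v - rotField ω x‖ ‖v - rotField ω (x + t • v)‖ ≤ (M + M') * (K + ω * M') :=
    mul_le_mul h1 h4 ((norm_nonneg _).trans (le_max_left _ _)) (by linarith)
  linarith

variable (ω : ℝ) (p : ℕ → ParticleState)

/-- Radial distance at the collisions. -/
noncomputable def rad (i : ℕ) : ℝ := radialDist (p (i + 1)).pos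

/-- Relative speed before the collisions. -/
noncomputable def speedIn (i : ℕ) : ℝ := ‖(p i).vel - rotField ω (p (i + 1)).pos‖

/-- Relative speed after the collisions. -/
noncomputable def speedOut (i : ℕ) : ℝ := ‖(p (i + 1)).vel - rotField ω (p (i + 1)).pos‖

/-- The relations between consecutive states of a particle that never gets stuck. -/
structure IsTrajectory (R : E3 → Matrix (Fin 3) (Fin 3) ℝ) (η Δ : ℕ → E3) (ξ : ℕ → ℝ)
    (τ : ℕ → ℝ) : Prop where
  pos_τ : ∀ k, 0 < τ k
  time : ∀ k, (p (k + 1)).time = (p k).time + τ k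
  pos : ∀ k, (p (k + 1)).pos = (p k).pos + τ k • (p k).vel
  vel : ∀ k, (p (k + 1)).vel =
    collide R (p k).vel (rotField ω (p (k + 1)).pos + Δ (k + 1)) (η (k + 1))
  dist : ∀ k, relDist ω (p k).pos (p k).vel (τ k) = ξ k

variable {ω p} {R : E3 → Matrix (Fin 3) (Fin 3) ℝ} {η Δ : ℕ → E3} {ξ τ : ℕ → ℝ}

lemma isTrajectory_particle (hω : 0 < ω) (x₀ v₀ : E3) (hξ : ∀ k, 0 < ξ k)
    (h : ∀ k, ¬ IsStuck (particle ω R η Δ ξ x₀ v₀ k).pos (particle ω R η Δ ξ x₀ v₀ k).vel) :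
    IsTrajectory ω (particle ω R η Δ ξ x₀ v₀) R η Δ ξ fun k =>
      flightTime ω (particle ω R η Δ ξ x₀ v₀ k).pos (particle ω R η Δ ξ x₀ v₀ k).vel (ξ k) where
  pos_τ k := flightTime_pos hω (h k) (hξ k)
  time _ := rfl
  pos _ := rfl
  vel _ := rfl
  dist k := relDist_flightTime hω (h k) (hξ k).le

namespace IsTrajectory

/-- Index `i` of the walk is the state `i + 1` of the particle, since state 0 is the start and not a
collision. The input of index `i + 1` governs that collision and the flight after it. -/
lemma energyWalk (hT : IsTrajectory ω p R η Δ ξ τ) (hω : 0 < ω) (hR : IsRotationChoice R)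
    (hη : ∀ k, ‖η k‖ ≤ 1) :
    EnergyWalk ω (rad p) (speedIn ω p) (speedOut ω p) (fun i => ‖η (i + 1)‖)
      (fun i => ‖Δ (i + 1)‖) (fun i => ξ (i + 1)) where
  r_nonneg _ := radialDist_nonneg _
  u_nonneg _ := norm_nonneg _
  w_nonneg _ := norm_nonneg _
  a_nonneg _ := norm_nonneg _
  a_le_one _ := hη _
  d_nonneg _ := norm_nonneg _
  ξ_nonneg k := by rw [← hT.dist]; exact relDist_nonneg _ _ _ (hT.pos_τ _).le
  radial k := by
    rw [← hT.dist (k + 1)]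
    have := abs_radialDist_sub_le (p (k + 1)).pos (p (k + 1)).vel ω (hT.pos_τ (k + 1)).le
    rwa [← hT.pos] at this
  energy k := by
    have := energy_flight ω (p (k + 1)).pos (p (k + 1)).vel (τ (k + 1))
    rwa [← hT.pos] at this
  collision k := by
    unfold speedOut speedIn
    rw [hT.vel k]
    exact norm_collide_sub_le hR _ _ _ _
  flight k := by
    rw [← hT.dist (k + 1)]
    have := flight_bound hω (p (k + 1)).pos (p (k + 1)).vel (hT.pos_τ (k + 1)).le
    rwa [← hT.pos] at this

lemma le_duration (hT : IsTrajectory ω p R η Δ ξ τ) (i : ℕ) :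
    ξ (i + 1) ≤ τ (i + 1) * max (speedOut ω p i) (speedIn ω p (i + 1)) := by
  have h := relDist_le_mul_max ω (p (i + 1)).pos (p (i + 1)).vel (hT.pos_τ (i + 1)).le
  rwa [← hT.pos, hT.dist] at h

lemma strictMono_time (hT : IsTrajectory ω p R η Δ ξ τ) : StrictMono fun k => (p k).time :=
  strictMono_nat_of_lt_succ fun k => by
    have := hT.pos_τ k
    linarith [hT.time k]

lemma collisionIndex_eq (hT : IsTrajectory ω p R η Δ ξ τ) {t : ℝ} {k : ℕ} (h1 : (p k).time ≤ t)
    (h2 : t < (p (k + 1)).time) : collisionIndex p t = k := by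
  have : {j | (p j).time ≤ t} = Set.Iic k := by
    ext j
    constructor
    · intro hj
      have : (p j).time < (p (k + 1)).time := lt_of_le_of_lt hj h2
      exact Nat.lt_succ_iff.1 (hT.strictMono_time.lt_iff_lt.1 this)
    · intro hj
      exact (hT.strictMono_time.monotone (Set.mem_Iic.1 hj)).trans h1
  rw [collisionIndex, this, csSup_Iic]

lemma radialDist_posAt_ge (hT : IsTrajectory ω p R η Δ ξ τ) {t : ℝ} {i : ℕ}
    (h1 : (p (i + 1)).time ≤ t) (h2 : t < (p (i + 1 + 1)).time) :
    rad p i - 2 * ξ (i + 1) ≤ radialDist (posAt p t) := by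
  have hi := hT.collisionIndex_eq h1 h2
  unfold posAt velAt
  rw [hi]
  have hs : 0 ≤ t - (p (i + 1)).time := by linarith
  have h3 := abs_radialDist_sub_le (p (i + 1)).pos (p (i + 1)).vel ω hs
  have h4 : relDist ω (p (i + 1)).pos (p (i + 1)).vel (t - (p (i + 1)).time) ≤ ξ (i + 1) := by
    rw [← hT.dist (i + 1)]
    refine relDist_mono _ _ _ ?_
    rw [hT.time] at h2; linarith
  have := (abs_le.1 h3).1
  unfold rad
  linarith

/-- During a flight both parts of the quotient are controlled by collision data: the relative speed
by its end values, the radial distance by its start minus twice the path length. -/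
lemma relError_le (hT : IsTrajectory ω p R η Δ ξ τ) (hω : 0 < ω) {t δ : ℝ} {i : ℕ}
    (h1 : (p (i + 1)).time ≤ t) (h2 : t < (p (i + 1 + 1)).time) (hδ : 0 ≤ δ)
    (hr : 0 < rad p i - 2 * ξ (i + 1))
    (hm : max (speedOut ω p i) (speedIn ω p (i + 1)) ≤ δ * (ω * (rad p i - 2 * ξ (i + 1)))) :
    relError ω p t ≤ δ := by
  have h3 := hT.radialDist_posAt_ge h1 h2
  have hi := hT.collisionIndex_eq h1 h2
  unfold relError
  rw [norm_rotField hω.le, div_le_iff₀ (mul_pos hω (by linarith))]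
  have h4 : ‖velAt p t - rotField ω (posAt p t)‖ ≤
      max (speedOut ω p i) (speedIn ω p (i + 1)) := by
    unfold posAt velAt
    rw [hi]
    have hs : 0 ≤ t - (p (i + 1)).time := by linarith
    have h5 := relSpeed_le_max ω (p (i + 1)).pos (p (i + 1)).vel hs
      (t := τ (i + 1)) (by rw [hT.time] at h2; linarith)
    rwa [← hT.pos] at h5
  refine (h4.trans hm).trans ?_
  gcongr

/-- One collision and one flight with suitable random input lead from a bounded region to a large
radial distance. -/
lemma kick (hT : IsTrajectory ω p R η Δ ξ τ) (hω : 0 < ω) (hR : IsRotationChoice R)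
    (hη : ∀ k, ‖η k‖ ≤ 1) {ε K M M' A L : ℝ} (hε : 0 ≤ ε) (hA : A * ε = 3 + K + ω * M)
    (hA0 : 0 ≤ A) (hK : 0 ≤ K) (hM' : 0 ≤ M') (hL : L = (M + M') * (K + 2 * (A + 1) + ω * M'))
    {i : ℕ} (hr : rad p i ≤ M) (hu : speedIn ω p i ≤ K) (hn : ‖η (i + 1)‖ ≤ 1 - ε)
    (hδ : Δ (i + 1) ∈ Metric.ball (!₂[A, 0, 0] : E3) 1) (hξ : ξ (i + 1) ∈ Set.Ioo L (L + 1)) :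
    M' ≤ rad p (i + 1) ∧
      speedIn ω p (i + 1) ≤ K + 2 * (A + 1) + ω * (M + 2 * (L + 1)) := by
  have hW := hT.energyWalk hω hR hη
  obtain ⟨hv, hd⟩ := one_le_radialDist_collide hω hε hA hA0 hK hR hr hu hn hδ
  rw [← hT.vel i] at hv
  have hw : speedOut ω p i ≤ K + 2 * (A + 1) := by
    have h1 := hW.collision' i
    have h2 : ‖η (i + 1)‖ * speedIn ω p i ≤ speedIn ω p i :=
      mul_le_of_le_one_left (norm_nonneg _) (hη _)
    linarith
  constructor
  · unfold rad
    rw [hT.pos (i + 1)]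
    refine radialDist_flight_ge hω (hT.pos_τ _).le hr hw hv hM' ?_
    rw [hT.dist, ← hL]
    exact hξ.1
  · have h1 := (abs_le.1 (hW.radial i)).2
    have h2 : rad p (i + 1) ≤ M + 2 * (L + 1) := by
      have := hξ.2
      linarith
    have h0 := hW.r_nonneg (i + 1)
    have h3 : 0 ≤ K + 2 * (A + 1) := by linarith
    have h4 : 0 ≤ ω * (M + 2 * (L + 1)) := mul_nonneg hω.le (by linarith)
    refine abs_le_of_sq_le_sq' ?_ (by linarith) |>.2
    rw [hW.energy i]
    have h5 : speedOut ω p i ^ 2 ≤ (K + 2 * (A + 1)) ^ 2 := pow_le_pow_left₀ (hW.w_nonneg i) hw 2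
    have h6 : rad p (i + 1) ^ 2 ≤ (M + 2 * (L + 1)) ^ 2 := pow_le_pow_left₀ h0 h2 2
    nlinarith [mul_nonneg h3 h4, mul_le_mul_of_nonneg_left h6 (sq_nonneg ω), sq_nonneg (ω * rad p i)]

end IsTrajectory

end Trajectory

/-! ### Recurrence of moderate speeds. -/

namespace EnergyWalk

variable {ω : ℝ} {r u w a d ξ : ℕ → ℝ}

lemma speed_step (hω : 0 ≤ ω) (h : EnergyWalk ω r u w a d ξ) (k : ℕ) :
    u (k + 1) ≤ a k * u k + √(r k + 1) * (2 * d k + ω + 3 * ω * ξ k) := by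
  have h1 := h.incoming_le hω k
  have h2 := h.collision' k
  have hr := h.r_nonneg k
  have hd := h.d_nonneg k
  have hx := h.ξ_nonneg k
  have h3 : √(r k) ≤ √(r k + 1) := Real.sqrt_le_sqrt (by linarith)
  have h4 : 1 ≤ √(r k + 1) := Real.one_le_sqrt.2 (by linarith)
  have h5 : ω * √(r k) * (1 + ξ k) ≤ ω * √(r k + 1) * (1 + ξ k) := by gcongr
  have h6 : 0 ≤ (√(r k + 1) - 1) * (2 * d k + 2 * ω * ξ k) :=
    mul_nonneg (by linarith) (by positivity)
  nlinarith

/-- One step of a run of collisions that reduces the relative speed without moving far. -/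
lemma contract_step (hω : 0 ≤ ω) (h : EnergyWalk ω r u w a d ξ) {ε U M s h₀ q : ℝ} (hε : 0 < ε)
    (hε1 : ε ≤ 1) (hs : 0 ≤ s) (hh : h₀ ≤ 1) {k : ℕ} (hr : M - s ≤ r k)
    (hu : u k ≤ q * U + (2 + 4 * ω) / ε * √(r k + 1 + s)) (ha : a k ≤ 1 - ε) (hd : d k ≤ 1)
    (hξ : ξ k ≤ h₀) :
    M - (s + 2 * h₀) ≤ r (k + 1) ∧
      u (k + 1) ≤ ((1 - ε) * q) * U + (2 + 4 * ω) / ε * √(r (k + 1) + 1 + (s + 2 * h₀)) := by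
  have h1 := abs_le.1 (h.radial k)
  refine ⟨by linarith, ?_⟩
  have h2 := h.speed_step hω k
  have hrk := h.r_nonneg k
  set b := 2 + 4 * ω with hb
  have hb0 : 0 ≤ b := by positivity
  have h3 : √(r k + 1) ≤ √(r k + 1 + s) := Real.sqrt_le_sqrt (by linarith)
  have h4 : √(r k + 1 + s) ≤ √(r (k + 1) + 1 + (s + 2 * h₀)) := Real.sqrt_le_sqrt (by linarith)
  have h5 : 2 * d k + ω + 3 * ω * ξ k ≤ b := by
    have : ω * ξ k ≤ ω * 1 := mul_le_mul_of_nonneg_left (hξ.trans hh) hω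
    linarith
  have h50 : 0 ≤ 2 * d k + ω + 3 * ω * ξ k := by
    have := h.d_nonneg k
    have := h.ξ_nonneg k
    positivity
  have h6 : √(r k + 1) * (2 * d k + ω + 3 * ω * ξ k) ≤ √(r k + 1 + s) * b :=
    mul_le_mul h3 h5 h50 (Real.sqrt_nonneg _)
  have h7 : a k * u k ≤ (1 - ε) * (q * U + b / ε * √(r k + 1 + s)) :=
    mul_le_mul ha hu (h.u_nonneg k) (by linarith)
  -- The constant `b / ε` is the fixed point of `x ↦ (1 - ε) x + b`, so only the part `q U` shrinks.
  -- The number `s` accumulates the radial displacement and keeps the square root from decreasing.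
  have h8 : (1 - ε) * (b / ε * √(r k + 1 + s)) + √(r k + 1 + s) * b =
      b / ε * √(r k + 1 + s) := by field_simp; ring
  have h9 : b / ε * √(r k + 1 + s) ≤ b / ε * √(r (k + 1) + 1 + (s + 2 * h₀)) :=
    mul_le_mul_of_nonneg_left h4 (by positivity)
  linarith

/-- The incoming speed is infinitely often at most of the order of the square root of the radial
distance. -/
lemma frequently_speed_le (hω : 0 ≤ ω) (h : EnergyWalk ω r u w a d ξ) {K : ℝ} (hK : 0 < K)
    (hlim : Tendsto (fun n => ∑ j ∈ Finset.range n, (a j + (2 * d j + ω + 3 * ω * ξ j) / K - 1))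
      atTop atBot) : ∃ᶠ k in atTop, u k ≤ K * √(r k + 1) := by
  by_contra hcon
  rw [not_frequently] at hcon
  obtain ⟨m, hm⟩ := eventually_atTop.1 hcon
  set S : ℕ → ℝ := fun n => ∑ j ∈ Finset.range n, (a j + (2 * d j + ω + 3 * ω * ξ j) / K - 1)
  have hbig : ∀ k, m ≤ k → K ≤ u k := fun k hk => by
    have h1 := not_le.1 (hm k hk)
    have h2 : 1 ≤ √(r k + 1) := Real.one_le_sqrt.2 (by linarith [h.r_nonneg k])
    nlinarith
  have hstep : ∀ n, u (m + n) ≤ u m * Real.exp (S (m + n) - S m) := by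
    intro n
    induction n with
    | zero => simp
    | succ n ih =>
      have h1 := h.speed_step hω (m + n)
      have h2 := (not_le.1 (hm (m + n) (by omega))).le
      have hd := h.d_nonneg (m + n)
      have hx := h.ξ_nonneg (m + n)
      have ha := h.a_nonneg (m + n)
      set b := 2 * d (m + n) + ω + 3 * ω * ξ (m + n)
      have hb : 0 ≤ b := by positivity
      have h3 : √(r (m + n) + 1) ≤ u (m + n) / K := by
        rw [le_div_iff₀ hK]; linarith
      have h4 : u (m + n + 1) ≤ u (m + n) * (a (m + n) + b / K) := by
        calc u (m + n + 1) ≤ a (m + n) * u (m + n) + u (m + n) / K * b := by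
              refine h1.trans ?_
              gcongr
          _ = _ := by ring
      -- While `√(r + 1)` stays below `u / K`, the speed is multiplied by at most `a + b / K ≤ exp
      -- (a + b / K - 1)`. The sum of the exponents tends to `-∞`, so `u` would tend to zero
      -- although it stays above `K`.
      have h5 : a (m + n) + b / K ≤ Real.exp (a (m + n) + b / K - 1) := by
        have := Real.add_one_le_exp (a (m + n) + b / K - 1)
        linarith
      have h6 : S (m + n + 1) = S (m + n) + (a (m + n) + b / K - 1) := Finset.sum_range_succ _ _
      rw [← add_assoc, h6]
      have e : S (m + n) + (a (m + n) + b / K - 1) - S m =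
        (S (m + n) - S m) + (a (m + n) + b / K - 1) := by ring
      rw [e, Real.exp_add, ← mul_assoc]
      refine h4.trans (mul_le_mul ih h5 (by positivity) ?_)
      exact mul_nonneg (h.u_nonneg m) (Real.exp_pos _).le
  have hto : Tendsto (fun n => u m * Real.exp (S (m + n) - S m)) atTop (𝓝 0) := by
    have h1 : Tendsto (fun n => S (m + n)) atTop atBot :=
      hlim.comp (tendsto_add_atTop_nat m |>.congr fun n => by rw [add_comm])
    have h2 : Tendsto (fun n => S (m + n) - S m) atTop atBot :=
      tendsto_atBot_add_const_right _ _ h1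
    simpa using (Real.tendsto_exp_atBot.comp h2).const_mul (u m)
  have : K ≤ 0 := ge_of_tendsto hto (Eventually.of_forall fun n =>
    (hbig (m + n) (by omega)).trans (hstep n))
  linarith

/-- The incoming speeds grow sublinearly under a good future. -/
lemma speed_sublinear (hω : 0 ≤ ω) (h : EnergyWalk ω r u w a d ξ) {K ε c C₀ θ M : ℝ} (hK : 0 ≤ K)
    (hC : 0 ≤ C₀) (hM : 0 ≤ M) (hg : GoodFuture ω K ε c C₀ θ M a d ξ)
    (h0 : u 0 ≤ K * √(r 0 + 1)) {δ : ℝ} (hδ : 0 < δ) : ∀ᶠ n : ℕ in atTop, u n ≤ δ * n := by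
  have hr := h.r_nonneg 0
  set B := r 0 + 2 * C₀ + 2 * M + 1 with hB
  have hB1 : 0 ≤ B := by positivity
  have hbound : ∀ n : ℕ, 1 ≤ n → u n ^ 4 ≤ B ^ 2 * θ ^ 2 * (1 + M) * n ^ 3 := by
    intro n hn
    have hn' : (1 : ℝ) ≤ n := by exact_mod_cast hn
    have h1 := h.speed_le hω hK hC hM hg.path h0 n
    have h2 := pow_le_pow_left₀ (h.u_nonneg n) h1 4
    have hR0 : 0 ≤ r 0 + 2 * C₀ * n + 2 * M + 1 := by positivity
    rw [mul_pow] at h2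
    have h3 : √(r 0 + 2 * C₀ * n + 2 * M + 1) ^ 4 = (r 0 + 2 * C₀ * n + 2 * M + 1) ^ 2 := by
      rw [show (4 : ℕ) = 2 * 2 from rfl, pow_mul, Real.sq_sqrt hR0]
    have h4 : r 0 + 2 * C₀ * n + 2 * M + 1 ≤ B * n := by nlinarith
    have h5 : (r 0 + 2 * C₀ * n + 2 * M + 1) ^ 2 ≤ (B * n) ^ 2 := pow_le_pow_left₀ hR0 h4 2
    have h6 : θ ^ 2 * (n + M) ≤ θ ^ 2 * ((1 + M) * n) := by
      apply mul_le_mul_of_nonneg_left _ (sq_nonneg _); nlinarith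
    rw [h3] at h2
    calc u n ^ 4 ≤ (B * n) ^ 2 * (θ ^ 2 * ((1 + M) * n)) :=
          h2.trans (mul_le_mul h5 ((hg.speed n).trans h6) (by positivity) (by positivity))
      _ = _ := by ring
  filter_upwards [eventually_ge_atTop 1,
    tendsto_natCast_atTop_atTop.eventually_ge_atTop (B ^ 2 * θ ^ 2 * (1 + M) / δ ^ 4)] with n hn hn2
  -- By `hbound`, `u n ^ 4` is at most of order `n³`, so it falls below `δ ^ 4 n ^ 4`.
  rw [div_le_iff₀ (by positivity)] at hn2
  refine le_of_pow_le_pow_left₀ four_ne_zero (by positivity) ((hbound n hn).trans ?_)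
  rw [mul_pow]
  have : (0 : ℝ) ≤ (n : ℝ) ^ 3 := by positivity
  nlinarith [mul_le_mul_of_nonneg_right hn2 this]

end EnergyWalk

/-! ### The law of the input of one step. -/

section NoiseLaw

/-- The random input of one step: collision outcome, thermal velocity, free path length. -/
abbrev Noise := E3 × E3 × ℝ

/-- The law of the random input of one step. -/
noncomputable abbrev noiseLaw (ν : Measure E3) (σ lam : ℝ) : Measure Noise :=
  ν.prod ((thermalLaw σ).prod (expMeasure lam))

variable {ν : Measure E3} {σ lam : ℝ}

lemma isProbabilityMeasure_noiseLaw [IsProbabilityMeasure ν] (hlam : 0 < lam) :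
    IsProbabilityMeasure (noiseLaw ν σ lam) := by
  have := isProbabilityMeasure_expMeasure hlam
  infer_instance

lemma noiseLaw_box (hlam : 0 < lam) {A B : Set E3} {C : Set ℝ} (hA : ν A ≠ 0)
    (hB : thermalLaw σ B ≠ 0) (hC : expMeasure lam C ≠ 0) :
    noiseLaw ν σ lam (A ×ˢ B ×ˢ C) ≠ 0 := by
  have := isProbabilityMeasure_expMeasure hlam
  rw [Measure.prod_prod, Measure.prod_prod]
  exact mul_ne_zero hA (mul_ne_zero hB hC)

lemma ae_noiseLaw (hlam : 0 < lam) (hν : ∀ᵐ n ∂ν, n ∈ Metric.ball (0 : E3) 1) :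
    ∀ᵐ q ∂noiseLaw ν σ lam, ‖q.1‖ < 1 ∧ 0 < q.2.2 := by
  have := isProbabilityMeasure_expMeasure hlam
  have h1 : ∀ᵐ q ∂noiseLaw ν σ lam, q.1 ∈ Metric.ball (0 : E3) 1 :=
    Measure.quasiMeasurePreserving_fst.ae hν
  have h2 : ∀ᵐ q ∂(thermalLaw σ).prod (expMeasure lam), 0 < q.2 :=
    Measure.quasiMeasurePreserving_snd.ae (expMeasure_Ioi lam)
  have h3 : ∀ᵐ q ∂noiseLaw ν σ lam, 0 < q.2.2 := Measure.quasiMeasurePreserving_snd.ae h2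
  filter_upwards [h1, h3] with q hq1 hq2
  exact ⟨by simpa using hq1, hq2⟩

lemma outcome_ne_zero_of_dissipative {ε c : ℝ}
    (h : 0 < ∫ q : Noise, dissipative ε c ‖q.1‖ q.2.2 ∂noiseLaw ν σ lam) :
    ν {n | ‖n‖ ≤ 1 - ε} ≠ 0 := by
  intro h0
  have h1 : ∀ᵐ n ∂ν, ¬ ‖n‖ ≤ 1 - ε := by
    rw [ae_iff]; simpa using h0
  have h2 : ∀ᵐ q ∂noiseLaw ν σ lam, ¬ ‖q.1‖ ≤ 1 - ε := Measure.quasiMeasurePreserving_fst.ae h1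
  have h3 : ∫ q : Noise, dissipative ε c ‖q.1‖ q.2.2 ∂noiseLaw ν σ lam = 0 := by
    refine integral_eq_zero_of_ae ?_
    filter_upwards [h2] with q hq
    simp [dissipative, hq]
  linarith

variable [IsProbabilityMeasure ν]

lemma memLp_thermal (hlam : 0 < lam) : MemLp (fun q : Noise => ‖q.2.1‖) 8 (noiseLaw ν σ lam) := by
  have := isProbabilityMeasure_expMeasure hlam
  have h1 : MemLp id 8 (thermalLaw σ) := IsGaussian.memLp_id _ 8 (by norm_num)
  have h2 := (h1.comp_measurePreserving (measurePreserving_fst (μ := thermalLaw σ)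
    (ν := expMeasure lam))).comp_measurePreserving (measurePreserving_snd (μ := ν))
  exact h2.norm

lemma memLp_path (hlam : 0 < lam) : MemLp (fun q : Noise => q.2.2) 8 (noiseLaw ν σ lam) := by
  have := isProbabilityMeasure_expMeasure hlam
  have h1 : MemLp id 8 (expMeasure lam) := by
    exact_mod_cast memLp_id_expMeasure hlam 8 (by norm_num)
  exact (h1.comp_measurePreserving (measurePreserving_snd (μ := thermalLaw σ)
    (ν := expMeasure lam))).comp_measurePreserving (measurePreserving_snd (μ := ν))

/-- The increment of the dominating recursion `speedBound`. -/
noncomputable def speedIncr (ω : ℝ) (q : Noise) : ℝ := 2 * ‖q.2.1‖ + ω + 3 * ω * q.2.2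

lemma measurable_speedIncr (ω : ℝ) : Measurable (speedIncr ω) := by
  unfold speedIncr; fun_prop

lemma memLp_speedIncr (hlam : 0 < lam) (ω : ℝ) : MemLp (speedIncr ω) 8 (noiseLaw ν σ lam) := by
  have := isProbabilityMeasure_noiseLaw (ν := ν) (σ := σ) hlam
  exact ((((memLp_thermal hlam).const_mul 2).add (memLp_const ω)).add
    ((memLp_path hlam).const_mul (3 * ω)))

lemma integrable_outcome (hlam : 0 < lam) (hν : ∀ᵐ n ∂ν, n ∈ Metric.ball (0 : E3) 1) :
    Integrable (fun q : Noise => ‖q.1‖) (noiseLaw ν σ lam) := by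
  have := isProbabilityMeasure_noiseLaw (ν := ν) (σ := σ) hlam
  refine Integrable.of_bound (by fun_prop) 1 ?_
  filter_upwards [ae_noiseLaw hlam hν] with q hq
  simpa using hq.1.le

lemma integral_outcome_lt_one (hlam : 0 < lam) (hν : ∀ᵐ n ∂ν, n ∈ Metric.ball (0 : E3) 1) :
    ∫ q : Noise, ‖q.1‖ ∂noiseLaw ν σ lam < 1 := by
  have := isProbabilityMeasure_noiseLaw (ν := ν) (σ := σ) hlam
  have hint := integrable_outcome (σ := σ) hlam hν
  have hae := ae_noiseLaw (σ := σ) hlam hν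
  have h1 : 0 < ∫ q : Noise, (1 - ‖q.1‖) ∂noiseLaw ν σ lam := by
    have hint' : Integrable (fun q : Noise => 1 - ‖q.1‖) (noiseLaw ν σ lam) :=
      (integrable_const 1).sub hint
    rw [integral_pos_iff_support_of_nonneg_ae ?_ hint']
    · have : (Function.support fun q : Noise => 1 - ‖q.1‖) =ᵐ[noiseLaw ν σ lam] Set.univ := by
        rw [eventuallyEq_univ]
        filter_upwards [hae] with q hq
        simp only [Function.mem_support]
        linarith [hq.1]
      rw [measure_congr this]
      simp
    · filter_upwards [hae] with q hq
      simp only [Pi.zero_apply]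
      linarith [hq.1]
  rw [integral_sub (integrable_const 1) hint] at h1
  simp only [integral_const, probReal_univ, smul_eq_mul, mul_one] at h1
  linarith

/-- Outcomes have norm below 1, so their eighth powers are dominated by the norms, whose mean is
strictly less than 1. This is the contraction rate of the dominating recursion. -/
lemma eLpNorm_outcome_lt_one (hlam : 0 < lam) (hν : ∀ᵐ n ∂ν, n ∈ Metric.ball (0 : E3) 1) :
    eLpNorm (fun q : Noise => ‖q.1‖) 8 (noiseLaw ν σ lam) < 1 := by
  have hint := integrable_outcome (σ := σ) hlam hν
  rw [eLpNorm_eq_lintegral_rpow_enorm_toReal (by norm_num) (by norm_num)]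
  refine ENNReal.rpow_lt_one ?_ (by norm_num)
  calc ∫⁻ q : Noise, ‖(‖q.1‖)‖ₑ ^ (8 : ENNReal).toReal ∂noiseLaw ν σ lam
      ≤ ∫⁻ q : Noise, ENNReal.ofReal ‖q.1‖ ∂noiseLaw ν σ lam := by
        refine lintegral_mono_ae ?_
        filter_upwards [ae_noiseLaw hlam hν] with q hq
        rw [Real.enorm_eq_ofReal (norm_nonneg _)]
        refine (ENNReal.rpow_le_rpow_of_exponent_ge ?_ (by norm_num : (1 : ℝ) ≤ _)).trans
          (ENNReal.rpow_one _).le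
        exact ENNReal.ofReal_le_one.2 hq.1.le
    _ = ENNReal.ofReal (∫ q : Noise, ‖q.1‖ ∂noiseLaw ν σ lam) :=
        (ofReal_integral_eq_lintegral_ofReal hint (Eventually.of_forall fun _ => norm_nonneg _)).symm
    _ < 1 := by
        rw [ENNReal.ofReal_lt_one]
        exact integral_outcome_lt_one hlam hν

lemma measurable_dissipative (ε c : ℝ) :
    Measurable fun q : Noise => dissipative ε c ‖q.1‖ q.2.2 := by
  unfold dissipative
  refine Measurable.ite ?_ measurable_const measurable_const
  have h1 : MeasurableSet {q : Noise | ‖q.1‖ ≤ 1 - ε} :=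
    measurableSet_le (by fun_prop) measurable_const
  have h2 : MeasurableSet {q : Noise | c ≤ q.2.2} :=
    measurableSet_le measurable_const (by fun_prop)
  exact h1.inter h2

lemma integrable_dissipative (hlam : 0 < lam) (ε c : ℝ) :
    Integrable (fun q : Noise => dissipative ε c ‖q.1‖ q.2.2) (noiseLaw ν σ lam) := by
  have := isProbabilityMeasure_noiseLaw (ν := ν) (σ := σ) hlam
  refine Integrable.of_bound (measurable_dissipative ε c).aestronglyMeasurable 1
    (Eventually.of_forall fun q => ?_)
  rcases dissipative_mem ε c ‖q.1‖ q.2.2 with h | h <;> simp [h]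

/-- For suitable thresholds, more than three quarters of the steps are dissipative. -/
lemma exists_dissipative (hlam : 0 < lam) (hν : ∀ᵐ n ∂ν, n ∈ Metric.ball (0 : E3) 1) :
    ∃ ε c : ℝ, 0 < ε ∧ ε ≤ 1 ∧ 0 < c ∧
      3 / 4 < ∫ q : Noise, dissipative ε c ‖q.1‖ q.2.2 ∂noiseLaw ν σ lam := by
  have := isProbabilityMeasure_noiseLaw (ν := ν) (σ := σ) hlam
  set h : ℕ → ℝ := fun n => 1 / ((n : ℝ) + 1)
  have hh : Tendsto h atTop (𝓝 0) := tendsto_one_div_add_atTop_nhds_zero_nat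
  have hlim : Tendsto (fun n => ∫ q : Noise, dissipative (h n) (h n) ‖q.1‖ q.2.2 ∂noiseLaw ν σ lam)
      atTop (𝓝 (∫ _ : Noise, (1 : ℝ) ∂noiseLaw ν σ lam)) := by
    refine tendsto_integral_of_dominated_convergence (fun _ => 1)
      (fun n => (measurable_dissipative _ _).aestronglyMeasurable) (integrable_const 1)
      (fun n => Eventually.of_forall fun q => ?_) ?_
    · rcases dissipative_mem (h n) (h n) ‖q.1‖ q.2.2 with h | h <;> simp [h]
    · filter_upwards [ae_noiseLaw hlam hν] with q hq
      refine tendsto_const_nhds.congr' ?_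
      filter_upwards [hh.eventually_le_const (sub_pos.2 hq.1),
        hh.eventually_le_const hq.2] with n h1 h2
      rw [dissipative, if_pos ⟨by linarith, h2⟩]
  simp only [integral_const, probReal_univ, smul_eq_mul, mul_one] at hlim
  obtain ⟨n, hn⟩ := (hlim.eventually_const_lt (by norm_num : (3 / 4 : ℝ) < 1)).exists
  refine ⟨h n, h n, by positivity, ?_, by positivity, hn⟩
  simp only [h]
  rw [div_le_one (by positivity)]
  have : (0 : ℝ) ≤ n := Nat.cast_nonneg n
  linarith

end NoiseLaw

/-! ### Good futures have positive probability. -/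

section Future

variable {Ω : Type*} [MeasurableSpace Ω] {μ : Measure Ω} [IsProbabilityMeasure μ]
  {ν : Measure E3} [IsProbabilityMeasure ν] {σ lam : ℝ} {z : ℕ → Ω → Noise}

lemma speedBound_eq_linearRec (ω K : ℝ) (y : ℕ → Noise) (k : ℕ) :
    speedBound ω K (fun j => ‖(y j).1‖) (fun j => ‖(y j).2.1‖) (fun j => (y j).2.2) k =
      linearRec (fun q : Noise => ‖q.1‖) (speedIncr ω) K y k := by
  induction k with
  | zero => rfl
  | succ k ih => simp only [speedBound, linearRec, ih, speedIncr]

/-- `GoodFuture` for a sequence of random inputs. -/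
def goodFutures (ω K ε c C₀ θ M : ℝ) : Set (ℕ → Noise) :=
  {y | GoodFuture ω K ε c C₀ θ M (fun j => ‖(y j).1‖) (fun j => ‖(y j).2.1‖) fun j => (y j).2.2}

lemma measurableSet_goodFutures (ω K ε c C₀ θ M : ℝ) :
    MeasurableSet (goodFutures ω K ε c C₀ θ M) := by
  have e : goodFutures ω K ε c C₀ θ M =
      (⋂ n : ℕ, {y : ℕ → Noise | ∑ j ∈ Finset.range n, (y j).2.2 ≤ C₀ * n + M}) ∩
      ((⋂ n : ℕ, {y : ℕ → Noise | 3 / 4 * (n : ℝ) - M ≤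
        ∑ j ∈ Finset.range n, dissipative ε c ‖(y j).1‖ (y j).2.2}) ∩
      ⋂ n : ℕ, {y : ℕ → Noise |
        linearRec (fun q : Noise => ‖q.1‖) (speedIncr ω) K y n ^ 4 ≤ θ ^ 2 * (n + M)}) := by
    ext y
    simp only [Set.mem_inter_iff, Set.mem_iInter]
    constructor
    · intro h
      exact ⟨h.path, h.count, fun n => by
        have := h.speed n
        rwa [speedBound_eq_linearRec] at this⟩
    · rintro ⟨h1, h2, h3⟩
      exact ⟨h1, h2, fun n => by rw [speedBound_eq_linearRec]; exact h3 n⟩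
  rw [e]
  refine (MeasurableSet.iInter fun n => measurableSet_le ?_ measurable_const).inter
    ((MeasurableSet.iInter fun n => measurableSet_le measurable_const ?_).inter
    (MeasurableSet.iInter fun n => measurableSet_le ?_ measurable_const))
  · exact Finset.measurable_sum _ fun j _ => by fun_prop
  · exact Finset.measurable_sum _ fun j _ =>
      (measurable_dissipative ε c).comp (measurable_pi_apply j)
  · exact (measurable_linearRec (by fun_prop) (measurable_speedIncr ω) K n).pow_const 4

lemma exists_forall_le_of_eventually {x : ℕ → ℝ} (h : ∀ᶠ n in atTop, x n ≤ 0) :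
    ∃ M : ℝ, ∀ n, x n ≤ M := by
  obtain ⟨m, hm⟩ := eventually_atTop.1 h
  obtain ⟨B, hB⟩ := ((Finset.range m).image x).bddAbove
  refine ⟨max B 0, fun n => ?_⟩
  rcases lt_or_ge n m with hn | hn
  · exact (hB (by simpa using ⟨n, hn, rfl⟩)).trans (le_max_left _ _)
  · exact (hm n hn).trans (le_max_right _ _)

/-- Good futures have positive probability. -/
lemma exists_goodFutures (hz : IsIID z (noiseLaw ν σ lam) μ) (hlam : 0 < lam)
    (hν : ∀ᵐ n ∂ν, n ∈ Metric.ball (0 : E3) 1) {ω ε c C₀ θ K : ℝ}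
    (hεc : 3 / 4 < ∫ q : Noise, dissipative ε c ‖q.1‖ q.2.2 ∂noiseLaw ν σ lam)
    (hC₀ : ∫ q : Noise, q.2.2 ∂noiseLaw ν σ lam < C₀) (hθ : 0 < θ) :
    ∃ M : ℝ, 0 ≤ M ∧ μ {w | (fun j => z j w) ∈ goodFutures ω K ε c C₀ θ M} ≠ 0 := by
  have := isProbabilityMeasure_noiseLaw (ν := ν) (σ := σ) hlam
  have hpath := hz.strong_law (f := fun q : Noise => q.2.2) (by fun_prop)
    ((memLp_path hlam).integrable (by norm_num))
  have hcount := hz.strong_law (measurable_dissipative ε c) (integrable_dissipative hlam ε c)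
  have hspeed := hz.linearRec_growth (f := fun q : Noise => ‖q.1‖) (by fun_prop)
    (measurable_speedIncr ω) (eLpNorm_outcome_lt_one hlam hν) (memLp_speedIncr hlam ω).2 K
    (pow_pos hθ 2)
  have hall : ∀ᵐ w ∂μ, ∃ M : ℕ, (fun j => z j w) ∈ goodFutures ω K ε c C₀ θ M := by
    filter_upwards [hpath, hcount, hspeed] with w h1 h2 h3
    obtain ⟨M₁, hM₁⟩ := exists_forall_le_of_eventually
      (x := fun n : ℕ => ∑ j ∈ Finset.range n, (z j w).2.2 - C₀ * n) (by
        filter_upwards [h1.eventually_le_const hC₀, eventually_gt_atTop 0] with n hn hn0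
        rw [div_le_iff₀ (by exact_mod_cast hn0)] at hn
        linarith)
    obtain ⟨M₂, hM₂⟩ := exists_forall_le_of_eventually
      (x := fun n : ℕ => 3 / 4 * (n : ℝ) -
        ∑ j ∈ Finset.range n, dissipative ε c ‖(z j w).1‖ (z j w).2.2) (by
        filter_upwards [h2.eventually_const_le hεc, eventually_gt_atTop 0] with n hn hn0
        rw [le_div_iff₀ (by exact_mod_cast hn0)] at hn
        linarith)
    obtain ⟨M₃, hM₃⟩ := exists_forall_le_of_eventually
      (x := fun n : ℕ => linearRec (fun q : Noise => ‖q.1‖) (speedIncr ω) K (fun j => z j w) n ^ 4 -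
        θ ^ 2 * n) (by
        filter_upwards [h3] with n hn
        linarith)
    obtain ⟨M, hM⟩ := exists_nat_ge (max M₁ (max M₂ (M₃ / θ ^ 2)))
    have a1 := (le_max_left _ _).trans hM
    have a2 := ((le_max_left _ _).trans (le_max_right _ _)).trans hM
    have a3 := ((le_max_right _ _).trans (le_max_right _ _)).trans hM
    rw [div_le_iff₀ (by positivity)] at a3
    refine ⟨M, fun n => ?_, fun n => ?_, fun n => ?_⟩
    · linarith [hM₁ n]
    · linarith [hM₂ n]
    · rw [speedBound_eq_linearRec]
      linarith [hM₃ n]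
  -- Almost every input is good for some natural `M`; countably many null sets could not cover this.
  by_contra hcon
  push Not at hcon
  have hnull : ∀ᵐ w ∂μ, ∀ M : ℕ, (fun j => z j w) ∉ goodFutures ω K ε c C₀ θ M := by
    rw [ae_all_iff]
    intro M
    rw [ae_iff]
    simpa using hcon M (Nat.cast_nonneg M)
  obtain ⟨w, ⟨M, hM⟩, h2⟩ := (hall.and hnull).exists
  exact h2 M hM

end Future

/-! ### Null sets and sublinear growth for the next input. -/

namespace IsIID

variable {Ω N S : Type*} [MeasurableSpace Ω] [MeasurableSpace N] [MeasurableSpace S]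
  {μ : Measure Ω} [IsProbabilityMeasure μ] {z : ℕ → Ω → N} {P : Measure N}

/-- By independence the joint law of the past and the next input is a product, so it suffices that
every section is null. -/
lemma ae_next_notMem (h : IsIID z P μ) {i : ℕ} {X : Ω → S}
    (hX : Measurable[past z h.measurable i] X) {B : Set (S × N)} (hB : MeasurableSet B)
    (hnull : ∀ s, P (Prod.mk s ⁻¹' B) = 0) : ∀ᵐ w ∂μ, (X w, z (i + 1) w) ∉ B := by
  have hX' : Measurable X := hX.mono ((past z h.measurable).le i) le_rfl
  have : IsProbabilityMeasure P := by
    rw [← h.law 0]; exact Measure.isProbabilityMeasure_map (h.measurable 0).aemeasurable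
  have hind : IndepFun X (z (i + 1)) μ := by
    rw [IndepFun_iff_Indep]
    refine (indep_of_indep_of_le_right (indep_of_indep_of_le_left (h.indep_past_future i) ?_)
      hX.comap_le).symm
    rw [← measurable_iff_comap_le]
    exact (measurable_pi_apply 0).comp (comap_measurable fun w j => z (i + 1 + j) w)
  have hmap := (indepFun_iff_map_prod_eq_prod_map_map hX'.aemeasurable
    (h.measurable (i + 1)).aemeasurable).1 hind
  rw [h.law] at hmap
  have hprob : IsProbabilityMeasure (μ.map X) :=
    Measure.isProbabilityMeasure_map hX'.aemeasurable
  have h0 : (μ.map fun w => (X w, z (i + 1) w)) B = 0 := by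
    rw [hmap, Measure.measure_prod_null hB]
    exact Eventually.of_forall hnull
  rw [Measure.map_apply (hX'.prodMk (h.measurable _)) hB] at h0
  rw [ae_iff]
  simp only [not_not]
  exact h0

/-- The recursion with coefficient zero just returns its last input, so `linearRec_growth` bounds
the fourth power of a single input. -/
lemma sublinear (h : IsIID z P μ) {g : N → ℝ} (hg : Measurable g) (hg8 : MemLp g 8 P) :
    ∀ᵐ w ∂μ, ∀ δ > 0, ∀ᶠ k : ℕ in atTop, g (z (k + 1) w) ≤ δ * k := by
  have h0 : eLpNorm (fun _ : N => (0 : ℝ)) 8 P < 1 := by simp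
  filter_upwards [h.linearRec_growth measurable_const hg h0 hg8.2 0 one_pos] with w hw δ hδ
  have h1 := (tendsto_add_atTop_nat 2).eventually hw
  filter_upwards [h1, eventually_ge_atTop 1,
    tendsto_natCast_atTop_atTop.eventually_ge_atTop (3 / δ ^ 4)] with k hk hk1 hk2
  have e : linearRec (fun _ : N => (0 : ℝ)) g 0 (fun j => z j w) (k + 2) = g (z (k + 1) w) := by
    simp [linearRec]
  rw [e] at hk
  rw [div_le_iff₀ (by positivity)] at hk2
  have hk1' : (1 : ℝ) ≤ k := by exact_mod_cast hk1
  push_cast at hk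
  have h3 : (k : ℝ) ≤ (k : ℝ) ^ 4 := le_self_pow₀ hk1' (by norm_num)
  have h4 : (1 : ℝ) ≤ (k : ℝ) ^ 3 := one_le_pow₀ hk1'
  refine (le_abs_self _).trans (le_of_pow_le_pow_left₀ four_ne_zero (by positivity) ?_)
  rw [Even.pow_abs (by decide), mul_pow]
  have h5 : 3 * (k : ℝ) ^ 3 ≤ (k * δ ^ 4) * k ^ 3 := mul_le_mul_of_nonneg_right hk2 (by positivity)
  have h6 : (k : ℝ) ≤ (k : ℝ) ^ 3 := le_self_pow₀ hk1' (by norm_num)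
  nlinarith

end IsIID

/-! ### Measurability of the states; the particle never comes to rest. -/

section States

variable {Ω : Type*}

lemma measurable_flight_pos [MeasurableSpace Ω] {ω : ℝ} (hω : 0 < ω) {x v : Ω → E3} {ξ : Ω → ℝ}
    (hx : Measurable x) (hv : Measurable v) (hξ : Measurable ξ) :
    Measurable fun w => x w + flightTime ω (x w) (v w) (ξ w) • v w :=
  hx.add (((measurable_flightTime hω).comp ((hx.prodMk hv).prodMk hξ)).smul hv)

lemma measurable_flight_time [MeasurableSpace Ω] {ω : ℝ} (hω : 0 < ω) {x v : Ω → E3} {ξ T : Ω → ℝ}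
    (hx : Measurable x) (hv : Measurable v) (hξ : Measurable ξ) (hT : Measurable T) :
    Measurable fun w => T w + flightTime ω (x w) (v w) (ξ w) :=
  hT.add ((measurable_flightTime hω).comp ((hx.prodMk hv).prodMk hξ))

lemma measurable_collide_comp [MeasurableSpace Ω] {R : E3 → Matrix (Fin 3) (Fin 3) ℝ}
    (hR : IsRotationChoice R) {v u η : Ω → E3} (hv : Measurable v) (hu : Measurable u)
    (hη : Measurable η) : Measurable fun w => collide R (v w) (u w) (η w) := by
  have h := (measurable_collide hR).comp ((hv.prodMk hu).prodMk hη)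
  exact h

lemma measurable_flight_vel [MeasurableSpace Ω] {ω : ℝ} {R : E3 → Matrix (Fin 3) (Fin 3) ℝ}
    (hR : IsRotationChoice R) {x v η Δ : Ω → E3} (hx : Measurable x) (hv : Measurable v)
    (hη : Measurable η) (hΔ : Measurable Δ) :
    Measurable fun w => collide R (v w) (rotField ω (x w) + Δ w) (η w) := by
  have hF : Measurable fun w => rotField ω (x w) := (continuous_rotField ω).measurable.comp hx
  exact measurable_collide_comp hR hv (hF.add hΔ) hη

lemma measurable_relSpeed [MeasurableSpace Ω] (ω : ℝ) {x v : Ω → E3} (hx : Measurable x)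
    (hv : Measurable v) : Measurable fun w => ‖v w - rotField ω (x w)‖ := by
  have hF : Measurable fun w => rotField ω (x w) := (continuous_rotField ω).measurable.comp hx
  exact (hv.sub hF).norm

/-- The particle driven by a sequence of random inputs. -/
noncomputable def driven (ω : ℝ) (R : E3 → Matrix (Fin 3) (Fin 3) ℝ) (x₀ v₀ : E3)
    (z : ℕ → Ω → Noise) (w : Ω) : ℕ → ParticleState :=
  particle ω R (fun k => (z k w).1) (fun k => (z k w).2.1) (fun k => (z k w).2.2) x₀ v₀

variable [MeasurableSpace Ω] {ω : ℝ} {R : E3 → Matrix (Fin 3) (Fin 3) ℝ} {z : ℕ → Ω → Noise}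

/-- The path length of index `k` already fixes where and when collision `k + 1` takes place; only
its outcome needs the input of index `k + 1`. So radius and incoming speed of index `k` in the walk
belong to the past of `k`. -/
lemma measurable_driven (hω : 0 < ω) (hR : IsRotationChoice R) (x₀ v₀ : E3)
    (hz : ∀ k, Measurable (z k)) (k : ℕ) :
    Measurable[past z hz k] (fun w => (driven ω R x₀ v₀ z w k).vel) ∧
    Measurable[past z hz k] (fun w => (driven ω R x₀ v₀ z w (k + 1)).pos) ∧
    Measurable[past z hz k] (fun w => (driven ω R x₀ v₀ z w (k + 1)).time) := by
  have hξ : ∀ k, Measurable[past z hz k] fun w => (z k w).2.2 := fun k =>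
    (measurable_snd.comp measurable_snd).comp (measurable_past hz le_rfl)
  induction k with
  | zero =>
    exact ⟨measurable_const,
      @measurable_flight_pos _ (past z hz 0) _ hω _ _ _ measurable_const measurable_const (hξ 0),
      @measurable_flight_time _ (past z hz 0) _ hω _ _ _ _ measurable_const measurable_const (hξ 0)
        measurable_const⟩
  | succ k ih =>
    have hle : past z hz k ≤ past z hz (k + 1) := (past z hz).mono (Nat.le_succ k)
    have hv := ih.1.mono hle le_rfl
    have hx := ih.2.1.mono hle le_rfl
    have ht := ih.2.2.mono hle le_rfl
    have hzk : Measurable[past z hz (k + 1)] (z (k + 1)) := measurable_past hz le_rfl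
    have hv' : Measurable[past z hz (k + 1)] fun w => (driven ω R x₀ v₀ z w (k + 1)).vel :=
      @measurable_flight_vel _ (past z hz (k + 1)) _ _ hR _ _ _ _ hx hv
        (measurable_fst.comp hzk) ((measurable_fst.comp measurable_snd).comp hzk)
    exact ⟨hv', @measurable_flight_pos _ (past z hz (k + 1)) _ hω _ _ _ hx hv' (hξ (k + 1)),
      @measurable_flight_time _ (past z hz (k + 1)) _ hω _ _ _ _ hx hv' (hξ (k + 1)) ht⟩

lemma measurable_rad (hω : 0 < ω) (hR : IsRotationChoice R) (x₀ v₀ : E3)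
    (hz : ∀ k, Measurable (z k)) (i : ℕ) :
    Measurable[past z hz i] fun w => rad (driven ω R x₀ v₀ z w) i :=
  continuous_radialDist.measurable.comp (measurable_driven hω hR x₀ v₀ hz i).2.1

lemma measurable_speedIn (hω : 0 < ω) (hR : IsRotationChoice R) (x₀ v₀ : E3)
    (hz : ∀ k, Measurable (z k)) (i : ℕ) :
    Measurable[past z hz i] fun w => speedIn ω (driven ω R x₀ v₀ z w) i := by
  obtain ⟨hv, hx, -⟩ := measurable_driven hω hR x₀ v₀ hz i
  exact @measurable_relSpeed _ (past z hz i) ω _ _ hx hv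

lemma measurable_speedOut (hω : 0 < ω) (hR : IsRotationChoice R) (x₀ v₀ : E3)
    (hz : ∀ k, Measurable (z k)) (i : ℕ) :
    Measurable fun w => speedOut ω (driven ω R x₀ v₀ z w) i := by
  have hv := (measurable_driven hω hR x₀ v₀ hz (i + 1)).1.mono ((past z hz).le _) le_rfl
  have hx := (measurable_driven hω hR x₀ v₀ hz i).2.1.mono ((past z hz).le _) le_rfl
  exact measurable_relSpeed ω hx hv

variable {μ : Measure Ω} [IsProbabilityMeasure μ] {ν : Measure E3} {σ lam : ℝ}

/-- Almost surely, the particle is never at rest after a collision. -/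
lemma ae_vel_ne_zero (hz : IsIID z (noiseLaw ν σ lam) μ) (hω : 0 < ω) (hσ : 0 < σ) (hlam : 0 < lam)
    (hν : ∀ᵐ n ∂ν, n ∈ Metric.ball (0 : E3) 1) (hR : IsRotationChoice R) (x₀ v₀ : E3) (k : ℕ) :
    ∀ᵐ w ∂μ, (driven ω R x₀ v₀ z w (k + 1)).vel ≠ 0 := by
  have := isProbabilityMeasure_expMeasure hlam
  set B : Set ((E3 × E3) × Noise) := {q | ‖q.2.1‖ < 1 ∧
    ‖q.1.2 - (rotField ω q.1.1 + q.2.2.1)‖ * ‖(!₂[1, 0, 0] : E3) - q.2.1‖ = ‖q.1.2‖} with hB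
  have hF : Measurable fun q : (E3 × E3) × Noise => rotField ω q.1.1 :=
    (continuous_rotField ω).measurable.comp (by fun_prop)
  have hBm : MeasurableSet B := by
    have h1 : MeasurableSet {q : (E3 × E3) × Noise | ‖q.2.1‖ < 1} :=
      measurableSet_lt (by fun_prop) measurable_const
    have h2 : MeasurableSet {q : (E3 × E3) × Noise |
        ‖q.1.2 - (rotField ω q.1.1 + q.2.2.1)‖ * ‖(!₂[1, 0, 0] : E3) - q.2.1‖ = ‖q.1.2‖} :=
      measurableSet_eq_fun (by fun_prop) (by fun_prop)
    exact h1.inter h2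
  have hnull : ∀ s, noiseLaw ν σ lam (Prod.mk s ⁻¹' B) = 0 := by
    rintro ⟨x, v⟩
    rw [Measure.measure_prod_null (measurable_prodMk_left hBm)]
    refine Eventually.of_forall fun n => ?_
    by_cases hn : ‖n‖ < 1
    · have hpos : 0 < ‖(!₂[1, 0, 0] : E3) - n‖ := by
        have h1 : ‖(!₂[1, 0, 0] : E3)‖ = 1 := by
          rw [EuclideanSpace.norm_eq]; simp [Fin.sum_univ_three]
        have h2 := norm_sub_norm_le (!₂[1, 0, 0] : E3) n
        linarith
      -- Since `‖n‖ < 1`, the vector `e₁ - n` is nonzero, and the equation confines the thermal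
      -- velocity to a sphere whose centre and radius are already determined.
      refine measure_mono_null (t := (Metric.sphere (v - rotField ω x)
        (‖v‖ / ‖(!₂[1, 0, 0] : E3) - n‖)) ×ˢ Set.univ) ?_ ?_
      · rintro ⟨δ, t⟩ hq
        refine ⟨?_, trivial⟩
        rw [mem_sphere_iff_norm, eq_div_iff hpos.ne', ← hq.2, ← norm_neg (δ - _)]
        congr 2
        simp only
        abel
      · rw [Measure.prod_prod, thermalLaw_sphere hσ, zero_mul]
    · refine measure_mono_null (t := ∅) ?_ measure_empty
      intro q hq
      exact hn hq.1
  obtain ⟨hv, hx, -⟩ := measurable_driven hω hR x₀ v₀ hz.measurable k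
  have hae := hz.ae_law (ae_noiseLaw hlam hν)
  filter_upwards [hz.ae_next_notMem (hx.prodMk hv) hBm hnull, hae] with w hw hw2 h0
  exact hw ⟨(hw2 (k + 1)).1, norm_of_collide_eq_zero hR h0⟩

lemma ae_isTrajectory (hz : IsIID z (noiseLaw ν σ lam) μ) (hω : 0 < ω) (hσ : 0 < σ)
    (hlam : 0 < lam) (hν : ∀ᵐ n ∂ν, n ∈ Metric.ball (0 : E3) 1) (hR : IsRotationChoice R)
    {x₀ v₀ : E3} (h₀ : ¬ IsStuck x₀ v₀) :
    ∀ᵐ w ∂μ, (∀ k, ‖(z k w).1‖ ≤ 1) ∧ ∃ τ, IsTrajectory ω (driven ω R x₀ v₀ z w) R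
      (fun k => (z k w).1) (fun k => (z k w).2.1) (fun k => (z k w).2.2) τ := by
  have hv : ∀ᵐ w ∂μ, ∀ k, (driven ω R x₀ v₀ z w (k + 1)).vel ≠ 0 :=
    ae_all_iff.2 fun k => ae_vel_ne_zero hz hω hσ hlam hν hR x₀ v₀ k
  filter_upwards [hv, hz.ae_law (ae_noiseLaw hlam hν)] with w hw hw2
  refine ⟨fun k => (hw2 k).1.le, _, isTrajectory_particle hω x₀ v₀ (fun k => (hw2 k).2) fun k => ?_⟩
  cases k with
  | zero => exact h₀
  | succ k => exact fun hs => hw k hs.2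

end States

lemma measurableSet_le_and_le {Ω : Type*} {m : MeasurableSpace Ω} {f g f' g' : Ω → ℝ}
    (hf : Measurable[m] f) (hg : Measurable[m] g) (hf' : Measurable[m] f')
    (hg' : Measurable[m] g') : MeasurableSet[m] {w | f w ≤ g w ∧ f' w ≤ g' w} :=
  (measurableSet_le hf hg).inter (measurableSet_le hf' hg')

/-! ### Recurrence of favourable states and escape. -/

section Escape

variable {Ω : Type*} [MeasurableSpace Ω] {ω : ℝ} {R : E3 → Matrix (Fin 3) (Fin 3) ℝ}
  {z : ℕ → Ω → Noise} {μ : Measure Ω} [IsProbabilityMeasure μ] {ν : Measure E3}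
  {σ lam : ℝ} {x₀ v₀ : E3}

lemma frequently_succ {p : ℕ → Prop} (h : ∃ᶠ i in atTop, p (i + 1)) : ∃ᶠ i in atTop, p i :=
  (tendsto_add_atTop_nat 1).frequently h

/-- Almost surely, the incoming speed is infinitely often at most of the order of the square root
of the radial distance. -/
lemma ae_frequently_speed_le [IsProbabilityMeasure ν]
    (hz : IsIID z (noiseLaw ν σ lam) μ) (hω : 0 < ω) (hσ : 0 < σ)
    (hlam : 0 < lam) (hν : ∀ᵐ n ∂ν, n ∈ Metric.ball (0 : E3) 1) (hR : IsRotationChoice R)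
    (h₀ : ¬ IsStuck x₀ v₀) {K : ℝ} (hK : 0 < K)
    (hKE : (∫ q, speedIncr ω q ∂noiseLaw ν σ lam) / K <
      1 - ∫ q : Noise, ‖q.1‖ ∂noiseLaw ν σ lam) :
    ∀ᵐ w ∂μ, ∃ᶠ i in atTop, speedIn ω (driven ω R x₀ v₀ z w) i ≤
      K * √(rad (driven ω R x₀ v₀ z w) i + 1) := by
  have := isProbabilityMeasure_noiseLaw (ν := ν) (σ := σ) hlam
  have hi1 := integrable_outcome (σ := σ) hlam hν
  have hi2 : Integrable (speedIncr ω) (noiseLaw ν σ lam) :=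
    (memLp_speedIncr hlam ω).integrable (by norm_num)
  have hint : Integrable (fun q : Noise => ‖q.1‖ + speedIncr ω q / K - 1) (noiseLaw ν σ lam) :=
    (hi1.add (hi2.div_const K)).sub (integrable_const 1)
  have hmean : ∫ q : Noise, (‖q.1‖ + speedIncr ω q / K - 1) ∂noiseLaw ν σ lam < 0 := by
    have h1 : Integrable (fun q : Noise => ‖q.1‖ + speedIncr ω q / K) (noiseLaw ν σ lam) :=
      hi1.add (hi2.div_const K)
    rw [integral_sub h1 (integrable_const 1), integral_add hi1 (hi2.div_const K), integral_div]
    simp only [integral_const, probReal_univ, smul_eq_mul, mul_one]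
    linarith
  have hm : Measurable fun q : Noise => ‖q.1‖ + speedIncr ω q / K - 1 := by
    have := measurable_speedIncr ω
    fun_prop
  have hlaw := (hz.shift 1).strong_law hm hint
  filter_upwards [ae_isTrajectory hz hω hσ hlam hν hR h₀, hlaw] with w ⟨hη, τ, hT⟩ hw
  have hW := hT.energyWalk hω hR hη
  -- The exponents have negative mean, so by the strong law their sums tend to `-∞`.
  refine hW.frequently_speed_le hω.le hK ?_
  have h1 := hw.neg_mul_atTop hmean tendsto_natCast_atTop_atTop
  refine h1.congr' ?_
  filter_upwards [eventually_gt_atTop 0] with n hn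
  rw [div_mul_cancel₀ _ (by exact_mod_cast hn.ne')]
  exact Finset.sum_congr rfl fun j _ => by simp only [speedIncr, add_comm 1 j]

/-- The events of the successive stages of a contracting run. -/
def contracting (ω ε U M h₀ : ℝ) (p : Ω → ℕ → ParticleState) (j i : ℕ) : Set Ω :=
  {w | M - 2 * h₀ * j ≤ rad (p w) i ∧ speedIn ω (p w) i ≤
    (1 - ε) ^ j * U + (2 + 4 * ω) / ε * √(rad (p w) i + 1 + 2 * h₀ * j)}

lemma measurableSet_contracting (hω : 0 < ω) (hR : IsRotationChoice R)
    (hz : ∀ k, Measurable (z k)) (ε U M h₀ : ℝ) (j i : ℕ) :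
    MeasurableSet[past z hz i] (contracting ω ε U M h₀ (driven ω R x₀ v₀ z) j i) := by
  have hr := measurable_rad hω hR x₀ v₀ hz i
  have hu := measurable_speedIn hω hR x₀ v₀ hz i
  have h1 : Measurable[past z hz i] fun w => (1 - ε) ^ j * U + (2 + 4 * ω) / ε *
      √(rad (driven ω R x₀ v₀ z w) i + 1 + 2 * h₀ * j) := by
    have h2 : Measurable fun t : ℝ => (1 - ε) ^ j * U + (2 + 4 * ω) / ε * √(t + 1 + 2 * h₀ * j) := by
      fun_prop
    exact h2.comp hr
  exact measurableSet_le_and_le measurable_const hr hu h1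

/-- If the particle is in a bounded state infinitely often, then it is infinitely often far from the
axis with moderate relative speed. -/
lemma ae_frequently_far (hz : IsIID z (noiseLaw ν σ lam) μ) (hω : 0 < ω) (hσ : 0 < σ)
    (hlam : 0 < lam) (hν : ∀ᵐ n ∂ν, n ∈ Metric.ball (0 : E3) 1) (hR : IsRotationChoice R)
    (h₀ : ¬ IsStuck x₀ v₀) {ε K M : ℝ} (hε : 0 < ε) (hε1 : ε ≤ 1)
    (hνε : ν {n | ‖n‖ ≤ 1 - ε} ≠ 0) (hK : 1 + 2 * ((2 + 4 * ω) / ε) ≤ K) (hM : 0 ≤ M) :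
    ∀ᵐ w ∂μ, (∃ᶠ i in atTop, rad (driven ω R x₀ v₀ z w) i ≤ M ∧
        speedIn ω (driven ω R x₀ v₀ z w) i ≤ K * √(rad (driven ω R x₀ v₀ z w) i + 1)) →
      ∃ᶠ i in atTop, M ≤ rad (driven ω R x₀ v₀ z w) i ∧
        speedIn ω (driven ω R x₀ v₀ z w) i ≤ K * √(rad (driven ω R x₀ v₀ z w) i + 1) := by
  set p := driven ω R x₀ v₀ z with hp
  have hb0 : 0 ≤ (2 + 4 * ω) / ε := by positivity
  have hK0 : 0 ≤ K := by linarith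
  -- `K₁` bounds the speed at radius at most `M`, `A` is the size of the kick, `L` the flight length
  -- that forces radius at least `M + 2`, and `U` bounds the speed afterwards. Then `J` contracting
  -- steps reduce `U` to 1, with flights below `h₀'` so short that together they cost at most 2 of
  -- the radius.
  set K₁ := K * √(M + 1) with hK₁
  have hK₁0 : 0 ≤ K₁ := by positivity
  set A := (3 + K₁ + ω * M) / ε with hAdef
  have hA0 : 0 ≤ A := by positivity
  have hA : A * ε = 3 + K₁ + ω * M := div_mul_cancel₀ _ hε.ne'
  set L := (M + (M + 2)) * (K₁ + 2 * (A + 1) + ω * (M + 2)) with hL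
  have hL0 : 0 ≤ L := by positivity
  set U := K₁ + 2 * (A + 1) + ω * (M + 2 * (L + 1)) with hU
  have hU0 : 0 ≤ U := by positivity
  obtain ⟨J, hJ⟩ : ∃ J : ℕ, (1 - ε) ^ J * U ≤ 1 := by
    have h1 : Tendsto (fun J : ℕ => (1 - ε) ^ J * U) atTop (𝓝 (0 * U)) :=
      (tendsto_pow_atTop_nhds_zero_of_lt_one (by linarith) (by linarith)).mul_const U
    rw [zero_mul] at h1
    exact (h1.eventually_le_const one_pos).exists
  set h₀' : ℝ := 1 / ((J : ℝ) + 1) with hh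
  have hh0 : 0 < h₀' := by positivity
  have hJ0 : (0 : ℝ) ≤ J := Nat.cast_nonneg J
  have hh1 : h₀' ≤ 1 := by rw [hh, div_le_one (by positivity)]; linarith
  have hhJ : h₀' * J ≤ 1 := by
    rw [hh, div_mul_eq_mul_div, one_mul, div_le_one (by positivity)]; linarith
  set kickSet : Set Noise := {n | ‖n‖ ≤ 1 - ε} ×ˢ Metric.ball (!₂[A, 0, 0] : E3) 1 ×ˢ
    Set.Ioo L (L + 1) with hkick
  have hmn : MeasurableSet {n : E3 | ‖n‖ ≤ 1 - ε} := measurableSet_le (by fun_prop) measurable_const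
  have hkm : MeasurableSet kickSet :=
    hmn.prod (Metric.isOpen_ball.measurableSet.prod measurableSet_Ioo)
  have hkp : noiseLaw ν σ lam kickSet ≠ 0 :=
    noiseLaw_box hlam hνε (thermalLaw_ball hσ _) (expMeasure_Ioo hlam hL0 (by linarith))
  set stepSet : Set Noise := {n | ‖n‖ ≤ 1 - ε} ×ˢ Metric.ball (0 : E3) 1 ×ˢ
    Set.Ioo 0 h₀' with hstep
  have hsm : MeasurableSet stepSet :=
    hmn.prod (Metric.isOpen_ball.measurableSet.prod measurableSet_Ioo)
  have hsp : noiseLaw ν σ lam stepSet ≠ 0 :=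
    noiseLaw_box hlam hνε (thermalLaw_ball hσ _) (expMeasure_Ioo hlam le_rfl hh0)
  set S₂ : ℕ → Set Ω := fun i => {w | rad (p w) i ≤ M ∧
    speedIn ω (p w) i ≤ K * √(rad (p w) i + 1)} with hS₂
  have hS₂m : ∀ i, MeasurableSet[past z hz.measurable i] (S₂ i) := by
    intro i
    have hr := measurable_rad hω hR x₀ v₀ hz.measurable i
    have hu := measurable_speedIn hω hR x₀ v₀ hz.measurable i
    have h2 : Measurable fun t : ℝ => K * √(t + 1) := by fun_prop
    exact measurableSet_le_and_le hr measurable_const hu (h2.comp hr)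
  have htraj := ae_isTrajectory hz hω hσ hlam hν hR h₀
  have hstage0 : ∀ᵐ w ∂μ, (∃ᶠ i in atTop, w ∈ S₂ i) →
      ∃ᶠ i in atTop, w ∈ contracting ω ε U (M + 2) h₀' p 0 i := by
    filter_upwards [hz.frequently_and_next hS₂m hkm hkp, htraj] with w hw ⟨hη, τ, hT⟩ hfreq
    refine frequently_succ ((hw hfreq).mono fun i hi => ?_)
    obtain ⟨⟨hr, hu⟩, hn, hd, hx⟩ := hi
    have hu' : speedIn ω (p w) i ≤ K₁ :=
      hu.trans (mul_le_mul_of_nonneg_left (Real.sqrt_le_sqrt (by linarith)) hK0)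
    obtain ⟨h1, h2⟩ := hT.kick hω hR hη hε.le hA hA0 hK₁0 (by linarith) hL hr hu' hn hd hx
    refine ⟨by simpa using h1, h2.trans ?_⟩
    have : 0 ≤ (2 + 4 * ω) / ε * √(rad (p w) (i + 1) + 1 + 2 * h₀' * (0 : ℕ)) := by positivity
    simp only [pow_zero, one_mul]
    linarith
  have hstage : ∀ j, ∀ᵐ w ∂μ, (∃ᶠ i in atTop, w ∈ S₂ i) →
      ∃ᶠ i in atTop, w ∈ contracting ω ε U (M + 2) h₀' p j i := by
    intro j
    induction j with
    | zero => exact hstage0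
    | succ j ih =>
      filter_upwards [ih, hz.frequently_and_next (fun i => measurableSet_contracting
        (x₀ := x₀) (v₀ := v₀) hω hR hz.measurable ε U (M + 2) h₀' j i) hsm hsp, htraj]
        with w hw1 hw2 ⟨hη, τ, hT⟩ hfreq
      refine frequently_succ ((hw2 (hw1 hfreq)).mono fun i hi => ?_)
      obtain ⟨⟨hr, hu⟩, hn, hd, hx⟩ := hi
      have hd' : ‖(z (i + 1) w).2.1‖ < 1 := by simpa using hd
      obtain ⟨h1, h2⟩ := (hT.energyWalk hω hR hη).contract_step hω.le hε hε1
        (s := 2 * h₀' * j) (by positivity) hh1 hr hu hn hd'.le hx.2.le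
      have e : 2 * h₀' * ((j + 1 : ℕ) : ℝ) = 2 * h₀' * j + 2 * h₀' := by push_cast; ring
      refine ⟨?_, ?_⟩
      · rw [e]; exact h1
      · rw [e, pow_succ']; exact h2
  filter_upwards [hstage J] with w hw hfreq
  refine (hw hfreq).mono fun i hi => ?_
  obtain ⟨hr, hu⟩ := hi
  have hrM : M ≤ rad (p w) i := by linarith
  refine ⟨hrM, hu.trans ?_⟩
  have hr0 : 0 ≤ rad (p w) i := hM.trans hrM
  -- As `2 h₀' J ≤ 2` and the radius is nonnegative, `r + 3 ≤ 4 (r + 1)`; this explains `1 + 2 ((2 +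
  -- 4 ω) / ε)` as the lower bound for `K`.
  have h1 : √(rad (p w) i + 1 + 2 * h₀' * J) ≤ 2 * √(rad (p w) i + 1) := by
    rw [Real.sqrt_le_left (by positivity), mul_pow, Real.sq_sqrt (by linarith)]
    linarith
  have h2 : 1 ≤ √(rad (p w) i + 1) := Real.one_le_sqrt.2 (by linarith)
  have h3 := mul_le_mul_of_nonneg_left h1 hb0
  have h4 := mul_le_mul_of_nonneg_right hK (Real.sqrt_nonneg (rad (p w) i + 1))
  linarith

/-- Almost surely, the radial distance at the collisions grows linearly, and the relative speed
sublinearly. -/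
theorem ae_escape [IsProbabilityMeasure ν]
    (hz : IsIID z (noiseLaw ν σ lam) μ) (hω : 0 < ω) (hσ : 0 < σ)
    (hlam : 0 < lam) (hν : ∀ᵐ n ∂ν, n ∈ Metric.ball (0 : E3) 1) (hR : IsRotationChoice R)
    (h₀ : ¬ IsStuck x₀ v₀) :
    ∃ β > 0, ∀ᵐ w ∂μ, (∀ᶠ i : ℕ in atTop, β * i ≤ rad (driven ω R x₀ v₀ z w) i) ∧
      ∀ δ > 0, ∀ᶠ i : ℕ in atTop, speedIn ω (driven ω R x₀ v₀ z w) i ≤ δ * i := by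
  obtain ⟨ε, c, hε, hε1, hc, hεc⟩ := exists_dissipative (σ := σ) hlam hν
  set p := driven ω R x₀ v₀ z with hp
  set C₀ := max 0 (∫ q : Noise, q.2.2 ∂noiseLaw ν σ lam) + 1 with hC₀
  have hC : 0 ≤ C₀ := by positivity
  have hCE : ∫ q : Noise, q.2.2 ∂noiseLaw ν σ lam < C₀ :=
    lt_of_le_of_lt (le_max_right 0 _) (lt_add_one _)
  -- The order of choice matters: `β` and `θ` depend on `ε`, `c`, `C₀` only, then `K` comes from the
  -- drift and contraction conditions, then `M` from the probability of good futures, and last the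
  -- radius `M₂`.
  obtain ⟨β, hβ, θ, hθ, hgrow⟩ := EnergyWalk.linear_growth hω hε hε1 hc hC
  have hE1 := integral_outcome_lt_one (σ := σ) hlam hν
  set Ea := ∫ q : Noise, ‖q.1‖ ∂noiseLaw ν σ lam
  set Eg := ∫ q, speedIncr ω q ∂noiseLaw ν σ lam
  set K := max (1 + 2 * ((2 + 4 * ω) / ε)) (Eg / (1 - Ea) + 1) with hKdef
  have hK1 : 1 + 2 * ((2 + 4 * ω) / ε) ≤ K := le_max_left _ _
  have hK0 : 0 < K := lt_of_lt_of_le (by positivity) hK1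
  have hKE : Eg / K < 1 - Ea := by
    rw [div_lt_iff₀ hK0]
    have h1 : Eg / (1 - Ea) < K := lt_of_lt_of_le (lt_add_one _) (le_max_right _ _)
    rw [div_lt_iff₀ (by linarith)] at h1
    linarith
  obtain ⟨M, hM, hfut⟩ := exists_goodFutures (K := K) (ω := ω) hz hlam hν hεc hCE hθ
  obtain ⟨M₂, hM₂⟩ := hgrow K M hK0.le hM
  set M₃ := max M₂ 0 with hM₃
  set S : ℕ → Set Ω := fun i => {w | M₃ ≤ rad (p w) i ∧
    speedIn ω (p w) i ≤ K * √(rad (p w) i + 1)} with hS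
  have hSm : ∀ i, MeasurableSet[past z hz.measurable i] (S i) := by
    intro i
    have hr := measurable_rad hω hR x₀ v₀ hz.measurable i
    have hu := measurable_speedIn hω hR x₀ v₀ hz.measurable i
    have h2 : Measurable fun t : ℝ => K * √(t + 1) := by fun_prop
    exact measurableSet_le_and_le measurable_const hr hu (h2.comp hr)
  refine ⟨β / 2, by positivity, ?_⟩
  filter_upwards [ae_frequently_speed_le hz hω hσ hlam hν hR h₀ hK0 hKE,
    ae_frequently_far hz hω hσ hlam hν hR h₀ hε hε1
      (outcome_ne_zero_of_dissipative (by linarith)) hK1 (le_max_right M₂ 0),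
    hz.frequently_and_future hSm (measurableSet_goodFutures ω K ε c C₀ θ M) hfut,
    ae_isTrajectory hz hω hσ hlam hν hR h₀] with w hvisit hfar hfuture ⟨hη, τ, hT⟩
  have hSfreq : ∃ᶠ i in atTop, w ∈ S i := by
    have h1 : ∃ᶠ i in atTop, (w ∈ S i ∨ (rad (p w) i ≤ M₃ ∧
        speedIn ω (p w) i ≤ K * √(rad (p w) i + 1))) := hvisit.mono fun i hi => by
      rcases le_total M₃ (rad (p w) i) with h | h
      · exact Or.inl ⟨h, hi⟩
      · exact Or.inr ⟨h, hi⟩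
    rcases frequently_or_distrib.1 h1 with h | h
    · exact h
    · exact hfar h
  obtain ⟨m, ⟨hr, hu⟩, hg⟩ := (hfuture hSfreq).exists
  have hW := (hT.energyWalk hω hR hη).shift m
  have hg' : GoodFuture ω K ε c C₀ θ M (fun k => ‖(z (m + k + 1) w).1‖)
      (fun k => ‖(z (m + k + 1) w).2.1‖) (fun k => (z (m + k + 1) w).2.2) := by
    have e : ∀ k, m + k + 1 = m + 1 + k := fun k => by omega
    simp only [e]
    exact hg
  have hgr := hM₂ _ _ _ _ _ _ hW hg' ((le_max_left _ _).trans hr) hu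
  refine ⟨?_, fun δ hδ => ?_⟩
  -- Growth at rate `β` starts at the random index `m`; halving the rate absorbs the delay once `i ≥
  -- 2 m`, so the rate stays deterministic.
  · filter_upwards [eventually_ge_atTop (2 * m)] with i hi
    obtain ⟨n, rfl⟩ := Nat.exists_eq_add_of_le (show m ≤ i by omega)
    have h1 := hgr n
    have h2 : (0 : ℝ) ≤ rad (p w) (m + 0) := hW.r_nonneg 0
    have h3 : (m : ℝ) ≤ n := by exact_mod_cast (by omega : m ≤ n)
    push_cast
    nlinarith
  · have hsub := hW.speed_sublinear hω.le hK0.le hC hM hg' hu hδ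
    obtain ⟨n₀, hn₀⟩ := eventually_atTop.1 hsub
    filter_upwards [eventually_ge_atTop (m + n₀)] with i hi
    obtain ⟨n, rfl⟩ := Nat.exists_eq_add_of_le (show m ≤ i by omega)
    refine (hn₀ n (by omega)).trans (mul_le_mul_of_nonneg_left ?_ hδ.le)
    exact_mod_cast (by omega : n ≤ m + n)

end Escape

/-! ### From collisions to continuous time. -/

lemma exists_interval {T : ℕ → ℝ} (hm : Monotone T) (hT : Tendsto T atTop atTop) {n : ℕ} {t : ℝ}
    (h : T (n + 1) ≤ t) : ∃ i, n ≤ i ∧ T (i + 1) ≤ t ∧ t < T (i + 1 + 1) := by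
  have hex : ∃ j, t < T j := (hT.eventually_gt_atTop t).exists
  classical
  have h1 := Nat.find_spec hex
  set j := Nat.find hex with hj
  have h2 : n + 1 < j := by
    by_contra hle
    exact absurd (lt_of_lt_of_le h1 (hm (not_lt.1 hle))) (not_lt.2 h)
  refine ⟨j - 2, by omega, ?_, ?_⟩
  · exact not_lt.1 (Nat.find_min hex (show j - 2 + 1 < Nat.find hex by omega))
  · rwa [show j - 2 + 1 + 1 = j by omega]

/-- Passage from events along the collisions to events in continuous time. -/
lemma ae_and_tendsto_measure_of_collisions {Ω : Type*} [MeasurableSpace Ω] {μ : Measure Ω}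
    [IsProbabilityMeasure μ] {T : ℕ → Ω → ℝ} (hTm : ∀ k, Measurable (T k))
    (hT : ∀ᵐ w ∂μ, (Monotone fun k => T k w) ∧ Tendsto (fun k => T k w) atTop atTop)
    {G : ℕ → Set Ω} (hGm : ∀ i, MeasurableSet (G i)) (hG : ∀ᵐ w ∂μ, ∀ᶠ i in atTop, w ∈ G i)
    {bad : ℝ → Set Ω} (hbad : ∀ᵐ w ∂μ, ∀ t i, T (i + 1) w ≤ t → t < T (i + 1 + 1) w → w ∈ G i →
      w ∉ bad t) :
    (∀ᵐ w ∂μ, ∀ᶠ t in atTop, w ∉ bad t) ∧ Tendsto (fun t => μ (bad t)) atTop (𝓝 0) := by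
  constructor
  · filter_upwards [hT, hG, hbad] with w ⟨hm, hlim⟩ hg hb
    obtain ⟨n, hn⟩ := eventually_atTop.1 hg
    filter_upwards [eventually_ge_atTop (T (n + 1) w)] with t ht
    obtain ⟨i, hi, h1, h2⟩ := exists_interval hm hlim ht
    exact hb t i h1 h2 (hn i hi)
  · set H : ℕ → Set Ω := fun n => ⋃ i, ⋃ (_ : n ≤ i), (G i)ᶜ with hH
    have hHlim : Tendsto (μ ∘ H) atTop (𝓝 (μ (⋂ n, H n))) := by
      refine tendsto_measure_iInter_atTop (fun n => ?_) ?_ ⟨0, measure_ne_top _ _⟩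
      · exact (MeasurableSet.iUnion fun i => MeasurableSet.iUnion fun _ =>
          (hGm i).compl).nullMeasurableSet
      · intro m n hmn
        exact Set.iUnion_mono fun i => Set.iUnion_mono' fun hi => ⟨hmn.trans hi, subset_rfl⟩
    have hH0 : μ (⋂ n, H n) = 0 := by
      refine measure_mono_null ?_ hG
      intro w hw hev
      obtain ⟨n, hn⟩ := eventually_atTop.1 hev
      obtain ⟨i, hi, h⟩ := Set.mem_iUnion₂.1 (Set.mem_iInter.1 hw n)
      exact h (hn i hi)
    rw [hH0] at hHlim
    have hK : ∀ n, Tendsto (fun t : ℝ => μ {w | t < T n w}) atTop (𝓝 0) := by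
      intro n
      have h1 : Tendsto (μ ∘ fun t : ℝ => {w | t < T n w}) atTop
          (𝓝 (μ (⋂ t : ℝ, {w | t < T n w}))) := by
        refine tendsto_measure_iInter_atTop (fun t => ?_) ?_ ⟨0, measure_ne_top _ _⟩
        · exact (measurableSet_lt measurable_const (hTm n)).nullMeasurableSet
        · intro s t hst w hw
          exact lt_of_le_of_lt hst hw
      have h2 : (⋂ t : ℝ, {w | t < T n w}) = ∅ := by
        ext w
        simp only [Set.mem_iInter, Set.mem_empty_iff_false, iff_false, not_forall]
        exact ⟨T n w, fun h => lt_irrefl (T n w) h⟩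
      rw [h2, measure_empty] at h1
      exact h1
    rw [ENNReal.tendsto_nhds_zero]
    intro ε hε
    have hε2 : 0 < ε / 2 := ENNReal.half_pos hε.ne'
    obtain ⟨n, hn⟩ := (ENNReal.tendsto_nhds_zero.1 hHlim (ε / 2) hε2).exists
    filter_upwards [ENNReal.tendsto_nhds_zero.1 (hK (n + 1)) (ε / 2) hε2] with t ht
    -- A bad time `t` means a failure of some `G i` with `i ≥ n`, or fewer than `n + 1` collisions
    -- so far. Only this inclusion is used, so `bad t` need not be measurable.
    calc μ (bad t) ≤ μ (H n ∪ {w | t < T (n + 1) w}) := by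
          refine measure_mono_ae ?_
          filter_upwards [hT, hbad] with w ⟨hm, hlim⟩ hb hw
          by_contra hcon
          have hcon' : w ∉ H n ∧ ¬ t < T (n + 1) w :=
            ⟨fun h => hcon (Or.inl h), fun h => hcon (Or.inr h)⟩
          obtain ⟨i, hi, h1, h2⟩ := exists_interval hm hlim (not_lt.1 hcon'.2)
          refine hb t i h1 h2 ?_ hw
          by_contra hGi
          exact hcon'.1 (Set.mem_iUnion₂.2 ⟨i, hi, hGi⟩)
      _ ≤ μ (H n) + μ {w | t < T (n + 1) w} := measure_union_le _ _
      _ ≤ ε / 2 + ε / 2 := add_le_add hn ht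
      _ = ε := ENNReal.add_halves ε

section Asymptotics

variable {ω : ℝ} {p : ℕ → ParticleState} {R : E3 → Matrix (Fin 3) (Fin 3) ℝ} {η Δ : ℕ → E3}
  {ξ τ : ℕ → ℝ}

namespace IsTrajectory

lemma max_speed_sublinear (hT : IsTrajectory ω p R η Δ ξ τ) (hω : 0 < ω) (hR : IsRotationChoice R)
    (hη : ∀ k, ‖η k‖ ≤ 1)
    (hu : ∀ δ > 0, ∀ᶠ i : ℕ in atTop, speedIn ω p i ≤ δ * i)
    (hn : ∀ δ > 0, ∀ᶠ i : ℕ in atTop, ‖Δ (i + 1)‖ + |ξ (i + 1)| ≤ δ * i) {δ : ℝ} (hδ : 0 < δ) :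
    ∀ᶠ i : ℕ in atTop, max (speedOut ω p i) (speedIn ω p (i + 1)) ≤ δ * i := by
  have hW := hT.energyWalk hω hR hη
  have hδ3 : 0 < δ / 3 := by positivity
  filter_upwards [hu _ hδ3, hn _ hδ3, (tendsto_add_atTop_nat 1).eventually (hu _ hδ3),
    eventually_ge_atTop 1] with i h1 h2 h3 h4
  have h4' : (1 : ℝ) ≤ i := by exact_mod_cast h4
  refine max_le ?_ ?_
  · have h5 := hW.collision' i
    have h6 : ‖η (i + 1)‖ * speedIn ω p i ≤ speedIn ω p i :=
      mul_le_of_le_one_left (norm_nonneg _) (hη _)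
    have := abs_nonneg (ξ (i + 1))
    linarith
  · push_cast at h3
    nlinarith

/-- The first `n` flights after the first collision have total length at least `c n` at relative
speed at most `δ n + |C|`, so their total duration is at least about `c / δ`, with `δ` arbitrary. -/
lemma tendsto_time (hT : IsTrajectory ω p R η Δ ξ τ) (h0 : (p 0).time = 0)
    (hm : ∀ δ > 0, ∀ᶠ i : ℕ in atTop, max (speedOut ω p i) (speedIn ω p (i + 1)) ≤ δ * i)
    {c : ℝ} (hc : 0 < c) (hsum : ∀ᶠ n : ℕ in atTop, c * n ≤ ∑ i ∈ Finset.range n, ξ (i + 1)) :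
    Tendsto (fun k => (p k).time) atTop atTop := by
  rw [tendsto_atTop]
  intro B₀
  set B := |B₀| + 1 with hB
  have hB0 : 0 < B := by positivity
  -- If the time stayed below `B`, the path length would be at most `c n / 2 + B |C|`, which is less
  -- than `c n` for large `n`.
  set δ := c / (2 * B) with hδd
  have hδ : 0 < δ := by positivity
  obtain ⟨C, hC⟩ := exists_forall_le_of_eventually
    (x := fun i : ℕ => max (speedOut ω p i) (speedIn ω p (i + 1)) - δ * i) (by
      filter_upwards [hm δ hδ] with i hi
      linarith)
  have hT0 : ∀ k, 0 ≤ (p k).time := fun k => by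
    rw [← h0]; exact hT.strictMono_time.monotone (Nat.zero_le k)
  have hbound : ∀ n : ℕ, ∑ i ∈ Finset.range n, ξ (i + 1) ≤ (p (n + 1)).time * (δ * n + |C|) := by
    intro n
    have h1 : ∀ i ∈ Finset.range n, ξ (i + 1) ≤ τ (i + 1) * (δ * n + |C|) := by
      intro i hi
      have hin : (i : ℝ) ≤ n := by exact_mod_cast (Finset.mem_range.1 hi).le
      refine (hT.le_duration i).trans (mul_le_mul_of_nonneg_left ?_ (hT.pos_τ _).le)
      nlinarith [hC i, le_abs_self C]
    refine (Finset.sum_le_sum h1).trans ?_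
    rw [← Finset.sum_mul]
    refine mul_le_mul_of_nonneg_right ?_ (by positivity)
    have h2 : ∀ n : ℕ, ∑ i ∈ Finset.range n, τ (i + 1) = (p (n + 1)).time - (p 1).time := by
      intro n
      induction n with
      | zero => simp
      | succ n ih => rw [Finset.sum_range_succ, ih, hT.time (n + 1)]; ring
    rw [h2]
    linarith [hT0 1]
  have hev : ∀ᶠ n : ℕ in atTop, B₀ ≤ (p (n + 1)).time := by
    filter_upwards [hsum, tendsto_natCast_atTop_atTop.eventually_gt_atTop (2 * B * |C| / c)]
      with n h1 h2
    rw [div_lt_iff₀ hc] at h2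
    by_contra hlt
    push Not at hlt
    have h3 : (p (n + 1)).time ≤ B := by linarith [le_abs_self B₀]
    have h4 : (p (n + 1)).time * (δ * n + |C|) ≤ B * (δ * n + |C|) :=
      mul_le_mul_of_nonneg_right h3 (by positivity)
    have h5 : B * (δ * n) = c * n / 2 := by rw [hδd]; field_simp
    nlinarith [hbound n]
  obtain ⟨m, hm'⟩ := eventually_atTop.1 hev
  filter_upwards [eventually_ge_atTop (m + 1)] with k hk
  obtain ⟨n, rfl⟩ := Nat.exists_eq_add_of_le' (show 1 ≤ k by omega)
  exact hm' n (by omega)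

end IsTrajectory

end Asymptotics

lemma IsCollisionNoise.isIID {Ω : Type*} [MeasurableSpace Ω] {μ : Measure Ω} {ν : Measure E3}
    {σ lam : ℝ} {η Δ : ℕ → Ω → E3} {ξ : ℕ → Ω → ℝ} (h : IsCollisionNoise μ ν σ lam η Δ ξ) :
    IsIID (fun k w => (η k w, Δ k w, ξ k w)) (noiseLaw ν σ lam) μ where
  measurable k := (h.measurable_η k).prodMk ((h.measurable_Δ k).prodMk (h.measurable_ξ k))
  indep := h.indep
  law := h.law

lemma integral_path_pos {ν : Measure E3} [IsProbabilityMeasure ν] {σ lam : ℝ} (hlam : 0 < lam)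
    (hν : ∀ᵐ n ∂ν, n ∈ Metric.ball (0 : E3) 1) : 0 < ∫ q : Noise, q.2.2 ∂noiseLaw ν σ lam := by
  have := isProbabilityMeasure_noiseLaw (ν := ν) (σ := σ) hlam
  have hae := ae_noiseLaw (σ := σ) hlam hν
  rw [integral_pos_iff_support_of_nonneg_ae ?_ ((memLp_path hlam).integrable (by norm_num))]
  · have : (Function.support fun q : Noise => q.2.2) =ᵐ[noiseLaw ν σ lam] Set.univ := by
      rw [eventuallyEq_univ]
      filter_upwards [hae] with q hq
      exact hq.2.ne'
    rw [measure_congr this]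
    simp
  · filter_upwards [hae] with q hq
    exact hq.2.le

lemma measurable_time {Ω : Type*} [MeasurableSpace Ω] {ω : ℝ} {R : E3 → Matrix (Fin 3) (Fin 3) ℝ}
    {z : ℕ → Ω → Noise} (hz : ∀ k, Measurable (z k)) (hω : 0 < ω) (hR : IsRotationChoice R)
    (x₀ v₀ : E3) (k : ℕ) : Measurable fun w => (driven ω R x₀ v₀ z w k).time := by
  cases k with
  | zero => exact measurable_const
  | succ k =>
    exact (measurable_driven hω hR x₀ v₀ hz k).2.2.mono ((past z hz).le _) le_rfl

/-! ### Long-time behaviour in continuous time. -/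

section LongTime

variable {Ω : Type*} [MeasurableSpace Ω] {μ : Measure Ω} [IsProbabilityMeasure μ] {ω : ℝ}
  {R : E3 → Matrix (Fin 3) (Fin 3) ℝ} {z : ℕ → Ω → Noise} {ν : Measure E3} [IsProbabilityMeasure ν]
  {σ lam : ℝ} {x₀ v₀ : E3}

/-- The behaviour of almost every path along the collisions: the radial distance grows linearly, all
other quantities sublinearly, and the collision times tend to infinity. -/
theorem ae_long_time (hz : IsIID z (noiseLaw ν σ lam) μ) (hω : 0 < ω) (hσ : 0 < σ)
    (hlam : 0 < lam) (hν : ∀ᵐ n ∂ν, n ∈ Metric.ball (0 : E3) 1) (hR : IsRotationChoice R)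
    (h₀ : ¬ IsStuck x₀ v₀) :
    ∃ β > 0, ∀ᵐ w ∂μ,
      (∃ τ, IsTrajectory ω (driven ω R x₀ v₀ z w) R
        (fun k => (z k w).1) (fun k => (z k w).2.1) (fun k => (z k w).2.2) τ) ∧
      Tendsto (fun k => (driven ω R x₀ v₀ z w k).time) atTop atTop ∧
      (∀ᶠ i : ℕ in atTop, β * i ≤ rad (driven ω R x₀ v₀ z w) i) ∧
      (∀ δ > 0, ∀ᶠ i : ℕ in atTop, (z (i + 1) w).2.2 ≤ δ * i) ∧
      ∀ δ > 0, ∀ᶠ i : ℕ in atTop, max (speedOut ω (driven ω R x₀ v₀ z w) i)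
        (speedIn ω (driven ω R x₀ v₀ z w) (i + 1)) ≤ δ * i := by
  obtain ⟨β, hβ, hesc⟩ := ae_escape hz hω hσ hlam hν hR h₀
  have hE := integral_path_pos (σ := σ) hlam hν
  have := isProbabilityMeasure_noiseLaw (ν := ν) (σ := σ) hlam
  have hnoise := hz.sublinear (g := fun q : Noise => ‖q.2.1‖ + |q.2.2|) (by fun_prop)
    ((memLp_thermal hlam).add (memLp_path hlam).norm)
  have hpath := (hz.shift 1).strong_law (f := fun q : Noise => q.2.2) (by fun_prop)
    ((memLp_path hlam).integrable (by norm_num))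
  refine ⟨β, hβ, ?_⟩
  filter_upwards [ae_isTrajectory hz hω hσ hlam hν hR h₀, hesc, hnoise, hpath]
    with w ⟨hη, τ, hT⟩ ⟨h1, h2⟩ h3 h4
  have hm := fun (δ : ℝ) (hδ : 0 < δ) => hT.max_speed_sublinear hω hR hη h2 h3 hδ
  refine ⟨⟨τ, hT⟩, hT.tendsto_time rfl hm (half_pos hE) ?_, h1, fun δ hδ => ?_, hm⟩
  · filter_upwards [h4.eventually_const_le (half_lt_self hE), eventually_gt_atTop 0] with n hn hn0
    rw [le_div_iff₀ (by exact_mod_cast hn0)] at hn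
    simpa only [add_comm 1] using hn
  · filter_upwards [h3 δ hδ] with i hi
    linarith [le_abs_self (z (i + 1) w).2.2, norm_nonneg (z (i + 1) w).2.1]

/-- The event `G i` keeps the whole flight after collision `i + 1` beyond `M`. It holds eventually,
since `rad` grows linearly and path lengths sublinearly. -/
theorem radialDist_escape (hz : IsIID z (noiseLaw ν σ lam) μ) (hω : 0 < ω) (hσ : 0 < σ)
    (hlam : 0 < lam) (hν : ∀ᵐ n ∂ν, n ∈ Metric.ball (0 : E3) 1) (hR : IsRotationChoice R)
    (h₀ : ¬ IsStuck x₀ v₀) (M : ℝ) :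
    (∀ᵐ w ∂μ, ∀ᶠ t in atTop, w ∉ {w | radialDist (posAt (driven ω R x₀ v₀ z w) t) ≤ M}) ∧
    Tendsto (fun t : ℝ => μ {w | radialDist (posAt (driven ω R x₀ v₀ z w) t) ≤ M}) atTop (𝓝 0) := by
  obtain ⟨β, hβ, hlong⟩ := ae_long_time hz hω hσ hlam hν hR h₀
  refine ae_and_tendsto_measure_of_collisions
    (G := fun i => {w | M < rad (driven ω R x₀ v₀ z w) i - 2 * (z (i + 1) w).2.2})
    (measurable_time hz.measurable hω hR x₀ v₀) ?_ (fun i => ?_) ?_ ?_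
  · filter_upwards [hlong] with w ⟨⟨τ, hT⟩, hlim, _⟩
    exact ⟨hT.strictMono_time.monotone, hlim⟩
  · have h1 := (measurable_rad hω hR x₀ v₀ hz.measurable i).mono
      ((past z hz.measurable).le _) le_rfl
    have h2 := hz.measurable (i + 1)
    exact measurableSet_lt measurable_const (h1.sub (by fun_prop))
  · filter_upwards [hlong] with w ⟨_, _, h1, h2, _⟩
    filter_upwards [h1, h2 (β / 4) (by positivity),
      tendsto_natCast_atTop_atTop.eventually_gt_atTop (2 * M / β)] with i hi1 hi2 hi3
    rw [div_lt_iff₀ hβ] at hi3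
    linarith
  · filter_upwards [hlong] with w ⟨⟨τ, hT⟩, _⟩ t i h1 h2 hG hbad
    exact absurd (lt_of_lt_of_le hG (hT.radialDist_posAt_ge h1 h2)) (not_lt.2 hbad)

/-- Along a flight the numerator is sublinear and the denominator at least of order `β i / 2`; the
first event in `G i` keeps that denominator positive. -/
theorem relError_vanish (hz : IsIID z (noiseLaw ν σ lam) μ) (hω : 0 < ω) (hσ : 0 < σ)
    (hlam : 0 < lam) (hν : ∀ᵐ n ∂ν, n ∈ Metric.ball (0 : E3) 1) (hR : IsRotationChoice R)
    (h₀ : ¬ IsStuck x₀ v₀) {δ : ℝ} (hδ : 0 < δ) :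
    (∀ᵐ w ∂μ, ∀ᶠ t in atTop, w ∉ {w | δ < relError ω (driven ω R x₀ v₀ z w) t}) ∧
    Tendsto (fun t : ℝ => μ {w | δ < relError ω (driven ω R x₀ v₀ z w) t}) atTop (𝓝 0) := by
  obtain ⟨β, hβ, hlong⟩ := ae_long_time hz hω hσ hlam hν hR h₀
  refine ae_and_tendsto_measure_of_collisions
    (G := fun i => {w | 0 < rad (driven ω R x₀ v₀ z w) i - 2 * (z (i + 1) w).2.2} ∩
      {w | max (speedOut ω (driven ω R x₀ v₀ z w) i) (speedIn ω (driven ω R x₀ v₀ z w) (i + 1)) ≤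
        δ * (ω * (rad (driven ω R x₀ v₀ z w) i - 2 * (z (i + 1) w).2.2))})
    (measurable_time hz.measurable hω hR x₀ v₀) ?_ (fun i => ?_) ?_ ?_
  · filter_upwards [hlong] with w ⟨⟨τ, hT⟩, hlim, _⟩
    exact ⟨hT.strictMono_time.monotone, hlim⟩
  · have h1 := (measurable_rad hω hR x₀ v₀ hz.measurable i).mono
      ((past z hz.measurable).le _) le_rfl
    have h2 := hz.measurable (i + 1)
    have h3 : Measurable fun w =>
        rad (driven ω R x₀ v₀ z w) i - 2 * (z (i + 1) w).2.2 := h1.sub (by fun_prop)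
    have h4 := (measurable_speedIn hω hR x₀ v₀ hz.measurable (i + 1)).mono
      ((past z hz.measurable).le _) le_rfl
    have h5 := measurable_speedOut hω hR x₀ v₀ hz.measurable i
    exact (measurableSet_lt measurable_const h3).inter
      (measurableSet_le (h5.max h4) ((h3.const_mul ω).const_mul δ))
  · filter_upwards [hlong] with w ⟨_, _, h1, h2, h3⟩
    filter_upwards [h1, h2 (β / 4) (by positivity), h3 (δ * (ω * (β / 2))) (by positivity),
      eventually_gt_atTop 0] with i hi1 hi2 hi3 hi4
    have hi : (0 : ℝ) < i := by exact_mod_cast hi4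
    have h : β / 2 * i ≤ rad (driven ω R x₀ v₀ z w) i - 2 * (z (i + 1) w).2.2 := by linarith
    refine ⟨lt_of_lt_of_le (by positivity) h, hi3.trans ?_⟩
    rw [mul_assoc, mul_assoc]
    gcongr
  · filter_upwards [hlong] with w ⟨⟨τ, hT⟩, _⟩ t i h1 h2 hG hbad
    exact absurd (hT.relError_le hω h1 h2 hδ.le hG.1 hG.2) (not_le.2 hbad)

end LongTime

lemma relError_nonneg (ω : ℝ) (p : ℕ → ParticleState) (t : ℝ) : 0 ≤ relError ω p t :=
  div_nonneg (norm_nonneg _) (norm_nonneg _)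

end RotatingWalk

/-! ### The theorem. -/

theorem theorem1 {Ω : Type*} [MeasurableSpace Ω] (μ : Measure Ω) [IsProbabilityMeasure μ]
    (ω lam σ : ℝ) (hω : 0 < ω) (hlam : 0 < lam) (hσ : 0 < σ)
    -- the law of the normalised collision: on the open unit ball, support with nonempty interior
    (ν : Measure RotatingWalk.E3) [IsProbabilityMeasure ν]
    (hν_ball : ∀ᵐ n ∂ν, n ∈ Metric.ball (0 : RotatingWalk.E3) 1)
    (hν_supp : (interior ν.support).Nonempty)
    (R : RotatingWalk.E3 → Matrix (Fin 3) (Fin 3) ℝ) (hR : RotatingWalk.IsRotationChoice R)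
    (η Δ : ℕ → Ω → RotatingWalk.E3) (ξ : ℕ → Ω → ℝ)
    (hnoise : RotatingWalk.IsCollisionNoise μ ν σ lam η Δ ξ)
    (x₀ v₀ : RotatingWalk.E3)
    -- the particle does not start at rest on the rotation axis, where it would never collide
    (h₀ : ¬ (RotatingWalk.radialDist x₀ = 0 ∧ v₀ = 0))
    (p : Ω → ℕ → RotatingWalk.ParticleState)
    (hp : p = fun w => RotatingWalk.particle ω R (fun k => η k w) (fun k => Δ k w)
      (fun k => ξ k w) x₀ v₀) :
    -- the particle is almost surely well defined for all times
    (∀ᵐ w ∂μ,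
      (∀ k, RotatingWalk.relDist ω (p w k).pos (p w k).vel ((p w (k + 1)).time - (p w k).time)
        = ξ k w) ∧
      StrictMono (fun k => (p w k).time) ∧ Tendsto (fun k => (p w k).time) atTop atTop) ∧
    -- the radial distance tends to infinity, almost surely and in probability
    (∀ᵐ w ∂μ, Tendsto (fun t : ℝ => RotatingWalk.radialDist (RotatingWalk.posAt (p w) t))
      atTop atTop) ∧
    (∀ M : ℝ, Tendsto
      (fun t : ℝ => μ {w | RotatingWalk.radialDist (RotatingWalk.posAt (p w) t) ≤ M})
      atTop (𝓝 0)) ∧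
    -- the velocity divided by the velocity of the space tends to one, likewise
    (∀ᵐ w ∂μ, Tendsto (fun t : ℝ => RotatingWalk.relError ω (p w) t) atTop (𝓝 0)) ∧
    TendstoInMeasure μ (fun (t : ℝ) w => RotatingWalk.relError ω (p w) t) atTop (fun _ => 0) ∧
    -- linear growth along the collisions
    (∃ β : ℝ, 0 < β ∧
      ∀ᵐ w ∂μ, ∀ᶠ n : ℕ in atTop, β * n < RotatingWalk.radialDist (p w n).pos) := by
  have hz := hnoise.isIID
  have hpz : p = RotatingWalk.driven ω R x₀ v₀ fun k w => (η k w, Δ k w, ξ k w) := hp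
  clear hp
  subst hpz
  refine ⟨?_, ?_, fun M =>
    (RotatingWalk.radialDist_escape hz hω hσ hlam hν_ball hR h₀ M).2, ?_, ?_, ?_⟩
  · obtain ⟨β, -, hlong⟩ := RotatingWalk.ae_long_time hz hω hσ hlam hν_ball hR h₀
    filter_upwards [hlong] with w ⟨⟨τ, hT⟩, hlim, _⟩
    refine ⟨fun k => ?_, hT.strictMono_time, hlim⟩
    rw [hT.time k, add_sub_cancel_left]
    exact hT.dist k
  · have hall : ∀ᵐ w ∂μ, ∀ M : ℕ, _ := ae_all_iff.2 fun M : ℕ =>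
      (RotatingWalk.radialDist_escape hz hω hσ hlam hν_ball hR h₀ M).1
    filter_upwards [hall] with w hw
    rw [tendsto_atTop]
    intro B
    obtain ⟨M, hM⟩ := exists_nat_ge B
    filter_upwards [hw M] with t ht
    exact hM.trans (not_le.1 ht).le
  · have hall : ∀ᵐ w ∂μ, ∀ n : ℕ, _ := ae_all_iff.2 fun n : ℕ =>
      (RotatingWalk.relError_vanish hz hω hσ hlam hν_ball hR h₀
        (Nat.one_div_pos_of_nat (α := ℝ) (n := n))).1
    filter_upwards [hall] with w hw
    refine tendsto_order.2 ⟨fun a ha => Eventually.of_forall fun t =>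
      ha.trans_le (RotatingWalk.relError_nonneg _ _ _), fun a ha => ?_⟩
    obtain ⟨n, hn⟩ := exists_nat_one_div_lt ha
    filter_upwards [hw n] with t ht
    exact (not_lt.1 ht).trans_lt hn
  · rw [tendstoInMeasure_iff_norm]
    intro ε hε
    refine tendsto_of_tendsto_of_tendsto_of_le_of_le tendsto_const_nhds
      (RotatingWalk.relError_vanish hz hω hσ hlam hν_ball hR h₀ (half_pos hε)).2
      (fun t => zero_le) (fun t => measure_mono fun w hw => ?_)
    rw [Set.mem_ofPred_eq, sub_zero, Real.norm_of_nonneg (RotatingWalk.relError_nonneg _ _ _)] at hw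
    exact (half_lt_self hε).trans_le hw
  · obtain ⟨β, hβ, hlong⟩ := RotatingWalk.ae_long_time hz hω hσ hlam hν_ball hR h₀
    -- Collision `n + 1` is index `n` of the walk; the smaller rate absorbs this shift and gives a
    -- strict inequality.
    refine ⟨β / 4, by positivity, ?_⟩
    filter_upwards [hlong] with w ⟨_, _, h1, _⟩
    obtain ⟨m, hm⟩ := eventually_atTop.1 h1
    filter_upwards [eventually_ge_atTop (m + 2)] with k hk
    obtain ⟨n, rfl⟩ := Nat.exists_eq_add_of_le' (show 1 ≤ k by omega)
    have hn : (1 : ℝ) ≤ n := by exact_mod_cast (show 1 ≤ n by omega)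
    refine lt_of_lt_of_le ?_ (hm n (by omega))
    push_cast
    nlinarith
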